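/- Let $(M,g)$ be a nonempty smooth Riemannian manifold of dimension $n\ge 2$, let $\pi:T^*M\to M$ be its cotangent bundle, and split $TT^*M=VT^*M\oplus HT^*M$ by means of the Levi-Civita connection of $g$. Write $X^H$ for the horizontal lift of a vector $X$, $\alpha^V$ for the vertical lift of a covector $\alpha$, $\flat,\sharp$ for the musical isomorphisms of $g$, and $t=\tfrac12 g^{-1}(p,p)$ for the energy density at $p\in T^*M$. Let $a_1,b_1,a_2,b_2,c_1,d_1,c_2,d_2$ be smooth functions on $[0,\infty)$, and define on $T^*M$ the natural diagonal tensor fields $P$ and $G$ by $$PX^H_p=a_1(t)(X^\flat)^V_p+b_1(t)\,p(X)\,p^V_p,\qquad P\alpha^V_p=a_2(t)(\alpha^\sharp)^H_p+b_2(t)\,g^{-1}(p,\alpha)\,(p^\sharp)^H_p,$$ $$G_p(X^H,Y^H)=c_1(t)g(X,Y)+d_1(t)p(X)p(Y),\quad G_p(\alpha^V,\omega^V)=c_2(t)g^{-1}(\alpha,\omega)+d_2(t)g^{-1}(p,\alpha)g^{-1}(p,\omega),\quad G_p(X^H,\alpha^V)=0.$$ Assume that $(G,P)$ is an almost para-Hermitian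 structure: $G$ is a nondegenerate metric, $P^2=I$ and $G(PX,PY)=-G(X,Y)$. Then there are smooth functions $\lambda,\mu$ on $[0,\infty)$ with $$\frac{c_1}{a_1}=-\frac{c_2}{a_2}=\lambda,\qquad \frac{c_1+2td_1}{a_1+2tb_1}=-\frac{c_2+2td_2}{a_2+2tb_2}=\lambda+2t\mu\qquad(t\ge 0),$$ where no denominator vanishes, and for any such $\lambda,\mu$: 1. $(G,P)$ is para-Kählerian (that is, $P$ is integrable and the $2$-form $\Omega(X,Y)=G(X,PY)$ is closed) if and only if $P$ is a locally product structure (that is, $P^2=I$ and the Nijenhuis tensor field of $P$ vanishes) and $\mu=\lambda'$ on $[0,\infty)$. 2. $P$ is a locally product structure if and only if there is a constant $c$ such that $(M,g)$ has constant sectional curvature $c$ and, for all $t\ge 0$, $$b_1=\frac{a_1a_1'+c}{a_1-2ta_1'},\qquad b_2=\frac{a_1a_2'-a_2^2c}{a_1+2cta_2},$$ where the denominators do not vanish. -/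

import Mathlib

set_option maxSynthPendingDepth 3

open scoped Manifold ContDiff

noncomputable section

namespace ParaKahlerCotangent

open Bundle ContinuousLinearMap

section GeneralManifold

/-! ### Almost product and almost para-Hermitian structures on a smooth manifold `N` -/

variable {F : Type*} [NormedAddCommGroup F] [NormedSpace ℝ F]
  {H : Type*} [TopologicalSpace H] (I : ModelWithCorners ℝ F H)
  {N : Type*} [TopologicalSpace N] [ChartedSpace H N] [IsManifold I 1 N]

/-- The vector field `V` on `N` is smooth near the point `p`. -/
def SmoothFieldAt (V : ∀ p : N, TangentSpace I p) (p : N) : Prop :=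
  ContMDiffAt I I.tangent ∞ (fun q ↦ (⟨q, V q⟩ : TangentBundle I N)) p

/-- The vector field `J V`. -/
def applyField (J : ∀ p : N, TangentSpace I p →L[ℝ] TangentSpace I p)
    (V : ∀ p : N, TangentSpace I p) : ∀ p : N, TangentSpace I p :=
  fun p ↦ J p (V p)

/-- The Nijenhuis field `[JV, JW] - J[JV, W] - J[V, JW] + J²[V, W]` of a `(1, 1)`-tensor field. -/
def nijenhuis (J : ∀ p : N, TangentSpace I p →L[ℝ] TangentSpace I p)
    (V W : ∀ p : N, TangentSpace I p) (p : N) : TangentSpace I p :=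
  VectorField.mlieBracket I (applyField I J V) (applyField I J W) p
    - J p (VectorField.mlieBracket I (applyField I J V) W p)
    - J p (VectorField.mlieBracket I V (applyField I J W) p)
    + J p (J p (VectorField.mlieBracket I V W p))

/-- `J` is an almost product structure: `J² = 1`. -/
def IsAlmostProduct (J : ∀ p : N, TangentSpace I p →L[ℝ] TangentSpace I p) : Prop :=
  ∀ (p : N) (w : TangentSpace I p), J p (J p w) = w

/-- `J` is a locally product structure: an almost product structure which is integrable, that is,
whose Nijenhuis tensor field vanishes. -/
def IsLocallyProduct (J : ∀ p : N, TangentSpace I p →L[ℝ] TangentSpace I p) : Prop :=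
  IsAlmostProduct I J ∧
    ∀ (p : N) (V W : ∀ q : N, TangentSpace I q),
      SmoothFieldAt I V p → SmoothFieldAt I W p → nijenhuis I J V W p = 0

/-- `(G, J)` is an almost para-Hermitian structure: `G` is a pseudo-Riemannian metric (symmetric and
nondegenerate), `J² = 1` and `G(JX, JY) = -G(X, Y)`. -/
structure IsAlmostParaHermitian
    (G : ∀ p : N, TangentSpace I p →L[ℝ] TangentSpace I p →L[ℝ] ℝ)
    (J : ∀ p : N, TangentSpace I p →L[ℝ] TangentSpace I p) : Prop where
  symm : ∀ (p : N) (v w : TangentSpace I p), G p v w = G p w v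
  nondegenerate : ∀ (p : N) (v : TangentSpace I p), (∀ w : TangentSpace I p, G p v w = 0) → v = 0
  almostProduct : IsAlmostProduct I J
  compatible : ∀ (p : N) (v w : TangentSpace I p), G p (J p v) (J p w) = -G p v w

/-- The associated `2`-form `Ω(X, Y) = G(X, JY)`. -/
def associatedForm (G : ∀ p : N, TangentSpace I p →L[ℝ] TangentSpace I p →L[ℝ] ℝ)
    (J : ∀ p : N, TangentSpace I p →L[ℝ] TangentSpace I p)
    (p : N) (v w : TangentSpace I p) : ℝ :=
  G p v (J p w)

/-- The derivative `V f` at `p` of a function `f` along a vector field `V`. -/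
def dirDeriv (V : ∀ p : N, TangentSpace I p) (f : N → ℝ) (p : N) : ℝ :=
  mfderiv I 𝓘(ℝ, ℝ) f p (V p)

/-- The exterior derivative of a `2`-form, evaluated on three vector fields:
`dΨ(U, V, W) = U Ψ(V, W) - V Ψ(U, W) + W Ψ(U, V) - Ψ([U, V], W) + Ψ([U, W], V) - Ψ([V, W], U)`. -/
def extDerivTwoForm (Ψ : ∀ p : N, TangentSpace I p → TangentSpace I p → ℝ)
    (U V W : ∀ p : N, TangentSpace I p) (p : N) : ℝ :=
  dirDeriv I U (fun q ↦ Ψ q (V q) (W q)) p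
    - dirDeriv I V (fun q ↦ Ψ q (U q) (W q)) p
    + dirDeriv I W (fun q ↦ Ψ q (U q) (V q)) p
    - Ψ p (VectorField.mlieBracket I U V p) (W p)
    + Ψ p (VectorField.mlieBracket I U W p) (V p)
    - Ψ p (VectorField.mlieBracket I V W p) (U p)

/-- The `2`-form `Ψ` is closed. -/
def IsClosedTwoForm (Ψ : ∀ p : N, TangentSpace I p → TangentSpace I p → ℝ) : Prop :=
  ∀ (p : N) (U V W : ∀ q : N, TangentSpace I q),
    SmoothFieldAt I U p → SmoothFieldAt I V p → SmoothFieldAt I W p →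
      extDerivTwoForm I Ψ U V W p = 0

/-- `(G, J)` is almost para-Kählerian: almost para-Hermitian with closed associated `2`-form. -/
def IsAlmostParaKahler (G : ∀ p : N, TangentSpace I p →L[ℝ] TangentSpace I p →L[ℝ] ℝ)
    (J : ∀ p : N, TangentSpace I p →L[ℝ] TangentSpace I p) : Prop :=
  IsAlmostParaHermitian I G J ∧ IsClosedTwoForm I (associatedForm I G J)

/-- `(G, J)` is para-Kählerian: almost para-Kählerian, with `J` integrable. -/
def IsParaKahler (G : ∀ p : N, TangentSpace I p →L[ℝ] TangentSpace I p →L[ℝ] ℝ)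
    (J : ∀ p : N, TangentSpace I p →L[ℝ] TangentSpace I p) : Prop :=
  IsAlmostParaKahler I G J ∧ IsLocallyProduct I J

end GeneralManifold

section Base

/-! ### The base: a smooth Riemannian manifold `(M, g)` modelled on `E`

The tangent space `T_x M` is `E`, through the chart at `x`. -/

variable {E : Type*} [NormedAddCommGroup E] [NormedSpace ℝ E]
  {M : Type*} [TopologicalSpace M] [ChartedSpace E M] [IsManifold 𝓘(ℝ, E) ∞ M]

/-- Smooth Riemannian metrics on `M`. -/
abbrev Metric (E : Type*) [NormedAddCommGroup E] [NormedSpace ℝ E]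
    (M : Type*) [TopologicalSpace M] [ChartedSpace E M] [IsManifold 𝓘(ℝ, E) ∞ M] :=
  ContMDiffRiemannianMetric 𝓘(ℝ, E) ∞ E (fun x : M ↦ TangentSpace 𝓘(ℝ, E) x)

/-- `X ↦ X♭`, that is `g_x` itself. -/
def flat (g : Metric E M) (x : M) : E →L[ℝ] E →L[ℝ] ℝ := g.inner x

/-- `α ↦ α♯`, the inverse of `X ↦ X♭`. -/
def sharp (g : Metric E M) (x : M) : (E →L[ℝ] ℝ) →L[ℝ] E := (flat g x).inverse

/-- The metric `g⁻¹(α, β) = α(β♯)` on the cotangent space at `x`. -/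
def cometric (g : Metric E M) (x : M) : (E →L[ℝ] ℝ) →L[ℝ] (E →L[ℝ] ℝ) →L[ℝ] ℝ :=
  (compL ℝ (E →L[ℝ] ℝ) E ℝ).flip (sharp g x)

/-- The differential at `y` of the inverse of the chart of `M` at `x`: it sends the coordinate
vectors to the coordinate vector fields. -/
def chartFrame (x : M) (y : E) :
    E →L[ℝ] TangentSpace 𝓘(ℝ, E) ((extChartAt 𝓘(ℝ, E) x).symm y) :=
  mfderiv 𝓘(ℝ, E) 𝓘(ℝ, E) (extChartAt 𝓘(ℝ, E) x).symm y

/-- The metric in the chart at `x`, at the point with coordinates `y`: the matrix `g_ij(y)` as a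
bilinear form on `E`. -/
def chartMetric (g : Metric E M) (x : M) (y : E) : E →L[ℝ] E →L[ℝ] ℝ :=
  (flat g ((extChartAt 𝓘(ℝ, E) x).symm y)).bilinearComp (chartFrame x y) (chartFrame x y)

/-- Exchanging the arguments of a bilinear form. -/
def flipCLM (E : Type*) [NormedAddCommGroup E] [NormedSpace ℝ E] :
    (E →L[ℝ] E →L[ℝ] ℝ) →L[ℝ] E →L[ℝ] E →L[ℝ] ℝ :=
  (flipₗᵢ ℝ E E ℝ).toContinuousLinearEquiv

/-- The Christoffel symbols of the first kind in the chart at `x`: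
`(u, v, w) ↦ (∂_u g(v, w) + ∂_v g(u, w) - ∂_w g(u, v)) / 2`. -/
def christoffelFirst (g : Metric E M) (x : M) (y : E) : E →L[ℝ] E →L[ℝ] E →L[ℝ] ℝ :=
  (1 / 2 : ℝ) • (fderiv ℝ (chartMetric g x) y + (fderiv ℝ (chartMetric g x) y).flip
    - flipCLM E ∘L (fderiv ℝ (chartMetric g x) y).flip)

/-- The Christoffel symbols `Γ(u, v)` of the Levi-Civita connection in the chart at `x`. -/
def christoffel (g : Metric E M) (x : M) (y : E) : E →L[ℝ] E →L[ℝ] E :=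
  (compL ℝ E (E →L[ℝ] ℝ) E (chartMetric g x y).inverse) ∘L christoffelFirst g x y

/-- The Christoffel symbols at the point `x`, in the chart at `x`. -/
def christoffelAt (g : Metric E M) (x : M) : E →L[ℝ] E →L[ℝ] E :=
  christoffel g x (extChartAt 𝓘(ℝ, E) x x)

/-- The curvature `R(u, v)w` of the Levi-Civita connection at `x`, computed in the chart at `x`. -/
def curvature (g : Metric E M) (x : M) (u v w : E) : E :=
  fderiv ℝ (fun y ↦ christoffel g x y v w) (extChartAt 𝓘(ℝ, E) x x) u
    - fderiv ℝ (fun y ↦ christoffel g x y u w) (extChartAt 𝓘(ℝ, E) x x) v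
    + christoffelAt g x u (christoffelAt g x v w)
    - christoffelAt g x v (christoffelAt g x u w)

/-- All sectional curvatures `g(R(u, v)v, u) / (g(u, u) g(v, v) - g(u, v)²)` are equal to `c`. -/
def HasConstantSectionalCurvature (g : Metric E M) (c : ℝ) : Prop :=
  ∀ (x : M) (u v : E), flat g x (curvature g x u v v) u =
    c * (flat g x u u * flat g x v v - flat g x u v ^ 2)

end Base

section Cotangent

/-! ### Natural diagonal lifts to the cotangent bundle

Mathlib's chart of `T*M` at `p`, with `π(p) = x`, is the chart `(q, p)` induced by the chart of `M`
at `x`. Hence `T_p(T*M)` is `E × E*`, the pair `(u, β)` standing for `uⁱ ∂/∂qⁱ + β_i ∂/∂p_i`. -/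

variable {E : Type*} [NormedAddCommGroup E] [NormedSpace ℝ E]
  {M : Type*} [TopologicalSpace M] [ChartedSpace E M] [IsManifold 𝓘(ℝ, E) ∞ M]

/-- The total space `T*M` of the cotangent bundle. -/
abbrev CotangentBundle (E : Type*) [NormedAddCommGroup E] [NormedSpace ℝ E]
    (M : Type*) [TopologicalSpace M] [ChartedSpace E M] [IsManifold 𝓘(ℝ, E) ∞ M] :=
  TotalSpace (E →L[ℝ] ℝ) (fun x : M ↦ TangentSpace 𝓘(ℝ, E) x →L[ℝ] Trivial M ℝ x)

/-- The model with corners of `T*M`. -/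
abbrev cotangentModel (E : Type*) [NormedAddCommGroup E] [NormedSpace ℝ E] :
    ModelWithCorners ℝ (E × (E →L[ℝ] ℝ)) (ModelProd E (E →L[ℝ] ℝ)) :=
  𝓘(ℝ, E).prod 𝓘(ℝ, E →L[ℝ] ℝ)

/-- The covector `p ∈ T*_x M`. -/
def covector (p : CotangentBundle E M) : E →L[ℝ] ℝ := p.snd

/-- The energy density `t = g⁻¹(p, p) / 2`. -/
def energy (g : Metric E M) (p : CotangentBundle E M) : ℝ :=
  (1 / 2 : ℝ) * cometric g p.proj (covector p) (covector p)

/-- `u ↦ p(Γ(u, ·))`, that is `uⁱ ↦ p_k Γᵏ_{ih} uⁱ`. -/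
def connectionForm (g : Metric E M) (p : CotangentBundle E M) : E →L[ℝ] E →L[ℝ] ℝ :=
  (compL ℝ E E ℝ (covector p)) ∘L christoffelAt g p.proj

/-- The horizontal lift `X ↦ X^H_p`: it sends `∂/∂xⁱ` to
`δ/δqⁱ = ∂/∂qⁱ + p_k Γᵏ_{ih} ∂/∂p_h`. -/
def hlift (g : Metric E M) (p : CotangentBundle E M) :
    E →L[ℝ] E × (E →L[ℝ] ℝ) :=
  (ContinuousLinearMap.id ℝ E).prod (connectionForm g p)

/-- The vertical lift `α ↦ α^V_p`: it sends `dxⁱ` to `∂/∂p_i`. -/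
def vlift (_p : CotangentBundle E M) : (E →L[ℝ] ℝ) →L[ℝ] E × (E →L[ℝ] ℝ) :=
  inr ℝ E (E →L[ℝ] ℝ)

/-- The projection `π_*` of a tangent vector of `T*M`: `X^H ↦ X`, `α^V ↦ 0`. -/
def hpart (_p : CotangentBundle E M) : E × (E →L[ℝ] ℝ) →L[ℝ] E :=
  fst ℝ E (E →L[ℝ] ℝ)

/-- The vertical component of a tangent vector of `T*M`: `X^H ↦ 0`, `α^V ↦ α`. -/
def vpart (g : Metric E M) (p : CotangentBundle E M) :
    E × (E →L[ℝ] ℝ) →L[ℝ] E →L[ℝ] ℝ :=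
  snd ℝ E (E →L[ℝ] ℝ) - connectionForm g p ∘L fst ℝ E (E →L[ℝ] ℝ)

/-- The natural diagonal `(1, 1)`-tensor field
`P X^H = a₁(t) (X♭)^V + b₁(t) p(X) p^V`, `P α^V = a₂(t) (α♯)^H + b₂(t) g⁻¹(p, α) (p♯)^H`. -/
def naturalTensor (g : Metric E M) (a₁ b₁ a₂ b₂ : ℝ → ℝ) (p : CotangentBundle E M) :
    TangentSpace (cotangentModel E) p →L[ℝ] TangentSpace (cotangentModel E) p :=
  vlift p ∘L (a₁ (energy g p) • flat g p.proj
      + b₁ (energy g p) • (covector p).smulRight (covector p)) ∘L hpart p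
  + hlift g p ∘L (a₂ (energy g p) • sharp g p.proj
      + b₂ (energy g p) •
        (cometric g p.proj (covector p)).smulRight (sharp g p.proj (covector p))) ∘L vpart g p

/-- The natural diagonal metric
`G(X^H, Y^H) = c₁(t) g(X, Y) + d₁(t) p(X) p(Y)`,
`G(α^V, ω^V) = c₂(t) g⁻¹(α, ω) + d₂(t) g⁻¹(p, α) g⁻¹(p, ω)`, `G(X^H, α^V) = 0`. -/
def naturalMetric (g : Metric E M) (c₁ d₁ c₂ d₂ : ℝ → ℝ) (p : CotangentBundle E M) :
    TangentSpace (cotangentModel E) p →L[ℝ] TangentSpace (cotangentModel E) p →L[ℝ] ℝ :=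
  (c₁ (energy g p) • flat g p.proj
      + d₁ (energy g p) • (covector p).smulRight (covector p)).bilinearComp (hpart p) (hpart p)
  + (c₂ (energy g p) • cometric g p.proj
      + d₂ (energy g p) •
        (cometric g p.proj (covector p)).smulRight (cometric g p.proj (covector p))).bilinearComp
          (vpart g p) (vpart g p)

end Cotangent

section Coefficients

/-! ### Relations between coefficients, which are functions of the energy density `t ∈ [0, ∞)` -/

/-- A smooth function on `[0, ∞)`. -/
def SmoothCoeff (f : ℝ → ℝ) : Prop := ContDiffOn ℝ ∞ f (Set.Ici 0)

/-- The derivative of a function on `[0, ∞)`, one-sided at `0`. -/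
def coeffDeriv (f : ℝ → ℝ) (t : ℝ) : ℝ := derivWithin f (Set.Ici 0) t

/-- `lam` and `mu` are the smooth proportionality factors of the coefficients of `G` and `P`:
`c₁ / a₁ = -c₂ / a₂ = λ` and
`(c₁ + 2t d₁) / (a₁ + 2t b₁) = -(c₂ + 2t d₂) / (a₂ + 2t b₂) = λ + 2t μ`. -/
structure AreProportionalityFactors (a₁ b₁ a₂ b₂ c₁ d₁ c₂ d₂ lam mu : ℝ → ℝ) : Prop where
  smooth_lam : SmoothCoeff lam
  smooth_mu : SmoothCoeff mu
  ne_zero : ∀ t, 0 ≤ t →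
    a₁ t ≠ 0 ∧ a₂ t ≠ 0 ∧ a₁ t + 2 * t * b₁ t ≠ 0 ∧ a₂ t + 2 * t * b₂ t ≠ 0
  first : ∀ t, 0 ≤ t → c₁ t / a₁ t = lam t ∧ -(c₂ t / a₂ t) = lam t
  second : ∀ t, 0 ≤ t →
    (c₁ t + 2 * t * d₁ t) / (a₁ t + 2 * t * b₁ t) = lam t + 2 * t * mu t ∧
    -((c₂ t + 2 * t * d₂ t) / (a₂ t + 2 * t * b₂ t)) = lam t + 2 * t * mu t

/-- `b₁ = (a₁ a₁' + c) / (a₁ - 2t a₁')` and `b₂ = (a₁ a₂' - a₂² c) / (a₁ + 2c t a₂)` on `[0, ∞)`,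
where the denominators have no zeros. -/
def IntegrabilityRelations (a₁ b₁ a₂ b₂ : ℝ → ℝ) (c : ℝ) : Prop :=
  ∀ t, 0 ≤ t →
    a₁ t - 2 * t * coeffDeriv a₁ t ≠ 0 ∧ a₁ t + 2 * c * t * a₂ t ≠ 0 ∧
    b₁ t = (a₁ t * coeffDeriv a₁ t + c) / (a₁ t - 2 * t * coeffDeriv a₁ t) ∧
    b₂ t = (a₁ t * coeffDeriv a₂ t - a₂ t ^ 2 * c) / (a₁ t + 2 * c * t * a₂ t)

end Coefficients

end ParaKahlerCotangent

end

open ParaKahlerCotangent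

/-! The Nijenhuis tensor of P and the form dΩ are tensorial, so both can be tested at one point p on
single vectors, in the chart of T*M induced by the chart of M at π(p). There T*M becomes E × E*, and
the transformation law of the Christoffel symbols turns P and Ω into explicit expressions near p
(`cotangentFrame_lift`, `coordFrame_naturalTensor`, `associatedForm_coordFrame`).

Algebra. Testing the structure on a vector killed by p and on p♯ gives a₁a₂ = 1, (a₁ + 2tb₁)(a₂ +
2tb₂) = 1 and two analogous relations for G (`paraHermitianRelations`). Hence λ and μ exist, and Ω =
λ(t) ω + μ(t) θ ∧ dt with θ = p dq and ω = -dθ (`associatedForm_eq`).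

Part 1. Since dω = 0 and dt ∧ dt = 0, dΩ = (λ' - μ) dt ∧ ω (`flatExtDeriv_localForm`). As n ≥ 2, dt
∧ ω is nonzero wherever p ≠ 0, so closedness means μ = λ' for t > 0, and for t = 0 by continuity
(`isClosedTwoForm_iff`).

Part 2. From P² = 1 comes N(PX, Y) = -P N(X, Y), and P exchanges horizontal and vertical vectors, so
N is determined by its values on horizontal lifts. There N(X^H, Y^H) is the vertical lift of p(R(X,
Y)·) - k(t)(p(X) Y♭ - p(Y) X♭), with k = a₁b₁ - a₁'(a₁ + 2tb₁) (`flatNijenhuis_horizontal`). Scaling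
p in the equation N = 0 forces k to be a constant c, and then R is the curvature tensor of constant
curvature c; the converse is immediate (`curvature_condition_iff`). Finally k = c is solved for b₁
and b₂; the denominators do not vanish because f = a₁² + 2ct solves a linear equation f' = qf with
f(0) ≠ 0 (`nijenhuisCoeff_eq_const_iff`). -/

noncomputable section

namespace ParaKahlerCotangent

open Bundle ContinuousLinearMap Filter Topology VectorField

/-! ### Nijenhuis tensor and exterior derivative on a vector space -/

section VectorSpace

variable {F : Type*} [NormedAddCommGroup F] [NormedSpace ℝ F]

/-- The Nijenhuis tensor at `z` of a field of endomorphisms of a vector space. -/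
def flatNijenhuis (J : F → F →L[ℝ] F) (z v w : F) : F :=
  fderiv ℝ J z (J z v) w - fderiv ℝ J z (J z w) v
    + J z (fderiv ℝ J z w v) - J z (fderiv ℝ J z v w)

/-- Tensoriality: all terms containing derivatives of `V` and `W` cancel, leaving only derivatives
of `J`. The relation J² = 1 plays no role here. -/
theorem lieBracket_nijenhuis {J : F → F →L[ℝ] F} {V W : F → F} {z : F}
    (hJ : DifferentiableAt ℝ J z) (hV : DifferentiableAt ℝ V z) (hW : DifferentiableAt ℝ W z) :
    lieBracket ℝ (fun y ↦ J y (V y)) (fun y ↦ J y (W y)) z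
      - J z (lieBracket ℝ (fun y ↦ J y (V y)) W z)
      - J z (lieBracket ℝ V (fun y ↦ J y (W y)) z)
      + J z (J z (lieBracket ℝ V W z)) = flatNijenhuis J z (V z) (W z) := by
  simp only [lieBracket, flatNijenhuis, fderiv_clm_apply hJ hV, fderiv_clm_apply hJ hW]
  simp only [add_apply, ContinuousLinearMap.comp_apply,
    ContinuousLinearMap.flip_apply, map_sub, map_add]
  abel

/-- The exterior derivative at `z` of a field of bilinear forms on a vector space. -/
def flatExtDeriv (Ψ : F → F →L[ℝ] F →L[ℝ] ℝ) (z u v w : F) : ℝ :=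
  fderiv ℝ Ψ z u v w - fderiv ℝ Ψ z v u w + fderiv ℝ Ψ z w u v

theorem fderiv_bilinear_apply {Ψ : F → F →L[ℝ] F →L[ℝ] ℝ} {V W : F → F} {z : F}
    (hΨ : DifferentiableAt ℝ Ψ z) (hV : DifferentiableAt ℝ V z) (hW : DifferentiableAt ℝ W z)
    (u : F) :
    fderiv ℝ (fun y ↦ Ψ y (V y) (W y)) z u =
      fderiv ℝ Ψ z u (V z) (W z) + Ψ z (fderiv ℝ V z u) (W z) + Ψ z (V z) (fderiv ℝ W z u) := by
  rw [fderiv_clm_apply (hΨ.clm_apply hV) hW, fderiv_clm_apply hΨ hV]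
  simp only [add_apply, ContinuousLinearMap.comp_apply,
    ContinuousLinearMap.flip_apply]
  ring

/-- The derivatives of the three fields cancel against the bracket terms once the arguments of Ψ are
swapped, so antisymmetry is needed only at `z`. -/
theorem lieBracket_extDeriv {Ψ : F → F →L[ℝ] F →L[ℝ] ℝ} {U V W : F → F} {z : F}
    (hΨ : DifferentiableAt ℝ Ψ z) (hanti : ∀ v w, Ψ z v w = -Ψ z w v)
    (hU : DifferentiableAt ℝ U z) (hV : DifferentiableAt ℝ V z) (hW : DifferentiableAt ℝ W z) :
    fderiv ℝ (fun y ↦ Ψ y (V y) (W y)) z (U z) - fderiv ℝ (fun y ↦ Ψ y (U y) (W y)) z (V z)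
      + fderiv ℝ (fun y ↦ Ψ y (U y) (V y)) z (W z)
      - Ψ z (lieBracket ℝ U V z) (W z) + Ψ z (lieBracket ℝ U W z) (V z)
      - Ψ z (lieBracket ℝ V W z) (U z) = flatExtDeriv Ψ z (U z) (V z) (W z) := by
  simp only [lieBracket, flatExtDeriv, fderiv_bilinear_apply hΨ hV hW,
    fderiv_bilinear_apply hΨ hU hW, fderiv_bilinear_apply hΨ hU hV, map_sub,
    sub_apply]
  rw [hanti (V z), hanti (U z) (fderiv ℝ W z (V z)), hanti (U z) (fderiv ℝ V z (W z))]
  ring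

end VectorSpace

/-! ### Passing from a manifold to the extended chart at a point -/

section ChartTransfer

variable {F : Type*} [NormedAddCommGroup F] [NormedSpace ℝ F]
  {H : Type*} [TopologicalSpace H] (I : ModelWithCorners ℝ F H)
  {N : Type*} [TopologicalSpace N] [ChartedSpace H N]

/-- The differential at `z` of the inverse of the extended chart at `p`. -/
def coordFrame (p : N) (z : F) : F →L[ℝ] TangentSpace I ((extChartAt I p).symm z) :=
  mfderiv 𝓘(ℝ, F) I (extChartAt I p).symm z

/-- A vector field, read in the extended chart at `p`. -/
def coordField (p : N) (V : ∀ q : N, TangentSpace I q) (z : F) : F :=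
  (coordFrame I p z).inverse (V ((extChartAt I p).symm z))

variable [I.Boundaryless] [IsManifold I ∞ N]

theorem coordFrame_isInvertible {p : N} {z : F} (hz : z ∈ (extChartAt I p).target) :
    (coordFrame I p z).IsInvertible := by
  have := isInvertible_mfderivWithin_extChartAt_symm (I := I) hz
  rwa [I.range_eq_univ, mfderivWithin_univ] at this

theorem coordFrame_self (p : N) :
    coordFrame I p (extChartAt I p p) = ContinuousLinearMap.id ℝ F := by
  have := mfderivWithin_range_extChartAt_symm (I := I) (x := p)
  rwa [I.range_eq_univ, mfderivWithin_univ] at this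

theorem coordField_self (p : N) (V : ∀ q : N, TangentSpace I q) :
    coordField I p V (extChartAt I p p) = V p := by
  have h := mfderivWithin_extChartAt_symm_inverse_apply (I := I) (x := p) (V p)
  rw [I.range_eq_univ, mfderivWithin_univ] at h
  have h2 : V ((extChartAt I p).symm (extChartAt I p p)) = (V p : F) := by
    rw [extChartAt_to_inv]
  unfold coordField coordFrame
  rw [h2]
  exact h

/-- The bracket at `p` is by definition computed in the chart at `p`, and that chart has identity
differential at `p`, so no pushforward remains. -/
theorem mlieBracket_eq_coord (p : N) (V W : ∀ q : N, TangentSpace I q) :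
    mlieBracket I V W p =
      lieBracket ℝ (coordField I p V) (coordField I p W) (extChartAt I p p) := by
  rw [← mlieBracketWithin_univ, mlieBracketWithin_apply, mfderiv_extChartAt_self,
    I.range_eq_univ, Set.preimage_univ, Set.univ_inter, mpullbackWithin_univ,
    mpullbackWithin_univ]
  change (ContinuousLinearMap.id ℝ F).inverse
    (lieBracketWithin ℝ (coordField I p V) (coordField I p W) Set.univ (extChartAt I p p)) = _
  rw [ContinuousLinearMap.inverse_id, lieBracketWithin_univ]
  rfl

variable {I}

theorem SmoothFieldAt.differentiableAt_coordField [CompleteSpace F] {p : N}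
    {V : ∀ q : N, TangentSpace I q} (hV : SmoothFieldAt I V p) :
    DifferentiableAt ℝ (coordField I p V) (extChartAt I p p) := by
  have h := contMDiffWithinAt_mpullbackWithin_extChartAt_symm (n := ∞) (m := 1)
    (hV.of_le (mod_cast le_top)).contMDiffWithinAt uniqueMDiffOn_univ
    (Set.mem_univ p) (by norm_cast)
  rw [contMDiffWithinAt_vectorSpace_iff_contDiffWithinAt, I.range_eq_univ, Set.preimage_univ,
    Set.inter_univ, mpullbackWithin_univ] at h
  exact (h.contDiffAt (extChartAt_target_mem_nhds p)).differentiableAt one_ne_zero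

omit [I.Boundaryless] in
variable (I) in
-- The extension is the constant coordinate field pulled back through the chart. It reduces a
-- statement about all fields smooth near `p` to one about vectors at `p`.
theorem exists_smoothFieldAt [CompleteSpace F] (p : N) (v : F) :
    ∃ V : ∀ q : N, TangentSpace I q, SmoothFieldAt I V p ∧ V p = v := by
  have h1 : (mfderiv I 𝓘(ℝ, F) (extChartAt I p) p).IsInvertible := by
    rw [mfderiv_extChartAt_self]
    exact ⟨ContinuousLinearEquiv.refl ℝ F, rfl⟩
  refine ⟨mpullback I 𝓘(ℝ, F) (extChartAt I p) (fun _ ↦ v), ?_, ?_⟩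
  · refine ContMDiffAt.mpullback_vectorField_preimage (n := ∞) (m := ∞) ?_
      contMDiffAt_extChartAt h1 (by norm_cast)
    exact contMDiffAt_vectorSpace_iff_contDiffAt.2 contDiffAt_const
  · have h2 : (mfderiv I 𝓘(ℝ, F) (extChartAt I p) p : F →L[ℝ] F) = ContinuousLinearMap.id ℝ F :=
      mfderiv_extChartAt_self
    have h3 : (ContinuousLinearMap.id ℝ F).inverse v = v := by
      rw [ContinuousLinearMap.inverse_id]; rfl
    exact (congrArg (fun L : F →L[ℝ] F ↦ L.inverse v) h2).trans h3

theorem coordFrame_coordField {p : N} {z : F} (hz : z ∈ (extChartAt I p).target)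
    (V : ∀ q : N, TangentSpace I q) :
    coordFrame I p z (coordField I p V z) = V ((extChartAt I p).symm z) := by
  obtain ⟨e, he⟩ := coordFrame_isInvertible I hz
  unfold coordField
  rw [← he, ContinuousLinearMap.inverse_equiv]
  exact e.apply_symm_apply _

theorem coordField_eq_of_coordFrame {p : N} {z v : F} (hz : z ∈ (extChartAt I p).target)
    {V : ∀ q : N, TangentSpace I q}
    (h : coordFrame I p z v = V ((extChartAt I p).symm z)) :
    coordField I p V z = v := by
  obtain ⟨e, he⟩ := coordFrame_isInvertible I hz
  unfold coordField
  rw [← h, ← he, ContinuousLinearMap.inverse_equiv]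
  exact e.symm_apply_apply _

/-- If the frame intertwines `Jc` with `J` near `p`, then reading in coordinates commutes with
applying `J`, so the manifold brackets become vector space brackets to which `lieBracket_nijenhuis`
applies. -/
theorem nijenhuis_eq_flat [CompleteSpace F] {p : N}
    {J : ∀ q : N, TangentSpace I q →L[ℝ] TangentSpace I q} {Jc : F → F →L[ℝ] F}
    (hJ : DifferentiableAt ℝ Jc (extChartAt I p p))
    (hJc : ∀ᶠ z in 𝓝 (extChartAt I p p), ∀ v : F,
      coordFrame I p z (Jc z v) = J ((extChartAt I p).symm z) (coordFrame I p z v))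
    {V W : ∀ q : N, TangentSpace I q} (hV : SmoothFieldAt I V p) (hW : SmoothFieldAt I W p) :
    nijenhuis I J V W p = flatNijenhuis Jc (extChartAt I p p) (V p) (W p) := by
  have key : ∀ U : ∀ q : N, TangentSpace I q, coordField I p (applyField I J U)
      =ᶠ[𝓝 (extChartAt I p p)] fun z ↦ Jc z (coordField I p U z) := by
    intro U
    filter_upwards [hJc, extChartAt_target_mem_nhds (I := I) p] with z hz hzt
    refine coordField_eq_of_coordFrame hzt ?_
    rw [hz, coordFrame_coordField hzt]
    rfl
  have hself : ∀ v : F, J p v = Jc (extChartAt I p p) v := by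
    intro v
    have h := hJc.self_of_nhds v
    rw [coordFrame_self] at h
    have h2 : J ((extChartAt I p).symm (extChartAt I p p)) v = (J p v : F) := by
      rw [extChartAt_to_inv]
    rw [← h2]
    exact h.symm
  have := lieBracket_nijenhuis hJ hV.differentiableAt_coordField hW.differentiableAt_coordField
  rw [coordField_self, coordField_self] at this
  rw [← this]
  unfold nijenhuis
  rw [mlieBracket_eq_coord, mlieBracket_eq_coord, mlieBracket_eq_coord, mlieBracket_eq_coord,
    (key V).lieBracket_vectorField_eq (key W), (key V).lieBracket_vectorField_eq EventuallyEq.rfl,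
    (EventuallyEq.rfl).lieBracket_vectorField_eq (key W)]
  simp only [hself]
  rfl

theorem nijenhuis_eq_zero_iff [CompleteSpace F] {p : N}
    {J : ∀ q : N, TangentSpace I q →L[ℝ] TangentSpace I q} {Jc : F → F →L[ℝ] F}
    (hJ : DifferentiableAt ℝ Jc (extChartAt I p p))
    (hJc : ∀ᶠ z in 𝓝 (extChartAt I p p), ∀ v : F,
      coordFrame I p z (Jc z v) = J ((extChartAt I p).symm z) (coordFrame I p z v)) :
    (∀ V W : ∀ q : N, TangentSpace I q, SmoothFieldAt I V p → SmoothFieldAt I W p →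
      nijenhuis I J V W p = 0) ↔ ∀ v w : F, flatNijenhuis Jc (extChartAt I p p) v w = 0 := by
  constructor
  · intro h v w
    obtain ⟨V, hV, rfl⟩ := exists_smoothFieldAt I p v
    obtain ⟨W, hW, rfl⟩ := exists_smoothFieldAt I p w
    rw [← nijenhuis_eq_flat hJ hJc hV hW]
    exact h V W hV hW
  · intro h V W hV hW
    rw [nijenhuis_eq_flat hJ hJc hV hW]
    exact h _ _

omit [I.Boundaryless] in
theorem dirDeriv_eq_coord {p : N} {f : N → ℝ} {fc : F → ℝ}
    (hf : DifferentiableAt ℝ fc (extChartAt I p p))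
    (hfc : ∀ᶠ z in 𝓝 (extChartAt I p p), f ((extChartAt I p).symm z) = fc z)
    (U : ∀ q : N, TangentSpace I q) :
    dirDeriv I U f p = fderiv ℝ fc (extChartAt I p p) (U p) := by
  have h1 : f =ᶠ[𝓝 p] fc ∘ extChartAt I p := by
    filter_upwards [(continuousAt_extChartAt (I := I) p).eventually hfc,
      extChartAt_source_mem_nhds (I := I) p] with q hq hqs
    rw [Function.comp_apply, ← hq, (extChartAt I p).left_inv hqs]
  unfold dirDeriv
  rw [h1.mfderiv_eq, mfderiv_comp p hf.mdifferentiableAt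
    (mdifferentiableAt_extChartAt (mem_chart_source H p)), mfderiv_extChartAt_self,
    mfderiv_eq_fderiv]
  rfl

theorem extDerivTwoForm_eq_flat [CompleteSpace F] {p : N}
    {Ψ : ∀ q : N, TangentSpace I q → TangentSpace I q → ℝ} {Ψc : F → F →L[ℝ] F →L[ℝ] ℝ}
    (hΨ : DifferentiableAt ℝ Ψc (extChartAt I p p))
    (hanti : ∀ v w, Ψc (extChartAt I p p) v w = -Ψc (extChartAt I p p) w v)
    (hΨc : ∀ᶠ z in 𝓝 (extChartAt I p p), ∀ v w : F,
      Ψ ((extChartAt I p).symm z) (coordFrame I p z v) (coordFrame I p z w) = Ψc z v w)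
    {U V W : ∀ q : N, TangentSpace I q}
    (hU : SmoothFieldAt I U p) (hV : SmoothFieldAt I V p) (hW : SmoothFieldAt I W p) :
    extDerivTwoForm I Ψ U V W p = flatExtDeriv Ψc (extChartAt I p p) (U p) (V p) (W p) := by
  have key : ∀ X Y : ∀ q : N, TangentSpace I q, ∀ᶠ z in 𝓝 (extChartAt I p p),
      (fun q ↦ Ψ q (X q) (Y q)) ((extChartAt I p).symm z) =
        Ψc z (coordField I p X z) (coordField I p Y z) := by
    intro X Y
    filter_upwards [hΨc, extChartAt_target_mem_nhds (I := I) p] with z hz hzt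
    rw [← hz, coordFrame_coordField hzt, coordFrame_coordField hzt]
  have hself : ∀ v w : TangentSpace I p, Ψ p v w = Ψc (extChartAt I p p) v w := by
    intro v w
    have h := hΨc.self_of_nhds v w
    rw [coordFrame_self] at h
    -- The type of `v` and `w` depends on the base point, so the equality of points is substituted
    -- rather than rewritten.
    have h2 : ∀ q (_ : q = p), Ψ q v w = Ψ p v w := by
      rintro _ rfl; rfl
    rw [← h2 _ (extChartAt_to_inv (I := I) p)]
    exact h
  have dU := hU.differentiableAt_coordField
  have dV := hV.differentiableAt_coordField
  have dW := hW.differentiableAt_coordField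
  have := lieBracket_extDeriv hΨ hanti dU dV dW
  simp only [coordField_self] at this
  rw [← this]
  unfold extDerivTwoForm
  rw [hself (mlieBracket I U V p), hself (mlieBracket I U W p), hself (mlieBracket I V W p),
    dirDeriv_eq_coord ((hΨ.clm_apply dV).clm_apply dW) (key V W),
    dirDeriv_eq_coord ((hΨ.clm_apply dU).clm_apply dW) (key U W),
    dirDeriv_eq_coord ((hΨ.clm_apply dU).clm_apply dV) (key U V),
    mlieBracket_eq_coord, mlieBracket_eq_coord, mlieBracket_eq_coord]

theorem extDerivTwoForm_eq_zero_iff [CompleteSpace F] {p : N}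
    {Ψ : ∀ q : N, TangentSpace I q → TangentSpace I q → ℝ} {Ψc : F → F →L[ℝ] F →L[ℝ] ℝ}
    (hΨ : DifferentiableAt ℝ Ψc (extChartAt I p p))
    (hanti : ∀ v w, Ψc (extChartAt I p p) v w = -Ψc (extChartAt I p p) w v)
    (hΨc : ∀ᶠ z in 𝓝 (extChartAt I p p), ∀ v w : F,
      Ψ ((extChartAt I p).symm z) (coordFrame I p z v) (coordFrame I p z w) = Ψc z v w) :
    (∀ U V W : ∀ q : N, TangentSpace I q, SmoothFieldAt I U p → SmoothFieldAt I V p →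
      SmoothFieldAt I W p → extDerivTwoForm I Ψ U V W p = 0) ↔
      ∀ u v w : F, flatExtDeriv Ψc (extChartAt I p p) u v w = 0 := by
  constructor
  · intro h u v w
    obtain ⟨U, hU, rfl⟩ := exists_smoothFieldAt I p u
    obtain ⟨V, hV, rfl⟩ := exists_smoothFieldAt I p v
    obtain ⟨W, hW, rfl⟩ := exists_smoothFieldAt I p w
    rw [← extDerivTwoForm_eq_flat hΨ hanti hΨc hU hV hW]
    exact h U V W hU hV hW
  · intro h U V W hU hV hW
    rw [extDerivTwoForm_eq_flat hΨ hanti hΨc hU hV hW]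
    exact h _ _ _

end ChartTransfer

/-! ### Coordinate frames and the metric in charts of M -/

section BaseChart

variable {E : Type*} [NormedAddCommGroup E] [NormedSpace ℝ E]
  {M : Type*} [TopologicalSpace M] [ChartedSpace E M] [IsManifold 𝓘(ℝ, E) ∞ M]

/-- The coordinate frame `chartFrame x y` as an endomorphism of the model space. -/
def frame (x : M) (y : E) : E →L[ℝ] E := chartFrame x y

theorem frame_isInvertible {x : M} {y : E} (hy : y ∈ (extChartAt 𝓘(ℝ, E) x).target) :
    (frame x y).IsInvertible :=
  coordFrame_isInvertible 𝓘(ℝ, E) hy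

theorem frame_self (x : M) :
    frame x (extChartAt 𝓘(ℝ, E) x x) = ContinuousLinearMap.id ℝ E :=
  coordFrame_self 𝓘(ℝ, E) x

/-- The change of coordinates from the chart at `x` to the chart at `x₀`. -/
def baseTransition (x x₀ : M) : E → E :=
  extChartAt 𝓘(ℝ, E) x₀ ∘ (extChartAt 𝓘(ℝ, E) x).symm

theorem baseTransition_contDiffAt {x x₀ : M} {y : E} (hy : y ∈ (extChartAt 𝓘(ℝ, E) x).target)
    (hy' : (extChartAt 𝓘(ℝ, E) x).symm y ∈ (extChartAt 𝓘(ℝ, E) x₀).source) :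
    ContDiffAt ℝ ∞ (baseTransition x x₀) y := by
  have := contDiffWithinAt_ext_coord_change (n := ∞) (I := 𝓘(ℝ, E)) x₀ x
    (y := y) (by simp at hy hy' ⊢; exact ⟨hy, hy'⟩)
  rwa [modelWithCornersSelf_coe, Set.range_id, contDiffWithinAt_univ] at this

omit [IsManifold 𝓘(ℝ, E) ∞ M] in
theorem eventually_mem_overlap {x x₀ : M} (hx : x ∈ (extChartAt 𝓘(ℝ, E) x₀).source) :
    ∀ᶠ y in 𝓝 (extChartAt 𝓘(ℝ, E) x x), y ∈ (extChartAt 𝓘(ℝ, E) x).target ∧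
      (extChartAt 𝓘(ℝ, E) x).symm y ∈ (extChartAt 𝓘(ℝ, E) x₀).source := by
  have h := (continuousAt_extChartAt_symm (I := 𝓘(ℝ, E)) x)
  have h2 : (extChartAt 𝓘(ℝ, E) x₀).source ∈
      𝓝 ((extChartAt 𝓘(ℝ, E) x).symm (extChartAt 𝓘(ℝ, E) x x)) := by
    rw [extChartAt_to_inv]
    exact (isOpen_extChartAt_source x₀).mem_nhds hx
  filter_upwards [extChartAt_target_mem_nhds (I := 𝓘(ℝ, E)) x, h h2] with y hy hy'
  exact ⟨hy, hy'⟩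

/-- Chain rule for the inverse chart at `x`, factored through the chart at `x₀`. A tangent space is
identified with `E` by the preferred chart of its own point, so `frame` is in substance the Jacobian
of a change of charts. -/
theorem frame_eq_comp {x x₀ : M} {y : E} (hy : y ∈ (extChartAt 𝓘(ℝ, E) x).target)
    (hy' : (extChartAt 𝓘(ℝ, E) x).symm y ∈ (extChartAt 𝓘(ℝ, E) x₀).source) :
    frame x y =
      frame x₀ (baseTransition x x₀ y) ∘L fderiv ℝ (baseTransition x x₀) y := by
  have h1 : (extChartAt 𝓘(ℝ, E) x).symm =ᶠ[𝓝 y]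
      (extChartAt 𝓘(ℝ, E) x₀).symm ∘ baseTransition x x₀ := by
    have hc := continuousAt_extChartAt_symm'' (I := 𝓘(ℝ, E)) hy
    filter_upwards [hc ((isOpen_extChartAt_source x₀).mem_nhds hy')] with y' h
    exact ((extChartAt 𝓘(ℝ, E) x₀).left_inv h).symm
  have h2 : MDifferentiableAt 𝓘(ℝ, E) 𝓘(ℝ, E) (extChartAt 𝓘(ℝ, E) x₀).symm
      (baseTransition x x₀ y) := by
    have := mdifferentiableWithinAt_extChartAt_symm (I := 𝓘(ℝ, E))
      ((extChartAt 𝓘(ℝ, E) x₀).map_source hy')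
    rwa [modelWithCornersSelf_coe, Set.range_id, mdifferentiableWithinAt_univ] at this
  have h3 := (baseTransition_contDiffAt hy hy').differentiableAt (by simp)
  have h4 := mfderiv_comp y h2 h3.mdifferentiableAt
  rw [mfderiv_eq_fderiv] at h4
  exact h1.mfderiv_eq.trans h4

theorem fderiv_baseTransition_eq {x x₀ : M} (hx : x ∈ (extChartAt 𝓘(ℝ, E) x₀).source) :
    frame x₀ (extChartAt 𝓘(ℝ, E) x₀ x) ∘L
      fderiv ℝ (baseTransition x x₀) (extChartAt 𝓘(ℝ, E) x x) = ContinuousLinearMap.id ℝ E := by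
  have h := frame_eq_comp (mem_extChartAt_target (I := 𝓘(ℝ, E)) x)
    (x₀ := x₀) (by rwa [extChartAt_to_inv])
  have h2 : baseTransition x x₀ (extChartAt 𝓘(ℝ, E) x x) = extChartAt 𝓘(ℝ, E) x₀ x := by
    rw [baseTransition, Function.comp_apply, extChartAt_to_inv]
  rw [frame_self, h2] at h
  exact h.symm

theorem chartMetric_apply (g : Metric E M) (x : M) (y v w : E) :
    chartMetric g x y v w = flat g ((extChartAt 𝓘(ℝ, E) x).symm y)
      (frame x y v) (frame x y w) := rfl

theorem chartMetric_self (g : Metric E M) (x : M) :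
    chartMetric g x (extChartAt 𝓘(ℝ, E) x x) = flat g x := by
  ext v w
  rw [chartMetric_apply, frame_self, extChartAt_to_inv]
  rfl

theorem flat_symm (g : Metric E M) (x : M) (v w : E) : flat g x v w = flat g x w v :=
  g.symm x v w

theorem flat_pos (g : Metric E M) (x : M) {v : E} (hv : v ≠ 0) : 0 < flat g x v v :=
  g.pos x v hv

theorem chartMetric_symm (g : Metric E M) (x : M) (y v w : E) :
    chartMetric g x y v w = chartMetric g x y w v :=
  flat_symm g _ _ _

theorem chartMetric_pos (g : Metric E M) {x : M} {y : E}
    (hy : y ∈ (extChartAt 𝓘(ℝ, E) x).target) {v : E} (hv : v ≠ 0) :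
    0 < chartMetric g x y v v := by
  refine flat_pos g _ fun h ↦ hv ?_
  obtain ⟨e, he⟩ := frame_isInvertible hy
  change frame x y v = 0 at h
  rw [← he] at h
  exact e.map_eq_zero_iff.1 h

/-- Smoothness of the metric is smoothness in the trivialization at `x` of the bundle of bilinear
forms. The inverse of the tangent trivialization is the coordinate frame, so this local expression
is `chartMetric`. -/
theorem chartMetric_contDiffAt (g : Metric E M) {x : M} {y : E}
    (hy : y ∈ (extChartAt 𝓘(ℝ, E) x).target) :
    ContDiffAt ℝ ∞ (chartMetric g x) y := by
  have h1 := g.contMDiff ((extChartAt 𝓘(ℝ, E) x).symm y)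
  have hs := (extChartAt 𝓘(ℝ, E) x).map_target hy
  rw [(trivializationAt (E →L[ℝ] E →L[ℝ] ℝ)
    (fun x : M ↦ TangentSpace 𝓘(ℝ, E) x →L[ℝ] TangentSpace 𝓘(ℝ, E) x →L[ℝ] ℝ) x).contMDiffAt_section_iff
    (by simpa using hs)] at h1
  have h2 : ContMDiffAt 𝓘(ℝ, E) 𝓘(ℝ, E) ∞ (extChartAt 𝓘(ℝ, E) x).symm y := by
    have := contMDiffOn_extChartAt_symm (I := 𝓘(ℝ, E)) (n := ∞) x
    exact this.contMDiffAt ((isOpen_extChartAt_target x).mem_nhds hy)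
  refine ((h1.comp y h2).contDiffAt).congr_of_eventuallyEq ?_
  filter_upwards [(isOpen_extChartAt_target x).mem_nhds hy] with y' hy'
  have hs' := (extChartAt 𝓘(ℝ, E) x).map_target hy'
  have key := TangentBundle.symmL_trivializationAt (I := 𝓘(ℝ, E)) (x₀ := x)
    (x := (extChartAt 𝓘(ℝ, E) x).symm y') (by simpa using hs')
  rw [(extChartAt 𝓘(ℝ, E) x).right_inv hy', modelWithCornersSelf_coe, Set.range_id,
    mfderivWithin_univ] at key
  ext v w
  rw [Function.comp_apply, hom_trivializationAt_apply]
  rw [inCoordinates_apply_eq₂ (by simpa using hs') (by simpa using hs') (by simp)]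
  have hk : ∀ u : E, (trivializationAt E (TangentSpace 𝓘(ℝ, E)) x).symm
      ((extChartAt 𝓘(ℝ, E) x).symm y') u = frame x y' u := by
    intro u
    have h := congrArg (fun L : E →L[ℝ] E ↦ L u) key
    rw [← Trivialization.symmL_apply (R := ℝ) _ (by simpa using hs')]
    exact h
  rw [chartMetric_apply, ← hk v, ← hk w]
  simp
  rfl

/-- The transformation law of the matrix of the metric. -/
theorem chartMetric_transition (g : Metric E M) {x x₀ : M} {y : E}
    (hy : y ∈ (extChartAt 𝓘(ℝ, E) x).target)
    (hy' : (extChartAt 𝓘(ℝ, E) x).symm y ∈ (extChartAt 𝓘(ℝ, E) x₀).source) (v w : E) :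
    chartMetric g x y v w = chartMetric g x₀ (baseTransition x x₀ y)
      (fderiv ℝ (baseTransition x x₀) y v) (fderiv ℝ (baseTransition x x₀) y w) := by
  have h : (extChartAt 𝓘(ℝ, E) x₀).symm (baseTransition x x₀ y) =
      (extChartAt 𝓘(ℝ, E) x).symm y := (extChartAt 𝓘(ℝ, E) x₀).left_inv hy'
  rw [chartMetric_apply, chartMetric_apply, h, frame_eq_comp hy hy']
  rfl

end BaseChart

/-! ### Charts of the cotangent bundle and their coordinate frames -/

section CotangentChart

variable {E : Type*} [NormedAddCommGroup E] [NormedSpace ℝ E]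
  {M : Type*} [TopologicalSpace M] [ChartedSpace E M] [IsManifold 𝓘(ℝ, E) ∞ M]

/-- The momentum coordinates of a covector are its values on the coordinate frame of the base chart.
-/
theorem cotangent_extChartAt_apply (p q : CotangentBundle E M)
    (hq : q.proj ∈ (extChartAt 𝓘(ℝ, E) p.proj).source) :
    extChartAt (cotangentModel E) p q =
      (extChartAt 𝓘(ℝ, E) p.proj q.proj,
        covector q ∘L frame p.proj (extChartAt 𝓘(ℝ, E) p.proj q.proj)) := by
  rw [FiberBundle.extChartAt]
  have key := TangentBundle.symmL_trivializationAt (I := 𝓘(ℝ, E)) (x₀ := p.proj)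
    (x := q.proj) (by simpa using hq)
  rw [modelWithCornersSelf_coe, Set.range_id, mfderivWithin_univ] at key
  change (extChartAt 𝓘(ℝ, E) p.proj _, _) = _
  refine Prod.ext rfl ?_
  simp [hom_trivializationAt_apply, inCoordinates]
  exact congrArg (fun L : E →L[ℝ] E ↦ covector q ∘L L) key

theorem cotangent_mem_target_iff {p : CotangentBundle E M} {z : E × (E →L[ℝ] ℝ)} :
    z ∈ (extChartAt (cotangentModel E) p).target ↔
      z.1 ∈ (extChartAt 𝓘(ℝ, E) p.proj).target := by
  rw [FiberBundle.extChartAt_target]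
  constructor
  · rintro ⟨⟨h, -⟩, -⟩
    exact h
  · intro h
    refine ⟨⟨h, ?_⟩, trivial⟩
    have := (extChartAt 𝓘(ℝ, E) p.proj).map_target h
    simpa using this

theorem cotangent_mem_source_iff {p q : CotangentBundle E M} :
    q ∈ (extChartAt (cotangentModel E) p).source ↔
      q.proj ∈ (extChartAt 𝓘(ℝ, E) p.proj).source := by
  rw [FiberBundle.extChartAt]
  constructor
  · rintro ⟨-, h, -⟩
    exact h
  · intro h
    refine ⟨?_, h, trivial⟩
    simpa using h

theorem cotangent_extChartAt_symm_proj {p : CotangentBundle E M} {z : E × (E →L[ℝ] ℝ)}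
    (hz : z.1 ∈ (extChartAt 𝓘(ℝ, E) p.proj).target) :
    ((extChartAt (cotangentModel E) p).symm z).proj = (extChartAt 𝓘(ℝ, E) p.proj).symm z.1 := by
  have hz' := cotangent_mem_target_iff.2 hz
  have h := (extChartAt (cotangentModel E) p).right_inv hz'
  have hs := cotangent_mem_source_iff.1 ((extChartAt (cotangentModel E) p).map_target hz')
  rw [cotangent_extChartAt_apply _ _ hs] at h
  rw [← congrArg Prod.fst h, (extChartAt 𝓘(ℝ, E) p.proj).left_inv hs]

theorem covector_extChartAt_symm {p : CotangentBundle E M} {z : E × (E →L[ℝ] ℝ)}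
    (hz : z.1 ∈ (extChartAt 𝓘(ℝ, E) p.proj).target) :
    covector ((extChartAt (cotangentModel E) p).symm z) ∘L
      frame p.proj z.1 = z.2 := by
  have h := (extChartAt (cotangentModel E) p).right_inv (cotangent_mem_target_iff.2 hz)
  have hp := cotangent_extChartAt_symm_proj hz
  rw [cotangent_extChartAt_apply _ _
    (by rw [hp]; exact (extChartAt 𝓘(ℝ, E) p.proj).map_target hz)] at h
  have h1 := congrArg Prod.fst h
  have h2 := congrArg Prod.snd h
  simp only at h1 h2
  rwa [h1] at h2

omit [TopologicalSpace M] [ChartedSpace E M] [IsManifold 𝓘(ℝ, E) ∞ M] in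
theorem hasFDerivAt_cotangentMap {ψ : E → E} {A : E → E →L[ℝ] E} {y : E} {ξ : E →L[ℝ] ℝ}
    {B : E →L[ℝ] E} {A' : E →L[ℝ] E →L[ℝ] E} (hψ : HasFDerivAt ψ B y)
    (hA : HasFDerivAt A A' (ψ y)) :
    ∃ L : E × (E →L[ℝ] ℝ) →L[ℝ] E × (E →L[ℝ] ℝ),
      HasFDerivAt (fun z : E × (E →L[ℝ] ℝ) ↦ (ψ z.1, z.2 ∘L A (ψ z.1))) L (y, ξ) ∧
      ∀ u β, L (u, β) = (B u, β ∘L A (ψ y) + ξ ∘L A' (B u)) := by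
  have h1 : HasFDerivAt (fun z : E × (E →L[ℝ] ℝ) ↦ ψ z.1) _ (y, ξ) :=
    HasFDerivAt.comp (y, ξ) hψ hasFDerivAt_fst
  have h2 : HasFDerivAt (fun z : E × (E →L[ℝ] ℝ) ↦ A (ψ z.1)) _ (y, ξ) :=
    HasFDerivAt.comp (y, ξ) hA h1
  refine ⟨_, h1.prodMk (hasFDerivAt_snd.clm_comp h2), fun u β ↦ ?_⟩
  refine Prod.ext ?_ ?_
  · simp
  · simp [add_comm]

/-- The tangent space at `q` is read in the chart at `q`, so this frame is the differential of the
transition from the chart at `p` to the chart at `q`. That transition is the cotangent lift (y, ξ) ↦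
(ψ y, ξ ∘ Dφ(ψ y)) with φ = ψ⁻¹, whence the second derivative of φ, which is the inhomogeneous term
that the Christoffel symbols absorb. -/
theorem cotangent_coordFrame {p q : CotangentBundle E M} {y : E} {ξ : E →L[ℝ] ℝ}
    (hy : y ∈ (extChartAt 𝓘(ℝ, E) p.proj).target)
    (hq : (extChartAt (cotangentModel E) p).symm (y, ξ) = q) (u : E) (β : E →L[ℝ] ℝ) :
    (coordFrame (cotangentModel E) p (y, ξ) (u, β) : E × (E →L[ℝ] ℝ)) =
      (frame p.proj y u,
        β ∘L fderiv ℝ (baseTransition q.proj p.proj) (extChartAt 𝓘(ℝ, E) q.proj q.proj) +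
        ξ ∘L fderiv ℝ (fderiv ℝ (baseTransition q.proj p.proj))
          (extChartAt 𝓘(ℝ, E) q.proj q.proj) (frame p.proj y u)) := by
  subst hq
  set q := (extChartAt (cotangentModel E) p).symm (y, ξ) with hq
  have hproj : ∀ y' ξ', y' ∈ (extChartAt 𝓘(ℝ, E) p.proj).target →
      ((extChartAt (cotangentModel E) p).symm (y', ξ')).proj =
        (extChartAt 𝓘(ℝ, E) p.proj).symm y' :=
    fun y' ξ' h ↦ cotangent_extChartAt_symm_proj (z := (y', ξ')) h
  have hqy : q.proj = (extChartAt 𝓘(ℝ, E) p.proj).symm y := hproj y ξ hy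
  have hqs : q.proj ∈ (extChartAt 𝓘(ℝ, E) p.proj).source := by
    rw [hqy]; exact (extChartAt 𝓘(ℝ, E) p.proj).map_target hy
  have hψy : baseTransition p.proj q.proj y = extChartAt 𝓘(ℝ, E) q.proj q.proj := by
    rw [baseTransition, Function.comp_apply, ← hqy]
  have hqy' : (extChartAt 𝓘(ℝ, E) p.proj).symm y ∈ (extChartAt 𝓘(ℝ, E) q.proj).source := by
    rw [← hqy]; exact mem_extChartAt_source q.proj
  have hψ : HasFDerivAt (baseTransition p.proj q.proj) (frame p.proj y) y := by
    have h1 := ((baseTransition_contDiffAt hy hqy').differentiableAt (by simp)).hasFDerivAt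
    have h2 := frame_eq_comp hy hqy'
    rw [hψy, frame_self, ContinuousLinearMap.id_comp] at h2
    rwa [h2]
  have hφ := baseTransition_contDiffAt (mem_extChartAt_target (I := 𝓘(ℝ, E)) q.proj)
    (x₀ := p.proj) (by rwa [extChartAt_to_inv])
  have hφ' : HasFDerivAt (fderiv ℝ (baseTransition q.proj p.proj))
      (fderiv ℝ (fderiv ℝ (baseTransition q.proj p.proj)) (extChartAt 𝓘(ℝ, E) q.proj q.proj))
      (baseTransition p.proj q.proj y) := by
    rw [hψy]
    exact ((hφ.fderiv_right (m := 1) (by norm_cast)).differentiableAt (by simp)).hasFDerivAt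
  obtain ⟨L, hL, hLapp⟩ := hasFDerivAt_cotangentMap (ξ := ξ) hψ hφ'
  have heq : writtenInExtChartAt 𝓘(ℝ, E × (E →L[ℝ] ℝ)) (cotangentModel E) (y, ξ)
      (extChartAt (cotangentModel E) p).symm =ᶠ[𝓝 (y, ξ)]
      fun z : E × (E →L[ℝ] ℝ) ↦ (baseTransition p.proj q.proj z.1,
      z.2 ∘L fderiv ℝ (baseTransition q.proj p.proj) (baseTransition p.proj q.proj z.1)) := by
    have hc := continuousAt_extChartAt_symm'' (I := 𝓘(ℝ, E)) hy
    have ev : ∀ᶠ y' in 𝓝 y, y' ∈ (extChartAt 𝓘(ℝ, E) p.proj).target ∧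
        (extChartAt 𝓘(ℝ, E) p.proj).symm y' ∈ (extChartAt 𝓘(ℝ, E) q.proj).source := by
      filter_upwards [(isOpen_extChartAt_target (I := 𝓘(ℝ, E)) p.proj).mem_nhds hy,
        hc ((isOpen_extChartAt_source q.proj).mem_nhds hqy')] with y' h1 h2
      exact ⟨h1, h2⟩
    filter_upwards [(continuous_fst.tendsto (y, ξ)).eventually ev] with z hz
    obtain ⟨hz1, hz2⟩ := hz
    have hpz := cotangent_extChartAt_symm_proj hz1
    change extChartAt (cotangentModel E) q ((extChartAt (cotangentModel E) p).symm z) = _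
    rw [cotangent_extChartAt_apply _ _ (by rw [hpz]; exact hz2), hpz]
    refine Prod.ext rfl ?_
    change covector _ ∘L frame q.proj (baseTransition p.proj q.proj z.1) = _
    have hback : (extChartAt 𝓘(ℝ, E) q.proj).symm (baseTransition p.proj q.proj z.1) =
        (extChartAt 𝓘(ℝ, E) p.proj).symm z.1 := (extChartAt 𝓘(ℝ, E) q.proj).left_inv hz2
    have hback2 : baseTransition q.proj p.proj (baseTransition p.proj q.proj z.1) = z.1 := by
      rw [baseTransition, Function.comp_apply, hback, (extChartAt 𝓘(ℝ, E) p.proj).right_inv hz1]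
    rw [frame_eq_comp (x := q.proj) (x₀ := p.proj) (y := baseTransition p.proj q.proj z.1)
      ((extChartAt 𝓘(ℝ, E) q.proj).map_source hz2)
      (by rw [hback]; exact (extChartAt 𝓘(ℝ, E) p.proj).map_target hz1), hback2,
      ← ContinuousLinearMap.comp_assoc, covector_extChartAt_symm hz1]
  have hmd : MDifferentiableAt 𝓘(ℝ, E × (E →L[ℝ] ℝ)) (cotangentModel E)
      (extChartAt (cotangentModel E) p).symm (y, ξ) := by
    have := mdifferentiableWithinAt_extChartAt_symm (I := cotangentModel E) (x := p)
      (z := (y, ξ)) (cotangent_mem_target_iff.2 hy)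
    rwa [(cotangentModel E).range_eq_univ, mdifferentiableWithinAt_univ] at this
  have hfin : (coordFrame (cotangentModel E) p (y, ξ) :
      E × (E →L[ℝ] ℝ) →L[ℝ] E × (E →L[ℝ] ℝ)) = _ := hmd.mfderiv.trans ((by
    rw [modelWithCornersSelf_coe, Set.range_id, fderivWithin_univ]
    exact heq.fderiv_eq.trans hL.fderiv))
  refine (congrArg (fun L : E × (E →L[ℝ] ℝ) →L[ℝ] E × (E →L[ℝ] ℝ) ↦ L (u, β)) hfin).trans ?_
  rw [hLapp, hψy]

end CotangentChart

/-! ### Inner products, musical isomorphisms and natural tensors on E × E* -/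

section LinearAlgebra

variable {E : Type*} [NormedAddCommGroup E] [NormedSpace ℝ E]

/-- A positive definite symmetric bilinear form. -/
structure IsInner (h : E →L[ℝ] E →L[ℝ] ℝ) : Prop where
  symm : ∀ v w, h v w = h w v
  pos : ∀ v, v ≠ 0 → 0 < h v v

namespace IsInner

variable {h : E →L[ℝ] E →L[ℝ] ℝ} (hh : IsInner h)
include hh

theorem eq_zero_of_forall {v : E} (hv : ∀ w, h v w = 0) : v = 0 := by
  by_contra hne
  exact (hh.pos v hne).ne' (hv v)

theorem nonneg (v : E) : 0 ≤ h v v := by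
  by_cases hv : v = 0
  · simp [hv]
  · exact (hh.pos v hv).le

variable [FiniteDimensional ℝ E]

theorem isInvertible : h.IsInvertible := by
  have hinj : Function.Injective h := by
    refine (injective_iff_map_eq_zero h).2 fun v hv ↦ hh.eq_zero_of_forall fun w ↦ ?_
    rw [hv]; rfl
  have hfin : FiniteDimensional ℝ (E →L[ℝ] ℝ) := inferInstance
  have hdim : Module.finrank ℝ E = Module.finrank ℝ (E →L[ℝ] ℝ) := by
    rw [← (LinearMap.toContinuousLinearMap : (E →ₗ[ℝ] ℝ) ≃ₗ[ℝ] E →L[ℝ] ℝ).finrank_eq]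
    exact Subspace.dual_finrank_eq.symm
  refine ⟨(LinearEquiv.ofInjectiveOfFinrankEq h.toLinearMap hinj hdim).toContinuousLinearEquiv, ?_⟩
  ext v
  rfl

theorem apply_inverse (ξ : E →L[ℝ] ℝ) : h (h.inverse ξ) = ξ := by
  obtain ⟨e, rfl⟩ := hh.isInvertible
  simp

theorem inverse_apply (v : E) : h.inverse (h v) = v := by
  obtain ⟨e, rfl⟩ := hh.isInvertible
  simp

theorem apply_inverse_symm (ξ η : E →L[ℝ] ℝ) : ξ (h.inverse η) = η (h.inverse ξ) := by
  rw [← hh.apply_inverse ξ, hh.symm, hh.apply_inverse η, hh.apply_inverse ξ]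

theorem inverse_nonneg (ξ : E →L[ℝ] ℝ) : 0 ≤ ξ (h.inverse ξ) := by
  have := hh.nonneg (h.inverse ξ)
  rwa [hh.apply_inverse] at this

theorem inverse_pos {ξ : E →L[ℝ] ℝ} (hξ : ξ ≠ 0) : 0 < ξ (h.inverse ξ) := by
  have := hh.pos (h.inverse ξ) fun h0 ↦ hξ (by rw [← hh.apply_inverse ξ, h0, map_zero])
  rwa [hh.apply_inverse] at this

end IsInner

/-- The endomorphism `u^H ↦ (A₁ u)^V`, `β^V ↦ (A₂ β)^H` for the horizontal lift
`u ↦ (u, K u)`. -/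
def liftTensor (K A₁ : E →L[ℝ] E →L[ℝ] ℝ) (A₂ : (E →L[ℝ] ℝ) →L[ℝ] E) :
    E × (E →L[ℝ] ℝ) →L[ℝ] E × (E →L[ℝ] ℝ) :=
  inr ℝ E (E →L[ℝ] ℝ) ∘L A₁ ∘L fst ℝ E (E →L[ℝ] ℝ)
    + ((ContinuousLinearMap.id ℝ E).prod K) ∘L A₂ ∘L
      (snd ℝ E (E →L[ℝ] ℝ) - K ∘L fst ℝ E (E →L[ℝ] ℝ))

theorem liftTensor_apply (K A₁ : E →L[ℝ] E →L[ℝ] ℝ) (A₂ : (E →L[ℝ] ℝ) →L[ℝ] E) (u : E)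
    (β : E →L[ℝ] ℝ) :
    liftTensor K A₁ A₂ (u, β) = (A₂ (β - K u), A₁ u + K (A₂ (β - K u))) := by
  simp [liftTensor]

/-- The form `u ↦ a u♭ + b ξ(u) ξ`. -/
def naturalFlat (h : E →L[ℝ] E →L[ℝ] ℝ) (ξ : E →L[ℝ] ℝ) (a b : ℝ) : E →L[ℝ] E →L[ℝ] ℝ :=
  a • h + b • ξ.smulRight ξ

/-- The map `β ↦ a β♯ + b g⁻¹(ξ, β) ξ♯`. -/
def naturalSharp (h : E →L[ℝ] E →L[ℝ] ℝ) (ξ : E →L[ℝ] ℝ) (a b : ℝ) : (E →L[ℝ] ℝ) →L[ℝ] E :=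
  a • h.inverse + b • (ξ ∘L h.inverse).smulRight (h.inverse ξ)

theorem naturalFlat_apply (h : E →L[ℝ] E →L[ℝ] ℝ) (ξ : E →L[ℝ] ℝ) (a b : ℝ) (u v : E) :
    naturalFlat h ξ a b u v = a * h u v + b * (ξ u * ξ v) := by
  simp [naturalFlat]

theorem naturalSharp_apply (h : E →L[ℝ] E →L[ℝ] ℝ) (ξ : E →L[ℝ] ℝ) (a b : ℝ) (β : E →L[ℝ] ℝ) :
    naturalSharp h ξ a b β = a • h.inverse β + (b * ξ (h.inverse β)) • h.inverse ξ := by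
  simp [naturalSharp, smul_smul]

/-- Half of the squared length of a covector. -/
def halfSq (h : E →L[ℝ] E →L[ℝ] ℝ) (ξ : E →L[ℝ] ℝ) : ℝ := (1 / 2 : ℝ) * ξ (h.inverse ξ)

theorem IsInner.halfSq_nonneg [FiniteDimensional ℝ E] {h : E →L[ℝ] E →L[ℝ] ℝ} (hh : IsInner h)
    (ξ : E →L[ℝ] ℝ) : 0 ≤ halfSq h ξ :=
  mul_nonneg (by norm_num) (hh.inverse_nonneg ξ)

theorem IsInner.halfSq_pos [FiniteDimensional ℝ E] {h : E →L[ℝ] E →L[ℝ] ℝ} (hh : IsInner h)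
    {ξ : E →L[ℝ] ℝ} (hξ : ξ ≠ 0) : 0 < halfSq h ξ :=
  mul_pos (by norm_num) (hh.inverse_pos hξ)

variable {h h' : E →L[ℝ] E →L[ℝ] ℝ} {B C : E →L[ℝ] E}

/-- `C` is an isometry from `h` to `h'`, so raising an index commutes with it. -/
theorem inverse_transport [FiniteDimensional ℝ E] (hh : IsInner h) (hh' : IsInner h')
    (hC : ∀ v w, h v w = h' (C v) (C w))
    (hCB : C ∘L B = ContinuousLinearMap.id ℝ E) (β : E →L[ℝ] ℝ) :
    h.inverse (β ∘L C) = B (h'.inverse β) := by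
  have hCB' : ∀ v, C (B v) = v := fun v ↦ congrArg (fun L : E →L[ℝ] E ↦ L v) hCB
  rw [← hh.inverse_apply (B (h'.inverse β))]
  congr 1
  ext w
  rw [hC, hCB', hh'.apply_inverse]
  rfl

end LinearAlgebra

/-! ### Uniqueness and transformation law of the Levi-Civita connection -/

section LeviCivita

variable {E : Type*} [NormedAddCommGroup E] [NormedSpace ℝ E]

/-- `Γ` is the value at `y` of the Christoffel symbols of the Levi-Civita connection of `h`. -/
structure IsLeviCivitaAt (h : E → E →L[ℝ] E →L[ℝ] ℝ) (Γ : E →L[ℝ] E →L[ℝ] E) (y : E) : Prop where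
  symm : ∀ u v, Γ u v = Γ v u
  metric : ∀ u v w, fderiv ℝ h y u v w = h y (Γ u v) w + h y v (Γ u w)

omit [NormedAddCommGroup E] [NormedSpace ℝ E] in
theorem eq_zero_of_symm_of_antisymm {T : E → E → E → ℝ} (h1 : ∀ u v w, T u v w = T v u w)
    (h2 : ∀ u v w, T u v w = -T u w v) (u v w : E) : T u v w = 0 := by
  linarith [h1 u v w, h2 v u w, h1 v w u, h2 w v u, h1 w u v, h2 u w v]

/-- Uniqueness of the Levi-Civita connection. Let `S` be the difference of the two sides, with its
index lowered. It is symmetric in its first two arguments because both connections are torsion-free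
and D²φ is symmetric. Differentiating h = φ*h' and using both metric conditions makes it skew in the
last two. A trilinear expression with both symmetries vanishes. -/
theorem IsLeviCivitaAt.transition {h h' : E → E →L[ℝ] E →L[ℝ] ℝ} {φ : E → E} {y : E}
    {Γ Γ' : E →L[ℝ] E →L[ℝ] E} (hΓ : IsLeviCivitaAt h Γ y) (hΓ' : IsLeviCivitaAt h' Γ' (φ y))
    (hφ : ContDiffAt ℝ 2 φ y) (hh' : DifferentiableAt ℝ h' (φ y)) (hin : IsInner (h' (φ y)))
    (hdiff : DifferentiableAt ℝ h y)
    (hsurj : Function.Surjective (fderiv ℝ φ y))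
    (heq : ∀ᶠ x in 𝓝 y, ∀ v w, h x v w = h' (φ x) (fderiv ℝ φ x v) (fderiv ℝ φ x w)) (u v : E) :
    fderiv ℝ φ y (Γ u v) =
      Γ' (fderiv ℝ φ y u) (fderiv ℝ φ y v) + fderiv ℝ (fderiv ℝ φ) y u v := by
  have hφ1 : DifferentiableAt ℝ φ y := hφ.differentiableAt (by norm_num)
  have hφ2 : DifferentiableAt ℝ (fderiv ℝ φ) y :=
    (hφ.fderiv_right (m := 1) (by norm_num)).differentiableAt (by norm_num)
  have hh'φ : DifferentiableAt ℝ (fun x ↦ h' (φ x)) y := hh'.comp y hφ1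
  have hd : ∀ u v w, fderiv ℝ h y u v w =
      fderiv ℝ h' (φ y) (fderiv ℝ φ y u) (fderiv ℝ φ y v) (fderiv ℝ φ y w)
      + h' (φ y) (fderiv ℝ (fderiv ℝ φ) y u v) (fderiv ℝ φ y w)
      + h' (φ y) (fderiv ℝ φ y v) (fderiv ℝ (fderiv ℝ φ) y u w) := by
    intro u v w
    have e1 : fderiv ℝ (fun x ↦ h x v w) y u = fderiv ℝ h y u v w := by
      have := fderiv_bilinear_apply hdiff (differentiableAt_const v) (differentiableAt_const w) u
      simpa using this
    have e2 : (fun x ↦ h x v w) =ᶠ[𝓝 y]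
        fun x ↦ h' (φ x) (fderiv ℝ φ x v) (fderiv ℝ φ x w) := heq.mono fun x hx ↦ hx v w
    rw [← e1, e2.fderiv_eq, fderiv_bilinear_apply hh'φ (hφ2.clm_apply (differentiableAt_const v))
      (hφ2.clm_apply (differentiableAt_const w))]
    rw [fderiv_clm_apply hφ2 (differentiableAt_const v),
      fderiv_clm_apply hφ2 (differentiableAt_const w)]
    rw [fderiv_fun_comp (f := φ) (g := h') y hh' hφ1]
    simp
  set S : E → E → E := fun u v ↦ fderiv ℝ φ y (Γ u v) -
    (Γ' (fderiv ℝ φ y u) (fderiv ℝ φ y v) + fderiv ℝ (fderiv ℝ φ) y u v) with hS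
  have hD2 : ∀ u v, fderiv ℝ (fderiv ℝ φ) y u v = fderiv ℝ (fderiv ℝ φ) y v u := fun u v ↦
    (hφ.isSymmSndFDerivAt (by simp)).eq u v
  have hT : ∀ u v w, h' (φ y) (S u v) (fderiv ℝ φ y w) = 0 := by
    refine eq_zero_of_symm_of_antisymm ?_ ?_
    · intro u v w
      simp only [hS]
      rw [hΓ.symm u v, hΓ'.symm (fderiv ℝ φ y u), hD2 u v]
    · intro u v w
      have h1 := hd u v w
      rw [hΓ.metric, hΓ'.metric, heq.self_of_nhds, heq.self_of_nhds] at h1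
      simp only [hS, map_sub, map_add, sub_apply, add_apply]
      rw [hin.symm (fderiv ℝ φ y (Γ u w)), hin.symm (Γ' _ (fderiv ℝ φ y w)),
        hin.symm (fderiv ℝ (fderiv ℝ φ) y u w)]
      linarith
  have : S u v = 0 := hin.eq_zero_of_forall fun w ↦ by
    obtain ⟨w', rfl⟩ := hsurj w
    exact hT u v w'
  exact sub_eq_zero.1 this

end LeviCivita

/-! ### The Christoffel symbols of g and their change under charts -/

section Christoffel

variable {E : Type*} [NormedAddCommGroup E] [NormedSpace ℝ E] [FiniteDimensional ℝ E]
  {M : Type*} [TopologicalSpace M] [ChartedSpace E M] [IsManifold 𝓘(ℝ, E) ∞ M]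

omit [FiniteDimensional ℝ E] in
theorem flat_isInner (g : Metric E M) (x : M) : IsInner (flat g x) :=
  ⟨flat_symm g x, fun _ ↦ flat_pos g x⟩

omit [FiniteDimensional ℝ E] in
theorem chartMetric_isInner (g : Metric E M) {x : M} {y : E}
    (hy : y ∈ (extChartAt 𝓘(ℝ, E) x).target) : IsInner (chartMetric g x y) :=
  ⟨chartMetric_symm g x y, fun _ ↦ chartMetric_pos g hy⟩

omit [FiniteDimensional ℝ E] in
theorem fderiv_chartMetric_symm (g : Metric E M) {x : M} {y : E}
    (hy : y ∈ (extChartAt 𝓘(ℝ, E) x).target) (u v w : E) :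
    fderiv ℝ (chartMetric g x) y u v w = fderiv ℝ (chartMetric g x) y u w v := by
  have hd := (chartMetric_contDiffAt g hy).differentiableAt (by simp)
  have e1 : ∀ v w, fderiv ℝ (fun x' ↦ chartMetric g x x' v w) y u =
      fderiv ℝ (chartMetric g x) y u v w := by
    intro v w
    have := fderiv_bilinear_apply hd (differentiableAt_const v) (differentiableAt_const w) u
    simpa using this
  rw [← e1, ← e1]
  simp only [chartMetric_symm g x _ v w]

theorem christoffel_isLeviCivitaAt (g : Metric E M) {x : M} {y : E}
    (hy : y ∈ (extChartAt 𝓘(ℝ, E) x).target) :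
    IsLeviCivitaAt (chartMetric g x) (christoffel g x y) y := by
  have hin := chartMetric_isInner g hy
  have hs := fderiv_chartMetric_symm g hy
  -- The Koszul formula in coordinates; torsion-freeness and the metric condition both follow by
  -- permuting it.
  have hlow : ∀ u v w, chartMetric g x y (christoffel g x y u v) w =
      (fderiv ℝ (chartMetric g x) y u v w + fderiv ℝ (chartMetric g x) y v u w
        - fderiv ℝ (chartMetric g x) y w u v) / 2 := by
    intro u v w
    have : christoffel g x y u v = (chartMetric g x y).inverse (christoffelFirst g x y u v) := rfl
    rw [this, hin.apply_inverse]
    simp [christoffelFirst, flipCLM]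
    ring
  constructor
  · intro u v
    refine sub_eq_zero.1 (hin.eq_zero_of_forall fun w ↦ ?_)
    rw [map_sub, sub_apply, hlow, hlow, hs w u v]
    ring
  · intro u v w
    rw [hin.symm v, hlow, hlow, hs u w v]
    ring

theorem christoffel_transition (g : Metric E M) {x x₀ : M}
    (hx : x ∈ (extChartAt 𝓘(ℝ, E) x₀).source) (u v : E) :
    fderiv ℝ (baseTransition x x₀) (extChartAt 𝓘(ℝ, E) x x) (christoffelAt g x u v) =
      christoffel g x₀ (extChartAt 𝓘(ℝ, E) x₀ x)
        (fderiv ℝ (baseTransition x x₀) (extChartAt 𝓘(ℝ, E) x x) u)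
        (fderiv ℝ (baseTransition x x₀) (extChartAt 𝓘(ℝ, E) x x) v)
      + fderiv ℝ (fderiv ℝ (baseTransition x x₀)) (extChartAt 𝓘(ℝ, E) x x) u v := by
  have hφ : baseTransition x x₀ (extChartAt 𝓘(ℝ, E) x x) = extChartAt 𝓘(ℝ, E) x₀ x := by
    rw [baseTransition, Function.comp_apply, extChartAt_to_inv]
  have hx' : extChartAt 𝓘(ℝ, E) x₀ x ∈ (extChartAt 𝓘(ℝ, E) x₀).target :=
    (extChartAt 𝓘(ℝ, E) x₀).map_source hx
  have hmem := mem_extChartAt_target (I := 𝓘(ℝ, E)) x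
  have hcd := baseTransition_contDiffAt hmem (x₀ := x₀) (by rwa [extChartAt_to_inv])
  have hinj : Function.Injective
      (fderiv ℝ (baseTransition x x₀) (extChartAt 𝓘(ℝ, E) x x)) := by
    intro a b hab
    have h1 := fderiv_baseTransition_eq hx
    have h2 := fun w ↦ congrArg (fun L : E →L[ℝ] E ↦ L w) h1
    simp only [ContinuousLinearMap.comp_apply, ContinuousLinearMap.id_apply] at h2
    rw [← h2 a, hab, h2 b]
  rw [← hφ]
  refine IsLeviCivitaAt.transition (h := chartMetric g x) (h' := chartMetric g x₀)
    (christoffel_isLeviCivitaAt g hmem) ?_ (hcd.of_le (by norm_cast)) ?_ ?_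
    ((chartMetric_contDiffAt g hmem).differentiableAt (by simp))
    (LinearMap.injective_iff_surjective (f := (fderiv ℝ (baseTransition x x₀) _).toLinearMap).1 hinj)
    ?_ u v
  · rw [hφ]; exact christoffel_isLeviCivitaAt g hx'
  · rw [hφ]; exact (chartMetric_contDiffAt g hx').differentiableAt (by simp)
  · rw [hφ]; exact chartMetric_isInner g hx'
  · filter_upwards [eventually_mem_overlap hx] with y hy v w
    exact chartMetric_transition g hy.1 hy.2 v w

end Christoffel

/-! ### The tensor field and the 2-form in coordinates -/

section LocalModel

variable {E : Type*} [NormedAddCommGroup E] [NormedSpace ℝ E]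

/-- The map of tangent vectors involved here applies `B` to horizontal parts and composition with
`C` to vertical parts. It therefore intertwines the lifted tensors as soon as it intertwines the two
component maps. -/
theorem liftTensor_transport {B C : E →L[ℝ] E} {K K' A A' : E →L[ℝ] E →L[ℝ] ℝ}
    {S S' : (E →L[ℝ] ℝ) →L[ℝ] E} (hA : ∀ u, A u ∘L C = A' (B u))
    (hS : ∀ κ, S' (κ ∘L C) = B (S κ)) (v : E × (E →L[ℝ] ℝ)) :
    (B (liftTensor K A S v).1, ((liftTensor K A S v).2 - K (liftTensor K A S v).1) ∘L C
      + K' (B (liftTensor K A S v).1)) =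
      liftTensor K' A' S' (B v.1, (v.2 - K v.1) ∘L C + K' (B v.1)) := by
  obtain ⟨u, β⟩ := v
  simp only [liftTensor_apply, add_sub_cancel_right, hA, hS]

/-- `u ↦ ξ(Γ(u, ·))`. -/
def connForm (Γ : E →L[ℝ] E →L[ℝ] E) (ξ : E →L[ℝ] ℝ) : E →L[ℝ] E →L[ℝ] ℝ :=
  (compL ℝ E E ℝ ξ) ∘L Γ

theorem connForm_apply (Γ : E →L[ℝ] E →L[ℝ] E) (ξ : E →L[ℝ] ℝ) (u v : E) :
    connForm Γ ξ u v = ξ (Γ u v) := rfl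

/-- The energy density in coordinates. -/
def localEnergy (h : E → E →L[ℝ] E →L[ℝ] ℝ) (z : E × (E →L[ℝ] ℝ)) : ℝ := halfSq (h z.1) z.2

/-- The natural diagonal tensor field in coordinates. -/
def localTensor (h : E → E →L[ℝ] E →L[ℝ] ℝ) (Γ : E → E →L[ℝ] E →L[ℝ] E) (a₁ b₁ a₂ b₂ : ℝ → ℝ)
    (z : E × (E →L[ℝ] ℝ)) : E × (E →L[ℝ] ℝ) →L[ℝ] E × (E →L[ℝ] ℝ) :=
  liftTensor (connForm (Γ z.1) z.2)
    (naturalFlat (h z.1) z.2 (a₁ (localEnergy h z)) (b₁ (localEnergy h z)))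
    (naturalSharp (h z.1) z.2 (a₂ (localEnergy h z)) (b₂ (localEnergy h z)))

/-- The form `g⁻¹(ξ, κ)`, where `κ` is the vertical part of a tangent vector. -/
def vertForm (h : E →L[ℝ] E →L[ℝ] ℝ) (Γ : E →L[ℝ] E →L[ℝ] E) (ξ : E →L[ℝ] ℝ) :
    E × (E →L[ℝ] ℝ) →L[ℝ] ℝ :=
  ContinuousLinearMap.apply ℝ ℝ (h.inverse ξ) ∘L
    (snd ℝ E (E →L[ℝ] ℝ) - connForm Γ ξ ∘L fst ℝ E (E →L[ℝ] ℝ))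

theorem vertForm_apply (h : E →L[ℝ] E →L[ℝ] ℝ) (Γ : E →L[ℝ] E →L[ℝ] E) (ξ : E →L[ℝ] ℝ)
    (v : E × (E →L[ℝ] ℝ)) :
    vertForm h Γ ξ v = (v.2 - connForm Γ ξ v.1) (h.inverse ξ) := rfl

/-- The Liouville form `p dq`. -/
def liouvilleForm (ξ : E →L[ℝ] ℝ) : E × (E →L[ℝ] ℝ) →L[ℝ] ℝ := ξ ∘L fst ℝ E (E →L[ℝ] ℝ)

theorem liouvilleForm_apply (ξ : E →L[ℝ] ℝ) (v : E × (E →L[ℝ] ℝ)) :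
    liouvilleForm ξ v = ξ v.1 := rfl

variable (E) in
/-- The canonical symplectic form. -/
def canonicalForm : E × (E →L[ℝ] ℝ) →L[ℝ] E × (E →L[ℝ] ℝ) →L[ℝ] ℝ :=
  ((ContinuousLinearMap.id ℝ (E →L[ℝ] ℝ)).bilinearComp
    (snd ℝ E (E →L[ℝ] ℝ)) (fst ℝ E (E →L[ℝ] ℝ))).flip -
  (ContinuousLinearMap.id ℝ (E →L[ℝ] ℝ)).bilinearComp
    (snd ℝ E (E →L[ℝ] ℝ)) (fst ℝ E (E →L[ℝ] ℝ))

theorem canonicalForm_apply (v w : E × (E →L[ℝ] ℝ)) :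
    canonicalForm E v w = w.2 v.1 - v.2 w.1 := rfl

/-- The exterior product of two linear forms. -/
def wedge {F : Type*} [NormedAddCommGroup F] [NormedSpace ℝ F] (θ τ : F →L[ℝ] ℝ) :
    F →L[ℝ] F →L[ℝ] ℝ :=
  θ.smulRight τ - τ.smulRight θ

theorem wedge_apply {F : Type*} [NormedAddCommGroup F] [NormedSpace ℝ F] (θ τ : F →L[ℝ] ℝ)
    (v w : F) : wedge θ τ v w = θ v * τ w - τ v * θ w := by
  simp [wedge]

/-- The form `λ(t) ω + μ(t) p dq ∧ dt` in coordinates. -/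
def localForm (h : E → E →L[ℝ] E →L[ℝ] ℝ) (Γ : E → E →L[ℝ] E →L[ℝ] E) (lam mu : ℝ → ℝ)
    (z : E × (E →L[ℝ] ℝ)) : E × (E →L[ℝ] ℝ) →L[ℝ] E × (E →L[ℝ] ℝ) →L[ℝ] ℝ :=
  lam (localEnergy h z) • canonicalForm E + mu (localEnergy h z) •
    wedge (liouvilleForm z.2) (vertForm (h z.1) (Γ z.1) z.2)

theorem localForm_apply (h : E → E →L[ℝ] E →L[ℝ] ℝ) (Γ : E → E →L[ℝ] E →L[ℝ] E) (lam mu : ℝ → ℝ)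
    (z v w : E × (E →L[ℝ] ℝ)) :
    localForm h Γ lam mu z v w = lam (localEnergy h z) * (w.2 v.1 - v.2 w.1) +
      mu (localEnergy h z) * (z.2 v.1 * vertForm (h z.1) (Γ z.1) z.2 w
        - vertForm (h z.1) (Γ z.1) z.2 v * z.2 w.1) := by
  simp [localForm, canonicalForm_apply, wedge_apply, liouvilleForm_apply]

end LocalModel

/-! ### Coordinate expressions of natural tensors near a point of T*M -/

section Transfer

variable {E : Type*} [NormedAddCommGroup E] [NormedSpace ℝ E] [FiniteDimensional ℝ E]
  {M : Type*} [TopologicalSpace M] [ChartedSpace E M] [IsManifold 𝓘(ℝ, E) ∞ M]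

omit [FiniteDimensional ℝ E] in
theorem energy_eq_halfSq (g : Metric E M) (p : CotangentBundle E M) :
    energy g p = halfSq (flat g p.proj) (covector p) := rfl

omit [FiniteDimensional ℝ E] in
theorem naturalTensor_eq_liftTensor (g : Metric E M) (a₁ b₁ a₂ b₂ : ℝ → ℝ)
    (p : CotangentBundle E M) :
    naturalTensor g a₁ b₁ a₂ b₂ p = liftTensor (connForm (christoffelAt g p.proj) (covector p))
      (naturalFlat (flat g p.proj) (covector p) (a₁ (energy g p)) (b₁ (energy g p)))
      (naturalSharp (flat g p.proj) (covector p) (a₂ (energy g p)) (b₂ (energy g p))) := rfl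

/-- The second derivative in `cotangent_coordFrame` is, by `christoffel_transition`, the difference
of the two connection forms. So the coordinate frame at every nearby point respects the splitting
into horizontal and vertical parts, acting by `B` on the former and by its inverse `C` on covectors.
-/
theorem cotangentFrame_lift (g : Metric E M) {p : CotangentBundle E M} {z : E × (E →L[ℝ] ℝ)}
    (hz : z.1 ∈ (extChartAt 𝓘(ℝ, E) p.proj).target) :
    ∃ (q : CotangentBundle E M) (B C : E →L[ℝ] E),
      (extChartAt (cotangentModel E) p).symm z = q ∧
      (∀ v, B (C v) = v) ∧ C ∘L B = ContinuousLinearMap.id ℝ E ∧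
      covector q = z.2 ∘L C ∧
      (∀ v w, flat g q.proj v w = chartMetric g p.proj z.1 (C v) (C w)) ∧
      ∀ v : E × (E →L[ℝ] ℝ), (coordFrame (cotangentModel E) p z v : E × (E →L[ℝ] ℝ)) =
        (B v.1, (v.2 - connForm (christoffel g p.proj z.1) z.2 v.1) ∘L C
          + connForm (christoffelAt g q.proj) (covector q) (B v.1)) := by
  obtain ⟨y, ξ⟩ := z
  simp only at hz ⊢
  set q := (extChartAt (cotangentModel E) p).symm (y, ξ) with hq
  have hqy : q.proj = (extChartAt 𝓘(ℝ, E) p.proj).symm y :=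
    cotangent_extChartAt_symm_proj (z := (y, ξ)) hz
  have hqs : q.proj ∈ (extChartAt 𝓘(ℝ, E) p.proj).source := by
    rw [hqy]; exact (extChartAt 𝓘(ℝ, E) p.proj).map_target hz
  have hy : extChartAt 𝓘(ℝ, E) p.proj q.proj = y := by
    rw [hqy, (extChartAt 𝓘(ℝ, E) p.proj).right_inv hz]
  set B := frame p.proj y with hB
  set C := fderiv ℝ (baseTransition q.proj p.proj) (extChartAt 𝓘(ℝ, E) q.proj q.proj) with hC
  have hBC : B ∘L C = ContinuousLinearMap.id ℝ E := by
    have := fderiv_baseTransition_eq hqs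
    rwa [hy] at this
  have hBC' : ∀ v, B (C v) = v := fun v ↦ congrArg (fun L : E →L[ℝ] E ↦ L v) hBC
  have hCB : C ∘L B = ContinuousLinearMap.id ℝ E := by
    obtain ⟨e, he⟩ := frame_isInvertible hz
    ext v
    have h1 : e (C (B v)) = e v := by
      have := hBC' (B v)
      rw [hB, ← he] at this
      rw [hB, ← he]
      exact this
    exact e.injective h1
  have hCB' : ∀ v, C (B v) = v := fun v ↦ congrArg (fun L : E →L[ℝ] E ↦ L v) hCB
  have hcov : covector q = ξ ∘L C := by
    have h1 := covector_extChartAt_symm (z := (y, ξ)) hz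
    have h2 : covector q ∘L B = ξ := h1
    rw [← h2, ContinuousLinearMap.comp_assoc, hBC]
    rfl
  refine ⟨q, B, C, rfl, hBC', hCB, hcov, ?_, ?_⟩
  · intro v w
    have := chartMetric_transition g (mem_extChartAt_target (I := 𝓘(ℝ, E)) q.proj)
      (x₀ := p.proj) (by rwa [extChartAt_to_inv]) v w
    rw [chartMetric_self, baseTransition, Function.comp_apply, extChartAt_to_inv, hy] at this
    exact this
  · rintro ⟨u, β⟩
    rw [cotangent_coordFrame hz hq.symm u β]
    refine Prod.ext rfl ?_
    ext v
    -- Applied to `B u`, so that C (B u) = u makes the coordinate vector `u` appear.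
    have h1 := christoffel_transition g hqs (B u) v
    rw [← hC, hCB', hy] at h1
    simp only [add_apply, ContinuousLinearMap.comp_apply, sub_apply, connForm_apply, hcov, h1,
      map_add]
    ring

theorem coordFrame_naturalTensor (g : Metric E M) (a₁ b₁ a₂ b₂ : ℝ → ℝ)
    (p : CotangentBundle E M) {z : E × (E →L[ℝ] ℝ)}
    (hz : z.1 ∈ (extChartAt 𝓘(ℝ, E) p.proj).target) (v : E × (E →L[ℝ] ℝ)) :
    coordFrame (cotangentModel E) p z
        (localTensor (chartMetric g p.proj) (christoffel g p.proj) a₁ b₁ a₂ b₂ z v) =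
      naturalTensor g a₁ b₁ a₂ b₂ ((extChartAt (cotangentModel E) p).symm z)
        (coordFrame (cotangentModel E) p z v) := by
  obtain ⟨q, B, C, hq, hBC, hCB, hcov, hflat, hframe⟩ := cotangentFrame_lift g hz
  have hCB' : ∀ v, C (B v) = v := fun v ↦ congrArg (fun L : E →L[ℝ] E ↦ L v) hCB
  have hinv : ∀ β : E →L[ℝ] ℝ, (flat g q.proj).inverse (β ∘L C) =
      B ((chartMetric g p.proj z.1).inverse β) :=
    inverse_transport (flat_isInner g _) (chartMetric_isInner g hz) hflat hCB
  have hen : energy g q = localEnergy (chartMetric g p.proj) z := by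
    rw [energy_eq_halfSq, localEnergy, halfSq, halfSq, hcov, hinv, ContinuousLinearMap.comp_apply,
      hCB']
  rw [hq]
  have h1 : (coordFrame (cotangentModel E) p z
      (localTensor (chartMetric g p.proj) (christoffel g p.proj) a₁ b₁ a₂ b₂ z v) :
      E × (E →L[ℝ] ℝ)) = _ := hframe _
  have h2 : (coordFrame (cotangentModel E) p z v : E × (E →L[ℝ] ℝ)) = _ := hframe v
  have h3 : ∀ w : E × (E →L[ℝ] ℝ), (naturalTensor g a₁ b₁ a₂ b₂ q w : E × (E →L[ℝ] ℝ)) = _ :=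
    fun w ↦ congrArg (fun L : E × (E →L[ℝ] ℝ) →L[ℝ] E × (E →L[ℝ] ℝ) ↦ L w)
      (naturalTensor_eq_liftTensor g a₁ b₁ a₂ b₂ q)
  refine h1.trans (Eq.trans ?_ ((congrArg (fun w : E × (E →L[ℝ] ℝ) ↦
    (naturalTensor g a₁ b₁ a₂ b₂ q w : E × (E →L[ℝ] ℝ))) h2).trans (h3 _)).symm)
  refine liftTensor_transport ?_ ?_ v
  · intro u
    ext w
    simp only [ContinuousLinearMap.comp_apply, naturalFlat_apply, hcov, hCB', hflat, hen]
  · intro κ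
    rw [naturalSharp_apply, naturalSharp_apply, hcov, hinv, hinv, map_add, map_smul, map_smul,
      ContinuousLinearMap.comp_apply, hCB', hen]

theorem energy_coord (g : Metric E M) (p : CotangentBundle E M) {z : E × (E →L[ℝ] ℝ)}
    (hz : z.1 ∈ (extChartAt 𝓘(ℝ, E) p.proj).target) :
    energy g ((extChartAt (cotangentModel E) p).symm z) =
      localEnergy (chartMetric g p.proj) z := by
  obtain ⟨q, B, C, hq, hBC, hCB, hcov, hflat, hframe⟩ := cotangentFrame_lift g hz
  have hCB' : ∀ v, C (B v) = v := fun v ↦ congrArg (fun L : E →L[ℝ] E ↦ L v) hCB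
  rw [hq, energy_eq_halfSq, localEnergy, halfSq, halfSq, hcov,
    inverse_transport (flat_isInner g _) (chartMetric_isInner g hz) hflat hCB,
    ContinuousLinearMap.comp_apply, hCB']

end Transfer

/-! ### Algebraic relations of an almost para-Hermitian structure -/

section Coefficients

variable {E : Type*} [NormedAddCommGroup E] [NormedSpace ℝ E] [FiniteDimensional ℝ E]

theorem IsInner.exists_halfSq_eq [Nontrivial E] {h : E →L[ℝ] E →L[ℝ] ℝ} (hh : IsInner h) {t : ℝ}
    (ht : 0 ≤ t) : ∃ ξ : E →L[ℝ] ℝ, halfSq h ξ = t := by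
  obtain ⟨v, hv⟩ := exists_ne (0 : E)
  have hpos := hh.pos v hv
  refine ⟨Real.sqrt (2 * t / h v v) • h v, ?_⟩
  rw [halfSq, map_smul, hh.inverse_apply]
  simp only [smul_apply, map_smul, smul_eq_mul]
  rw [← mul_assoc √_, Real.mul_self_sqrt (by positivity)]
  field_simp

theorem exists_ne_zero_apply_eq_zero (hn : 2 ≤ Module.finrank ℝ E) (ξ : E →L[ℝ] ℝ) :
    ∃ u : E, u ≠ 0 ∧ ξ u = 0 := by
  have h1 := ξ.toLinearMap.finrank_range_add_finrank_ker
  have h2 : Module.finrank ℝ (LinearMap.range ξ.toLinearMap) ≤ 1 := by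
    simpa using Submodule.finrank_le (LinearMap.range ξ.toLinearMap)
  have h3 : 0 < Module.finrank ℝ (LinearMap.ker ξ.toLinearMap) := by omega
  obtain ⟨⟨u, hu⟩, hne⟩ := Module.finrank_pos_iff_exists_ne_zero.1 h3
  exact ⟨u, fun h0 ↦ hne (by ext; exact h0), hu⟩

variable {M : Type*} [TopologicalSpace M] [ChartedSpace E M] [IsManifold 𝓘(ℝ, E) ∞ M]

omit [FiniteDimensional ℝ E] in
theorem naturalMetric_apply (g : Metric E M) (c₁ d₁ c₂ d₂ : ℝ → ℝ) (p : CotangentBundle E M)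
    (v w : E × (E →L[ℝ] ℝ)) :
    naturalMetric g c₁ d₁ c₂ d₂ p v w =
      c₁ (energy g p) * flat g p.proj v.1 w.1
      + d₁ (energy g p) * (covector p v.1 * covector p w.1)
      + (c₂ (energy g p) * (v.2 - connForm (christoffelAt g p.proj) (covector p) v.1)
          ((flat g p.proj).inverse (w.2 - connForm (christoffelAt g p.proj) (covector p) w.1))
        + d₂ (energy g p) *
          (covector p ((flat g p.proj).inverse
            (v.2 - connForm (christoffelAt g p.proj) (covector p) v.1))
          * covector p ((flat g p.proj).inverse
            (w.2 - connForm (christoffelAt g p.proj) (covector p) w.1)))) := rfl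

/-- The algebraic relations between the coefficients of an almost para-Hermitian structure. -/
structure ParaHermitianRelations (a₁ b₁ a₂ b₂ c₁ d₁ c₂ d₂ : ℝ → ℝ) (t : ℝ) : Prop where
  mul_orth : a₁ t * a₂ t = 1
  mul_radial : (a₁ t + 2 * t * b₁ t) * (a₂ t + 2 * t * b₂ t) = 1
  metric_orth : c₂ t * a₁ t ^ 2 = -c₁ t
  metric_radial : (c₂ t + 2 * t * d₂ t) * (a₁ t + 2 * t * b₁ t) ^ 2 = -(c₁ t + 2 * t * d₁ t)

omit [FiniteDimensional ℝ E] in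
theorem naturalFlat_of_apply_eq_zero {h : E →L[ℝ] E →L[ℝ] ℝ} {ξ : E →L[ℝ] ℝ} {u : E} (hu : ξ u = 0)
    (a b : ℝ) : naturalFlat h ξ a b u = a • h u := by
  ext v
  simp [naturalFlat_apply, hu]

theorem IsInner.naturalFlat_inverse {h : E →L[ℝ] E →L[ℝ] ℝ} (hh : IsInner h) (ξ : E →L[ℝ] ℝ)
    (a b : ℝ) : naturalFlat h ξ a b (h.inverse ξ) = (a + 2 * halfSq h ξ * b) • ξ := by
  ext v
  simp [naturalFlat_apply, hh.apply_inverse, halfSq]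
  ring

omit [FiniteDimensional ℝ E] in
theorem naturalTensor_apply (g : Metric E M) (a₁ b₁ a₂ b₂ : ℝ → ℝ) (p : CotangentBundle E M)
    (w : E × (E →L[ℝ] ℝ)) :
    (naturalTensor g a₁ b₁ a₂ b₂ p w : E × (E →L[ℝ] ℝ)) =
      liftTensor (connForm (christoffelAt g p.proj) (covector p))
        (naturalFlat (flat g p.proj) (covector p) (a₁ (energy g p)) (b₁ (energy g p)))
        (naturalSharp (flat g p.proj) (covector p) (a₂ (energy g p)) (b₂ (energy g p))) w := rfl

omit [FiniteDimensional ℝ E] in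
theorem naturalTensor_hlift (g : Metric E M) (a₁ b₁ a₂ b₂ : ℝ → ℝ) (p : CotangentBundle E M)
    (w : E) :
    (naturalTensor g a₁ b₁ a₂ b₂ p (w, connForm (christoffelAt g p.proj) (covector p) w) :
      E × (E →L[ℝ] ℝ)) =
      (0, naturalFlat (flat g p.proj) (covector p) (a₁ (energy g p)) (b₁ (energy g p)) w) := by
  refine (naturalTensor_apply g a₁ b₁ a₂ b₂ p _).trans ?_
  simp only [liftTensor_apply, sub_self, map_zero, add_zero]
  rfl

omit [FiniteDimensional ℝ E] in
theorem naturalTensor_vlift (g : Metric E M) (a₁ b₁ a₂ b₂ : ℝ → ℝ) (p : CotangentBundle E M)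
    (β : E →L[ℝ] ℝ) :
    (naturalTensor g a₁ b₁ a₂ b₂ p ((0 : E), β) : E × (E →L[ℝ] ℝ)).1 =
      naturalSharp (flat g p.proj) (covector p) (a₂ (energy g p)) (b₂ (energy g p)) β := by
  refine (congrArg Prod.fst (naturalTensor_apply g a₁ b₁ a₂ b₂ p _)).trans ?_
  simp only [liftTensor_apply, sub_zero, map_zero]

omit [FiniteDimensional ℝ E] in
theorem naturalSharp_naturalFlat {g : Metric E M} {a₁ b₁ a₂ b₂ : ℝ → ℝ}
    (hP : IsAlmostProduct (cotangentModel E) (naturalTensor g a₁ b₁ a₂ b₂))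
    (p : CotangentBundle E M) (w : E) :
    naturalSharp (flat g p.proj) (covector p) (a₂ (energy g p)) (b₂ (energy g p))
      (naturalFlat (flat g p.proj) (covector p) (a₁ (energy g p)) (b₁ (energy g p)) w) = w := by
  rw [← naturalTensor_vlift g a₁ b₁]
  have h2 := hP p (w, connForm (christoffelAt g p.proj) (covector p) w)
  have h3 := congrArg (fun y : E × (E →L[ℝ] ℝ) ↦
    (naturalTensor g a₁ b₁ a₂ b₂ p y : E × (E →L[ℝ] ℝ))) (naturalTensor_hlift g a₁ b₁ a₂ b₂ p w)
  exact congrArg Prod.fst (h3.symm.trans h2)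

omit [FiniteDimensional ℝ E] in
theorem naturalMetric_naturalFlat {g : Metric E M} {a₁ b₁ a₂ b₂ c₁ d₁ c₂ d₂ : ℝ → ℝ}
    (hGP : IsAlmostParaHermitian (cotangentModel E) (naturalMetric g c₁ d₁ c₂ d₂)
      (naturalTensor g a₁ b₁ a₂ b₂)) (p : CotangentBundle E M) (w : E) {α : E →L[ℝ] ℝ}
    (hα : naturalFlat (flat g p.proj) (covector p) (a₁ (energy g p)) (b₁ (energy g p)) w = α) :
    c₂ (energy g p) * α ((flat g p.proj).inverse α) + d₂ (energy g p) *
      (covector p ((flat g p.proj).inverse α) * covector p ((flat g p.proj).inverse α)) =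
      -(c₁ (energy g p) * flat g p.proj w w
        + d₁ (energy g p) * (covector p w * covector p w)) := by
  have h1 := hGP.compatible p (w, connForm (christoffelAt g p.proj) (covector p) w)
    (w, connForm (christoffelAt g p.proj) (covector p) w)
  have h2 := naturalTensor_hlift g a₁ b₁ a₂ b₂ p w
  rw [hα] at h2
  have h3 : naturalMetric g c₁ d₁ c₂ d₂ p ((0 : E), α) ((0 : E), α) =
      -naturalMetric g c₁ d₁ c₂ d₂ p (w, connForm (christoffelAt g p.proj) (covector p) w)
        (w, connForm (christoffelAt g p.proj) (covector p) w) :=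
    (congrArg (fun y : E × (E →L[ℝ] ℝ) ↦ naturalMetric g c₁ d₁ c₂ d₂ p y y) h2).symm.trans h1
  rw [naturalMetric_apply, naturalMetric_apply] at h3
  simpa using h3

/-- Choose a covector ξ of energy `t`. A nonzero `u` in its kernel, which exists because n ≥ 2, sees
only the coefficients a and c; the vector ξ♯ sees only the radial combinations a + 2tb and c + 2td.
Evaluating P² = 1 and the compatibility of G on the horizontal lifts of these two vectors gives the
four relations. -/
theorem paraHermitianRelations (hn : 2 ≤ Module.finrank ℝ E) [Nonempty M] (g : Metric E M)
    {a₁ b₁ a₂ b₂ c₁ d₁ c₂ d₂ : ℝ → ℝ}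
    (hGP : IsAlmostParaHermitian (cotangentModel E) (naturalMetric g c₁ d₁ c₂ d₂)
      (naturalTensor g a₁ b₁ a₂ b₂)) {t : ℝ} (ht : 0 ≤ t) :
    ParaHermitianRelations a₁ b₁ a₂ b₂ c₁ d₁ c₂ d₂ t := by
  have : Nontrivial E := Module.nontrivial_of_finrank_pos (R := ℝ) (by omega)
  obtain ⟨x⟩ := ‹Nonempty M›
  have hh := flat_isInner g x
  obtain ⟨ξ, hξ⟩ := hh.exists_halfSq_eq ht
  obtain ⟨u, hu0, hu⟩ := exists_ne_zero_apply_eq_zero hn ξ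
  have hen : energy g (⟨x, ξ⟩ : CotangentBundle E M) = t := hξ
  have hJJ : ∀ w : E, naturalSharp (flat g x) ξ (a₂ t) (b₂ t)
      (naturalFlat (flat g x) ξ (a₁ t) (b₁ t) w) = w := by
    intro w
    have h1 := naturalSharp_naturalFlat hGP.almostProduct (⟨x, ξ⟩ : CotangentBundle E M) w
    rwa [hen] at h1
  have hG : ∀ (w : E) (α : E →L[ℝ] ℝ), naturalFlat (flat g x) ξ (a₁ t) (b₁ t) w = α →
      c₂ t * α ((flat g x).inverse α)
      + d₂ t * (ξ ((flat g x).inverse α) * ξ ((flat g x).inverse α)) =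
      -(c₁ t * flat g x w w + d₁ t * (ξ w * ξ w)) := by
    intro w α hα
    have h1 := naturalMetric_naturalFlat hGP (⟨x, ξ⟩ : CotangentBundle E M) w (α := α)
    rw [hen] at h1
    exact h1 hα
  have huu := hh.pos u hu0
  have hmul : a₁ t * a₂ t = 1 := by
    have h1 := hJJ u
    rw [naturalFlat_of_apply_eq_zero hu, naturalSharp_apply, map_smul, hh.inverse_apply, map_smul,
      hu, smul_zero, mul_zero, zero_smul, add_zero, smul_smul] at h1
    have h2 : (a₂ t * a₁ t - 1) • u = 0 := by rw [sub_smul, h1, one_smul, sub_self]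
    have h3 := (smul_eq_zero.1 h2).resolve_right hu0
    linarith
  have hmet : c₂ t * a₁ t ^ 2 = -c₁ t := by
    have h1 := hG u _ (naturalFlat_of_apply_eq_zero hu _ _)
    rw [map_smul, hh.inverse_apply, map_smul, hu] at h1
    simp only [smul_apply, map_smul, smul_eq_mul, hu] at h1
    have h2 : (c₂ t * a₁ t ^ 2 + c₁ t) * flat g x u u = 0 := by linear_combination h1
    have h3 := (mul_eq_zero.1 h2).resolve_right huu.ne'
    linarith
  -- At t = 0 the radial relations coincide with the orthogonal ones; otherwise the factor ξ(ξ♯) =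
  -- 2t can be cancelled.
  rcases ht.eq_or_lt with rfl | htpos
  · exact ⟨hmul, by simpa using hmul, hmet, by simpa using hmet⟩
  have hξs : ξ ((flat g x).inverse ξ) = 2 * t := by rw [← hξ, halfSq]; ring
  refine ⟨hmul, ?_, hmet, ?_⟩
  · have h1 := hJJ ((flat g x).inverse ξ)
    rw [hh.naturalFlat_inverse, hξ, naturalSharp_apply, map_smul, map_smul, hξs] at h1
    have h2 := congrArg ξ h1
    simp only [map_add, map_smul, smul_eq_mul, hξs] at h2
    have h3 : (2 * t) * ((a₁ t + 2 * t * b₁ t) * (a₂ t + 2 * t * b₂ t) - 1) = 0 := by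
      linear_combination h2
    have h4 := (mul_eq_zero.1 h3).resolve_left (by positivity)
    linarith
  · have h1 := hG ((flat g x).inverse ξ) _ (hh.naturalFlat_inverse _ _ _)
    rw [hξ, map_smul, hh.apply_inverse] at h1
    simp only [smul_apply, map_smul, smul_eq_mul, hξs] at h1
    have h3 : (2 * t) * ((c₂ t + 2 * t * d₂ t) * (a₁ t + 2 * t * b₁ t) ^ 2 +
        (c₁ t + 2 * t * d₁ t)) = 0 := by linear_combination h1
    have h4 := (mul_eq_zero.1 h3).resolve_left (by positivity)
    linarith

end Coefficients

/-! ### Existence of the proportionality factors -/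

section Existence

variable {a₁ b₁ a₂ b₂ c₁ d₁ c₂ d₂ : ℝ → ℝ}

theorem exists_proportionalityFactors
    (ha₁ : SmoothCoeff a₁) (hb₁ : SmoothCoeff b₁) (hc₁ : SmoothCoeff c₁) (hd₁ : SmoothCoeff d₁)
    (hrel : ∀ t, 0 ≤ t → ParaHermitianRelations a₁ b₁ a₂ b₂ c₁ d₁ c₂ d₂ t) :
    ∃ lam mu : ℝ → ℝ, AreProportionalityFactors a₁ b₁ a₂ b₂ c₁ d₁ c₂ d₂ lam mu := by
  have hne : ∀ t, 0 ≤ t →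
      a₁ t ≠ 0 ∧ a₂ t ≠ 0 ∧ a₁ t + 2 * t * b₁ t ≠ 0 ∧ a₂ t + 2 * t * b₂ t ≠ 0 := fun t ht ↦
    ⟨left_ne_zero_of_mul_eq_one (hrel t ht).mul_orth,
      right_ne_zero_of_mul_eq_one (hrel t ht).mul_orth,
      left_ne_zero_of_mul_eq_one (hrel t ht).mul_radial,
      right_ne_zero_of_mul_eq_one (hrel t ht).mul_radial⟩
  have hr : ContDiffOn ℝ ∞ (fun t ↦ a₁ t + 2 * t * b₁ t) (Set.Ici 0) :=
    ha₁.add ((contDiffOn_const.mul contDiffOn_id).mul hb₁)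
  -- Here μ is the difference of the radial and orthogonal quotients divided by 2t. Over a common
  -- denominator the factor 2t cancels explicitly, so μ is smooth up to t = 0.
  refine ⟨fun t ↦ c₁ t / a₁ t,
    fun t ↦ (d₁ t * a₁ t - c₁ t * b₁ t) / (a₁ t * (a₁ t + 2 * t * b₁ t)), ?_, ?_, hne, ?_, ?_⟩
  · exact hc₁.div ha₁ fun t ht ↦ (hne t ht).1
  · exact ((hd₁.mul ha₁).sub (hc₁.mul hb₁)).div (ha₁.mul hr) fun t ht ↦
      mul_ne_zero (hne t ht).1 (hne t ht).2.2.1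
  · intro t ht
    obtain ⟨h1, h2, h3, h4⟩ := hne t ht
    refine ⟨rfl, ?_⟩
    have e1 := (hrel t ht).mul_orth
    have e2 := (hrel t ht).metric_orth
    rw [← neg_div, div_eq_div_iff h2 h1]
    have : c₁ t = -(c₂ t * a₁ t ^ 2) := by linarith
    rw [this]
    linear_combination c₂ t * a₁ t * e1
  · intro t ht
    obtain ⟨h1, h2, h3, h4⟩ := hne t ht
    have e1 := (hrel t ht).mul_radial
    have e2 := (hrel t ht).metric_radial
    have key : (c₁ t + 2 * t * d₁ t) / (a₁ t + 2 * t * b₁ t) = c₁ t / a₁ t +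
        2 * t * ((d₁ t * a₁ t - c₁ t * b₁ t) / (a₁ t * (a₁ t + 2 * t * b₁ t))) := by
      field_simp
      ring
    refine ⟨key, ?_⟩
    rw [← key, ← neg_div, div_eq_div_iff h4 h3]
    have : c₁ t + 2 * t * d₁ t = -((c₂ t + 2 * t * d₂ t) * (a₁ t + 2 * t * b₁ t) ^ 2) := by
      linarith
    rw [this]
    linear_combination (c₂ t + 2 * t * d₂ t) * (a₁ t + 2 * t * b₁ t) * e1

end Existence

/-! ### The associated 2-form is λω + μ θ ∧ dt -/

section Form

variable {E : Type*} [NormedAddCommGroup E] [NormedSpace ℝ E] [FiniteDimensional ℝ E]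
  {M : Type*} [TopologicalSpace M] [ChartedSpace E M] [IsManifold 𝓘(ℝ, E) ∞ M]
  {a₁ b₁ a₂ b₂ c₁ d₁ c₂ d₂ lam mu : ℝ → ℝ}

/-- P exchanges horizontal and vertical parts and G is block diagonal, so only the pairings of a
horizontal with a vertical part survive. Their coefficients are computed from the relations and the
factors (`k1` to `k4`). -/
theorem associatedForm_eq (g : Metric E M)
    (hrel : ∀ t, 0 ≤ t → ParaHermitianRelations a₁ b₁ a₂ b₂ c₁ d₁ c₂ d₂ t)
    (hf : AreProportionalityFactors a₁ b₁ a₂ b₂ c₁ d₁ c₂ d₂ lam mu)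
    (p : CotangentBundle E M) (v w : E × (E →L[ℝ] ℝ)) :
    associatedForm (cotangentModel E) (naturalMetric g c₁ d₁ c₂ d₂) (naturalTensor g a₁ b₁ a₂ b₂)
      p v w = lam (energy g p) * (w.2 v.1 - v.2 w.1) + mu (energy g p) *
      (covector p v.1 * vertForm (flat g p.proj) (christoffelAt g p.proj) (covector p) w
        - vertForm (flat g p.proj) (christoffelAt g p.proj) (covector p) v * covector p w.1) := by
  have hh := flat_isInner g p.proj
  have hΓ : ∀ u v, christoffelAt g p.proj u v = christoffelAt g p.proj v u :=
    (christoffel_isLeviCivitaAt g (mem_extChartAt_target (I := 𝓘(ℝ, E)) p.proj)).symm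
  have ht : 0 ≤ energy g p := hh.halfSq_nonneg _
  have hξs : covector p ((flat g p.proj).inverse (covector p)) = 2 * energy g p := by
    rw [energy_eq_halfSq, halfSq]; ring
  have hJw : (naturalTensor g a₁ b₁ a₂ b₂ p w : E × (E →L[ℝ] ℝ)) = _ :=
    naturalTensor_apply g a₁ b₁ a₂ b₂ p w
  have hL : associatedForm (cotangentModel E) (naturalMetric g c₁ d₁ c₂ d₂)
      (naturalTensor g a₁ b₁ a₂ b₂) p v w = naturalMetric g c₁ d₁ c₂ d₂ p v
      (liftTensor (connForm (christoffelAt g p.proj) (covector p))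
      (naturalFlat (flat g p.proj) (covector p) (a₁ (energy g p)) (b₁ (energy g p)))
      (naturalSharp (flat g p.proj) (covector p) (a₂ (energy g p)) (b₂ (energy g p))) w) :=
    congrArg (fun y : E × (E →L[ℝ] ℝ) ↦ naturalMetric g c₁ d₁ c₂ d₂ p v y) hJw
  rw [hL, naturalMetric_apply]
  obtain ⟨u, β⟩ := v
  obtain ⟨u', β'⟩ := w
  obtain ⟨r1, r2, r3, r4⟩ := hrel _ ht
  obtain ⟨n1, n2, n3, n4⟩ := hf.ne_zero _ ht
  obtain ⟨f1, f2⟩ := hf.first _ ht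
  obtain ⟨f3, f4⟩ := hf.second _ ht
  -- The canonical form does not change when momenta are replaced by vertical parts, because the
  -- connection is torsion-free.
  have hcan : β' u - β u' = (β' - connForm (christoffelAt g p.proj) (covector p) u') u
      - (β - connForm (christoffelAt g p.proj) (covector p) u) u' := by
    simp only [sub_apply, connForm_apply, hΓ u u']
    ring
  simp only [liftTensor_apply, add_sub_cancel_right, vertForm_apply]
  rw [hcan]
  set κ := β - connForm (christoffelAt g p.proj) (covector p) u with hκ
  set κ' := β' - connForm (christoffelAt g p.proj) (covector p) u' with hκ'
  set t := energy g p
  set ξ := covector p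
  set h := flat g p.proj
  have hinv : ∀ w, h.inverse (h w) = w := hh.inverse_apply
  have hflat : h.inverse (naturalFlat h ξ (a₁ t) (b₁ t) u') =
      a₁ t • u' + (b₁ t * ξ u') • h.inverse ξ := by
    rw [← hinv (a₁ t • u')]
    rw [← map_smul h.inverse, ← map_add]
    congr 1
    ext y
    simp [naturalFlat_apply, mul_assoc]
  have hsw : ξ (h.inverse κ') = κ' (h.inverse ξ) := hh.apply_inverse_symm _ _
  have hsw' : ξ (h.inverse κ) = κ (h.inverse ξ) := hh.apply_inverse_symm _ _
  have hap : ∀ y, h u (h.inverse y) = y u := fun y ↦ by rw [hh.symm, hh.apply_inverse]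
  rw [hflat, naturalSharp_apply]
  simp only [map_add, map_smul, smul_eq_mul, hξs, hsw, hsw', hap]
  -- At ξ = 0 all rank-one terms vanish, so the value of μ there is irrelevant; elsewhere t > 0 and
  -- `k1`, `k2` may be divided by 2t.
  rcases eq_or_ne ξ 0 with h0 | h0
  · have ht0 : t = 0 := by
      have : (2 : ℝ) * t = 0 := by rw [← hξs, h0]; simp
      linarith
    simp only [h0, zero_apply, map_zero, mul_zero, zero_mul, add_zero, sub_zero]
    rw [div_eq_iff n1] at f1
    rw [← neg_div, div_eq_iff n2] at f2
    have f2' : c₂ t = -(lam t * a₂ t) := by linarith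
    rw [f1, f2']
    linear_combination lam t * (κ' u - κ u') * r1
  · have htpos : 0 < t := hh.halfSq_pos h0
    rw [div_eq_iff n1] at f1
    rw [← neg_div, div_eq_iff n2] at f2
    rw [div_eq_iff n3] at f3
    rw [← neg_div, div_eq_iff n4] at f4
    have k1 : c₁ t * b₂ t + d₁ t * (a₂ t + 2 * t * b₂ t) = mu t := by
      have : (2 * t) * (c₁ t * b₂ t + d₁ t * (a₂ t + 2 * t * b₂ t) - mu t) = 0 := by
        linear_combination (a₂ t + 2 * t * b₂ t) * f3 - a₂ t * f1 + (lam t + 2 * t * mu t) * r2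
          - lam t * r1
      have := (mul_eq_zero.1 this).resolve_left (by positivity)
      linarith
    have k2 : c₂ t * b₁ t + d₂ t * (a₁ t + 2 * t * b₁ t) = -mu t := by
      have : (2 * t) * (c₂ t * b₁ t + d₂ t * (a₁ t + 2 * t * b₁ t) + mu t) = 0 := by
        linear_combination -(a₁ t + 2 * t * b₁ t) * f4 + a₁ t * f2 - (lam t + 2 * t * mu t) * r2
          + lam t * r1
      have := (mul_eq_zero.1 this).resolve_left (by positivity)
      linarith
    have k3 : c₁ t * a₂ t = lam t := by linear_combination a₂ t * f1 + lam t * r1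
    have k4 : c₂ t * a₁ t = -lam t := by linear_combination -a₁ t * f2 - lam t * r1
    linear_combination κ' u * k3 + κ u' * k4 + ξ u * κ' (h.inverse ξ) * k1
      + κ (h.inverse ξ) * ξ u' * k2

theorem associatedForm_coordFrame (g : Metric E M)
    (hrel : ∀ t, 0 ≤ t → ParaHermitianRelations a₁ b₁ a₂ b₂ c₁ d₁ c₂ d₂ t)
    (hf : AreProportionalityFactors a₁ b₁ a₂ b₂ c₁ d₁ c₂ d₂ lam mu)
    (p : CotangentBundle E M) {z : E × (E →L[ℝ] ℝ)}
    (hz : z.1 ∈ (extChartAt 𝓘(ℝ, E) p.proj).target) (v w : E × (E →L[ℝ] ℝ)) :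
    associatedForm (cotangentModel E) (naturalMetric g c₁ d₁ c₂ d₂) (naturalTensor g a₁ b₁ a₂ b₂)
      ((extChartAt (cotangentModel E) p).symm z) (coordFrame (cotangentModel E) p z v)
      (coordFrame (cotangentModel E) p z w) =
      localForm (chartMetric g p.proj) (christoffel g p.proj) lam mu z v w := by
  have hen := energy_coord g p hz
  obtain ⟨q, B, C, hq, hBC, hCB, hcov, hflat, hframe⟩ := cotangentFrame_lift g hz
  have hCB' : ∀ v, C (B v) = v := fun v ↦ congrArg (fun L : E →L[ℝ] E ↦ L v) hCB
  have hinv : ∀ β : E →L[ℝ] ℝ, (flat g q.proj).inverse (β ∘L C) =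
      B ((chartMetric g p.proj z.1).inverse β) :=
    inverse_transport (flat_isInner g _) (chartMetric_isInner g hz) hflat hCB
  have hΓ : ∀ u v, christoffelAt g q.proj u v = christoffelAt g q.proj v u :=
    (christoffel_isLeviCivitaAt g (mem_extChartAt_target (I := 𝓘(ℝ, E)) q.proj)).symm
  have hΓ' := (christoffel_isLeviCivitaAt g hz).symm
  rw [hq] at hen ⊢
  have key := associatedForm_eq g hrel hf q (coordFrame (cotangentModel E) p z v)
    (coordFrame (cotangentModel E) p z w)
  refine key.trans ?_
  have hv : (coordFrame (cotangentModel E) p z v : E × (E →L[ℝ] ℝ)) = _ := hframe v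
  have hw : (coordFrame (cotangentModel E) p z w : E × (E →L[ℝ] ℝ)) = _ := hframe w
  generalize (coordFrame (cotangentModel E) p z v : E × (E →L[ℝ] ℝ)) = v' at hv
  generalize (coordFrame (cotangentModel E) p z w : E × (E →L[ℝ] ℝ)) = w' at hw
  subst hv hw
  rw [localForm_apply, hen]
  simp only [vertForm_apply, add_sub_cancel_right, hcov, hinv, add_apply,
    ContinuousLinearMap.comp_apply, hCB', sub_apply, connForm_apply]
  rw [hΓ (B w.1), hΓ' w.1]
  ring

end Form

/-! ### Exterior derivative of Lσ + M θ ∧ τ -/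

section Wedge

variable {F : Type*} [NormedAddCommGroup F] [NormedSpace ℝ F]

theorem hasFDerivAt_wedge {θ τ : F → F →L[ℝ] ℝ} {θ' τ' : F →L[ℝ] F →L[ℝ] ℝ} {z : F}
    (hθ : HasFDerivAt θ θ' z) (hτ : HasFDerivAt τ τ' z) :
    ∃ L : F →L[ℝ] F →L[ℝ] F →L[ℝ] ℝ, HasFDerivAt (fun z ↦ wedge (θ z) (τ z)) L z ∧
      ∀ u v w, L u v w = θ' u v * τ z w + θ z v * τ' u w - (τ' u v * θ z w + τ z v * θ' u w) := by
  have h3 : HasFDerivAt (fun z ↦ smulRightL ℝ F (F →L[ℝ] ℝ) (θ z) (τ z)) _ z :=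
    (HasFDerivAt.comp z (smulRightL ℝ F (F →L[ℝ] ℝ)).hasFDerivAt hθ).clm_apply hτ
  have h4 : HasFDerivAt (fun z ↦ smulRightL ℝ F (F →L[ℝ] ℝ) (τ z) (θ z)) _ z :=
    (HasFDerivAt.comp z (smulRightL ℝ F (F →L[ℝ] ℝ)).hasFDerivAt hτ).clm_apply hθ
  refine ⟨_, h3.sub h4, fun u v w ↦ ?_⟩
  simp
  ring

set_option synthInstance.maxHeartbeats 200000 in
-- With dL = lτ, dM = mτ, dτ = 0, dσ = 0 and dθ = -σ, the derivative is lτ ∧ σ + M dθ ∧ τ, since the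
-- term in `m` contains τ twice; this is (l - M) τ ∧ σ.
theorem flatExtDeriv_smul_add_smul_wedge {L M : F → ℝ} {σ : F →L[ℝ] F →L[ℝ] ℝ}
    {θ τ : F → F →L[ℝ] ℝ} {θ' τ' : F →L[ℝ] F →L[ℝ] ℝ} {l m : ℝ} {z : F}
    (hL : HasFDerivAt L (l • τ z) z) (hM : HasFDerivAt M (m • τ z) z)
    (hθ : HasFDerivAt θ θ' z) (hτ : HasFDerivAt τ τ' z) (hτs : ∀ u v, τ' u v = τ' v u)
    (hσ : ∀ u v, θ' u v - θ' v u = -σ u v) :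
    DifferentiableAt ℝ (fun z ↦ L z • σ + M z • wedge (θ z) (τ z)) z ∧ ∀ u v w,
      flatExtDeriv (fun z ↦ L z • σ + M z • wedge (θ z) (τ z)) z u v w =
        (l - M z) * (τ z u * σ v w - τ z v * σ u w + τ z w * σ u v) := by
  obtain ⟨W, hW, hWa⟩ := hasFDerivAt_wedge hθ hτ
  have hD : HasFDerivAt (fun z ↦ L z • σ + M z • wedge (θ z) (τ z)) _ z :=
    (hL.smul (hasFDerivAt_const σ z)).add (hM.smul hW)
  refine ⟨hD.differentiableAt, fun u v w ↦ ?_⟩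
  rw [flatExtDeriv, hD.fderiv]
  simp only [add_apply, smul_apply, ContinuousLinearMap.smulRight_apply, smul_zero,
    zero_add, hWa, wedge_apply, smul_eq_mul]
  have h1 : σ u v = θ' v u - θ' u v := by linarith [hσ u v]
  have h2 : σ u w = θ' w u - θ' u w := by linarith [hσ u w]
  have h3 : σ v w = θ' w v - θ' v w := by linarith [hσ v w]
  rw [hτs v u, hτs w u, hτs w v, h1, h2, h3]
  ring

end Wedge

/-! ### Derivatives of the energy, the coefficients and the local 2-form -/

section LocalCalculus

variable {E : Type*} [NormedAddCommGroup E] [NormedSpace ℝ E]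

/-- A metric with its Christoffel symbols near a point of a vector space. -/
structure IsLocalMetric (h : E → E →L[ℝ] E →L[ℝ] ℝ) (Γ : E → E →L[ℝ] E →L[ℝ] E) (y : E) :
    Prop where
  inner : ∀ᶠ x in 𝓝 y, IsInner (h x)
  leviCivita : ∀ᶠ x in 𝓝 y, IsLeviCivitaAt h (Γ x) x
  contDiffAt : ContDiffAt ℝ 2 h y
  differentiableAt : DifferentiableAt ℝ Γ y

theorem hasFDerivAt_connForm {Γ : E → E →L[ℝ] E →L[ℝ] E} {z : E × (E →L[ℝ] ℝ)}
    (hΓ : DifferentiableAt ℝ Γ z.1) (u : E) :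
    ∃ L : E × (E →L[ℝ] ℝ) →L[ℝ] E →L[ℝ] ℝ,
      HasFDerivAt (fun z : E × (E →L[ℝ] ℝ) ↦ connForm (Γ z.1) z.2 u) L z ∧
      ∀ v w, L v w = v.2 (Γ z.1 u w) + z.2 (fderiv ℝ Γ z.1 v.1 u w) := by
  have h1 : HasFDerivAt (fun z : E × (E →L[ℝ] ℝ) ↦ Γ z.1) _ z :=
    HasFDerivAt.comp z hΓ.hasFDerivAt hasFDerivAt_fst
  refine ⟨_, hasFDerivAt_snd.clm_comp (h1.clm_apply (hasFDerivAt_const u z)), fun v w ↦ ?_⟩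
  simp [add_comm]

theorem differentiableAt_connForm {Γ : E → E →L[ℝ] E →L[ℝ] E} {z : E × (E →L[ℝ] ℝ)}
    (hΓ : DifferentiableAt ℝ Γ z.1) :
    DifferentiableAt ℝ (fun z : E × (E →L[ℝ] ℝ) ↦ connForm (Γ z.1) z.2) z := by
  have h1 : DifferentiableAt ℝ (fun z : E × (E →L[ℝ] ℝ) ↦ Γ z.1) z :=
    hΓ.comp z differentiableAt_fst
  exact ((compL ℝ E E ℝ).differentiableAt.comp z differentiableAt_snd).clm_comp h1

variable [FiniteDimensional ℝ E] {h : E → E →L[ℝ] E →L[ℝ] ℝ} {Γ : E → E →L[ℝ] E →L[ℝ] E}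
  {z : E × (E →L[ℝ] ℝ)}

theorem contDiffAt_inverse {n : ℕ∞ω} {y : E} (hin : IsInner (h y)) (hh : ContDiffAt ℝ n h y) :
    ContDiffAt ℝ n (fun x ↦ (h x).inverse) y := by
  have : CompleteSpace E := FiniteDimensional.complete ℝ E
  exact hin.isInvertible.contDiffAt_map_inverse.comp y hh

theorem contDiffAt_sharp {n : ℕ∞ω} (hin : IsInner (h z.1)) (hh : ContDiffAt ℝ n h z.1) :
    ContDiffAt ℝ n (fun z : E × (E →L[ℝ] ℝ) ↦ (h z.1).inverse z.2) z :=
  ((contDiffAt_inverse hin hh).comp z contDiffAt_fst).clm_apply contDiffAt_snd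

theorem contDiffAt_localEnergy {n : ℕ∞ω} (hin : IsInner (h z.1)) (hh : ContDiffAt ℝ n h z.1) :
    ContDiffAt ℝ n (localEnergy h) z :=
  contDiffAt_const.mul (contDiffAt_snd.clm_apply (contDiffAt_sharp hin hh))

/-- The energy is constant along horizontal vectors because the connection is metric. The derivative
of s = ξ♯ is not computed through the inverse: differentiating h(s) = ξ and pairing with s gives
what is needed. -/
theorem hasFDerivAt_localEnergy (hin : IsInner (h z.1)) (hh : ContDiffAt ℝ 1 h z.1)
    (hΓ : IsLeviCivitaAt h (Γ z.1) z.1) (hsymm : ∀ᶠ x in 𝓝 z.1, IsInner (h x)) :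
    HasFDerivAt (localEnergy h) (vertForm (h z.1) (Γ z.1) z.2) z := by
  have hs := ((contDiffAt_sharp hin hh).differentiableAt one_ne_zero).hasFDerivAt
  have hd := ((hh.differentiableAt one_ne_zero)).hasFDerivAt
  set s := fun z : E × (E →L[ℝ] ℝ) ↦ (h z.1).inverse z.2 with hsdef
  have hh1 : HasFDerivAt (fun z : E × (E →L[ℝ] ℝ) ↦ h z.1) _ z :=
    HasFDerivAt.comp z hd hasFDerivAt_fst
  have e1 : (fun z : E × (E →L[ℝ] ℝ) ↦ h z.1 (s z)) =ᶠ[𝓝 z] fun z ↦ z.2 := by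
    filter_upwards [(continuous_fst.tendsto z).eventually hsymm] with z' hz'
    exact hz'.apply_inverse z'.2
  have e2 := (hh1.clm_apply hs).unique (hasFDerivAt_snd.congr_of_eventuallyEq e1)
  have e3 := (hasFDerivAt_snd (p := z) (𝕜 := ℝ)).clm_apply hs
  have e4 := e3.const_mul (1 / 2 : ℝ)
  refine e4.congr_fderiv ?_
  refine ContinuousLinearMap.ext fun v ↦ ?_
  have e5 := congrArg (fun L : E × (E →L[ℝ] ℝ) →L[ℝ] E →L[ℝ] ℝ ↦ L v (s z)) e2
  have hz2 : h z.1 (s z) = z.2 := hin.apply_inverse z.2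
  have h1 : h z.1 (fderiv ℝ s z v) (s z) = z.2 (fderiv ℝ s z v) := by rw [hin.symm, hz2]
  have h2 : fderiv ℝ h z.1 v.1 (s z) (s z) = 2 * z.2 (Γ z.1 v.1 (s z)) := by
    rw [hΓ.metric, hin.symm (Γ z.1 v.1 (s z)), hz2]; ring
  simp only [add_apply, ContinuousLinearMap.comp_apply, ContinuousLinearMap.flip_apply,
    ContinuousLinearMap.coe_fst', ContinuousLinearMap.coe_snd', h1, h2] at e5
  simp only [smul_apply, add_apply, ContinuousLinearMap.comp_apply,
    ContinuousLinearMap.flip_apply, ContinuousLinearMap.coe_snd', smul_eq_mul, vertForm_apply,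
    sub_apply, connForm_apply]
  change _ = v.2 (s z) - z.2 (Γ z.1 v.1 (s z))
  linarith

namespace IsLocalMetric

variable (H : IsLocalMetric h Γ z.1)
include H

theorem eventually_hasFDerivAt : ∀ᶠ z' in 𝓝 z,
    HasFDerivAt (localEnergy h) (vertForm (h z'.1) (Γ z'.1) z'.2) z' := by
  have h1 := (continuous_fst.tendsto z).eventually
    ((H.inner.and H.leviCivita).and (H.inner.eventually_nhds.and
      (H.contDiffAt.eventually (by simp))))
  filter_upwards [h1] with z' hz'
  exact hasFDerivAt_localEnergy hz'.1.1 (hz'.2.2.of_le (by norm_num)) hz'.1.2 hz'.2.1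

theorem hasFDerivAt_localEnergy :
    HasFDerivAt (localEnergy h) (vertForm (h z.1) (Γ z.1) z.2) z :=
  H.eventually_hasFDerivAt.self_of_nhds

theorem eventually_nonneg : ∀ᶠ z' in 𝓝 z, localEnergy h z' ∈ Set.Ici (0 : ℝ) := by
  filter_upwards [(continuous_fst.tendsto z).eventually H.inner] with z' hz'
  exact hz'.halfSq_nonneg z'.2

/-- A coefficient is only differentiable within [0, ∞), possibly one-sidedly at 0. The chain rule
still yields a full derivative because the energy stays nonnegative near `z`. -/
theorem hasFDerivAt_coeff {a : ℝ → ℝ} (ha : SmoothCoeff a) :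
    HasFDerivAt (fun z ↦ a (localEnergy h z))
      (coeffDeriv a (localEnergy h z) • vertForm (h z.1) (Γ z.1) z.2) z := by
  have h1 : HasDerivWithinAt a (coeffDeriv a (localEnergy h z)) (Set.Ici 0) (localEnergy h z) :=
    ((ha.differentiableOn (by simp)) _ H.eventually_nonneg.self_of_nhds).hasDerivWithinAt
  exact h1.comp_hasFDerivAt z H.hasFDerivAt_localEnergy H.eventually_nonneg

/-- Being dt near `z`, the form `vertForm` is differentiable and closed because t is of class C². -/
theorem vertForm_eventuallyEq :
    (fun z : E × (E →L[ℝ] ℝ) ↦ vertForm (h z.1) (Γ z.1) z.2) =ᶠ[𝓝 z]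
      fderiv ℝ (localEnergy h) :=
  H.eventually_hasFDerivAt.mono fun _ hz ↦ hz.fderiv.symm

theorem differentiableAt_vertForm :
    DifferentiableAt ℝ (fun z : E × (E →L[ℝ] ℝ) ↦ vertForm (h z.1) (Γ z.1) z.2) z := by
  refine DifferentiableAt.congr_of_eventuallyEq ?_ H.vertForm_eventuallyEq
  exact ((contDiffAt_localEnergy H.inner.self_of_nhds H.contDiffAt).fderiv_right
    (m := 1) (by norm_num)).differentiableAt one_ne_zero

theorem fderiv_vertForm_symm (v w : E × (E →L[ℝ] ℝ)) :
    fderiv ℝ (fun z : E × (E →L[ℝ] ℝ) ↦ vertForm (h z.1) (Γ z.1) z.2) z v w =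
      fderiv ℝ (fun z : E × (E →L[ℝ] ℝ) ↦ vertForm (h z.1) (Γ z.1) z.2) z w v := by
  rw [H.vertForm_eventuallyEq.fderiv_eq]
  exact ((contDiffAt_localEnergy H.inner.self_of_nhds H.contDiffAt).isSymmSndFDerivAt
    (by simp)).eq v w

theorem flatExtDeriv_localForm {lam mu : ℝ → ℝ} (hlam : SmoothCoeff lam)
    (hmu : SmoothCoeff mu) :
    DifferentiableAt ℝ (localForm h Γ lam mu) z ∧ ∀ u v w,
      flatExtDeriv (localForm h Γ lam mu) z u v w =
        (coeffDeriv lam (localEnergy h z) - mu (localEnergy h z)) *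
        (vertForm (h z.1) (Γ z.1) z.2 u * canonicalForm E v w
        - vertForm (h z.1) (Γ z.1) z.2 v * canonicalForm E u w
        + vertForm (h z.1) (Γ z.1) z.2 w * canonicalForm E u v) := by
  have h2 : HasFDerivAt (fun z : E × (E →L[ℝ] ℝ) ↦ liouvilleForm z.2) _ z :=
    hasFDerivAt_snd.clm_comp (hasFDerivAt_const (fst ℝ E (E →L[ℝ] ℝ)) z)
  refine flatExtDeriv_smul_add_smul_wedge
    (τ := fun z : E × (E →L[ℝ] ℝ) ↦ vertForm (h z.1) (Γ z.1) z.2)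
    (H.hasFDerivAt_coeff hlam) (H.hasFDerivAt_coeff hmu) h2
    H.differentiableAt_vertForm.hasFDerivAt H.fderiv_vertForm_symm fun u v ↦ ?_
  simp [canonicalForm_apply]

end IsLocalMetric

omit [FiniteDimensional ℝ E] in
theorem localForm_antisymm (lam mu : ℝ → ℝ) (v w : E × (E →L[ℝ] ℝ)) :
    localForm h Γ lam mu z v w = -localForm h Γ lam mu z w v := by
  rw [localForm_apply, localForm_apply]
  ring

end LocalCalculus

/-! ### Algebra of the Nijenhuis tensor and differentiability of lifts -/

section Generic

variable {F : Type*} [NormedAddCommGroup F] [NormedSpace ℝ F]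

theorem flatNijenhuis_add_left (J : F → F →L[ℝ] F) (z v v' w : F) :
    flatNijenhuis J z (v + v') w = flatNijenhuis J z v w + flatNijenhuis J z v' w := by
  simp only [flatNijenhuis, map_add, add_apply]
  abel

theorem flatNijenhuis_antisymm (J : F → F →L[ℝ] F) (z v w : F) :
    flatNijenhuis J z v w = -flatNijenhuis J z w v := by
  simp only [flatNijenhuis]
  abel

/-- Differentiating J² = 1 shows that every derivative of `J` anticommutes with `J`. -/
theorem flatNijenhuis_apply_left {J : F → F →L[ℝ] F} {z : F} (hJ : DifferentiableAt ℝ J z)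
    (hJJ : ∀ᶠ y in 𝓝 z, ∀ v, J y (J y v) = v) (v w : F) :
    flatNijenhuis J z (J z v) w = -J z (flatNijenhuis J z v w) := by
  have h1 : ∀ v w, fderiv ℝ J z v (J z w) = -J z (fderiv ℝ J z v w) := by
    intro v w
    have e1 : HasFDerivAt (fun y ↦ J y (J y w)) _ z :=
      hJ.hasFDerivAt.clm_apply (hJ.hasFDerivAt.clm_apply (hasFDerivAt_const w z))
    have e2 : (fun y ↦ J y (J y w)) =ᶠ[𝓝 z] fun _ ↦ w := hJJ.mono fun y hy ↦ hy w
    have e3 := e1.unique ((hasFDerivAt_const w z).congr_of_eventuallyEq e2)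
    have e4 := congrArg (fun L : F →L[ℝ] F ↦ L v) e3
    simp only [add_apply, ContinuousLinearMap.comp_apply, ContinuousLinearMap.flip_apply,
      zero_apply, map_zero, zero_add] at e4
    exact eq_neg_of_add_eq_zero_right e4
  have h2 := hJJ.self_of_nhds
  simp only [flatNijenhuis, h1, h2, map_add, map_sub, map_neg]
  abel

/-- By additivity and N(Jv, w) = -J N(v, w), vanishing on `S` in one slot propagates to S + JS,
which is everything; antisymmetry handles the other slot. -/
theorem flatNijenhuis_eq_zero_iff {J : F → F →L[ℝ] F} {z : F} (hJ : DifferentiableAt ℝ J z)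
    (hJJ : ∀ᶠ y in 𝓝 z, ∀ v, J y (J y v) = v) {S : Set F}
    (hS : ∀ v, ∃ a ∈ S, ∃ b ∈ S, v = a + J z b) :
    (∀ v w, flatNijenhuis J z v w = 0) ↔ ∀ v ∈ S, ∀ w ∈ S, flatNijenhuis J z v w = 0 := by
  refine ⟨fun h v _ w _ ↦ h v w, fun h v w ↦ ?_⟩
  have key : ∀ w, (∀ a ∈ S, flatNijenhuis J z a w = 0) → ∀ v, flatNijenhuis J z v w = 0 := by
    intro w hw v
    obtain ⟨a, ha, b, hb, rfl⟩ := hS v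
    rw [flatNijenhuis_add_left, flatNijenhuis_apply_left hJ hJJ, hw a ha, hw b hb, map_zero,
      neg_zero, add_zero]
  refine key w (fun a ha ↦ ?_) v
  rw [flatNijenhuis_antisymm, key a (fun b hb ↦ h b hb a ha), neg_zero]

variable {E : Type*} [NormedAddCommGroup E] [NormedSpace ℝ E]

theorem differentiableAt_liftTensor {K A₁ : F → E →L[ℝ] E →L[ℝ] ℝ}
    {A₂ : F → (E →L[ℝ] ℝ) →L[ℝ] E} {z : F} (hK : DifferentiableAt ℝ K z)
    (h₁ : DifferentiableAt ℝ A₁ z) (h₂ : DifferentiableAt ℝ A₂ z) :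
    DifferentiableAt ℝ (fun z ↦ liftTensor (K z) (A₁ z) (A₂ z)) z := by
  have e : (fun z ↦ liftTensor (K z) (A₁ z) (A₂ z)) = fun z ↦
      inr ℝ E (E →L[ℝ] ℝ) ∘L A₁ z ∘L fst ℝ E (E →L[ℝ] ℝ)
      + (inl ℝ E (E →L[ℝ] ℝ) + inr ℝ E (E →L[ℝ] ℝ) ∘L K z) ∘L A₂ z ∘L
        (snd ℝ E (E →L[ℝ] ℝ) - K z ∘L fst ℝ E (E →L[ℝ] ℝ)) := by
    funext z
    ext v <;> simp [liftTensor]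
  rw [e]
  have c1 : DifferentiableAt ℝ (fun z ↦ K z ∘L fst ℝ E (E →L[ℝ] ℝ)) z :=
    hK.clm_comp (differentiableAt_const _)
  have c2 : DifferentiableAt ℝ (fun z ↦ inr ℝ E (E →L[ℝ] ℝ) ∘L K z) z :=
    (differentiableAt_const _).clm_comp hK
  have c3 : DifferentiableAt ℝ
      (fun z ↦ inr ℝ E (E →L[ℝ] ℝ) ∘L A₁ z ∘L fst ℝ E (E →L[ℝ] ℝ)) z :=
    (differentiableAt_const _).clm_comp (h₁.clm_comp (differentiableAt_const _))
  exact c3.add ((c2.const_add _).clm_comp (h₂.clm_comp (c1.const_sub _)))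

theorem hasFDerivAt_naturalFlat {h : F → E →L[ℝ] E →L[ℝ] ℝ} {ξ : F → E →L[ℝ] ℝ} {a b : F → ℝ}
    {h' : F →L[ℝ] E →L[ℝ] E →L[ℝ] ℝ} {ξ' : F →L[ℝ] E →L[ℝ] ℝ} {a' b' : F →L[ℝ] ℝ} {z : F}
    (hh : HasFDerivAt h h' z) (hξ : HasFDerivAt ξ ξ' z) (ha : HasFDerivAt a a' z)
    (hb : HasFDerivAt b b' z) (u : E) :
    ∃ L : F →L[ℝ] E →L[ℝ] ℝ,
      HasFDerivAt (fun z ↦ naturalFlat (h z) (ξ z) (a z) (b z) u) L z ∧ ∀ v w, L v w =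
        a' v * h z u w + a z * h' v u w + b' v * (ξ z u * ξ z w)
          + b z * (ξ' v u * ξ z w + ξ z u * ξ' v w) := by
  have e : (fun z ↦ naturalFlat (h z) (ξ z) (a z) (b z) u) =
      fun z ↦ a z • h z u + b z • ξ z u • ξ z := by
    funext z
    ext v
    simp [naturalFlat]
  rw [e]
  have h1 := hh.clm_apply (hasFDerivAt_const u z)
  have h2 := hξ.clm_apply (hasFDerivAt_const u z)
  refine ⟨_, (ha.smul h1).add (hb.smul (h2.smul hξ)), fun v w ↦ ?_⟩
  simp
  ring

theorem differentiableAt_naturalFlat {h : F → E →L[ℝ] E →L[ℝ] ℝ} {ξ : F → E →L[ℝ] ℝ}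
    {a b : F → ℝ} {z : F}
    (hh : DifferentiableAt ℝ h z) (hξ : DifferentiableAt ℝ ξ z) (ha : DifferentiableAt ℝ a z)
    (hb : DifferentiableAt ℝ b z) :
    DifferentiableAt ℝ (fun z ↦ naturalFlat (h z) (ξ z) (a z) (b z)) z := by
  have h1 : DifferentiableAt ℝ (fun z ↦ smulRightL ℝ E (E →L[ℝ] ℝ) (ξ z) (ξ z)) z :=
    ((smulRightL ℝ E (E →L[ℝ] ℝ)).differentiableAt.comp z hξ).clm_apply hξ
  exact (ha.smul hh).add (hb.smul h1)

theorem differentiableAt_naturalSharp {h : F → E →L[ℝ] E →L[ℝ] ℝ} {ξ : F → E →L[ℝ] ℝ}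
    {a b : F → ℝ} {z : F} (hh : DifferentiableAt ℝ (fun z ↦ (h z).inverse) z)
    (hξ : DifferentiableAt ℝ ξ z) (ha : DifferentiableAt ℝ a z) (hb : DifferentiableAt ℝ b z) :
    DifferentiableAt ℝ (fun z ↦ naturalSharp (h z) (ξ z) (a z) (b z)) z := by
  have h1 : DifferentiableAt ℝ
      (fun z ↦ smulRightL ℝ (E →L[ℝ] ℝ) E (ξ z ∘L (h z).inverse) ((h z).inverse (ξ z))) z :=
    ((smulRightL ℝ (E →L[ℝ] ℝ) E).differentiableAt.comp z (hξ.clm_comp hh)).clm_apply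
      (hh.clm_apply hξ)
  exact (ha.smul hh).add (hb.smul h1)

/-- If the Lie brackets of `V`, `W`, `JV`, `JW` are vertical with the given components, then so is
the value of the Nijenhuis tensor. -/
theorem flatNijenhuis_of_hasFDerivAt {J : E × F → E × F →L[ℝ] E × F} {α β κ η : E × F → F}
    {α' β' κ' η' : E × F →L[ℝ] F} {z : E × F} {u v : E} (hJ : DifferentiableAt ℝ J z)
    (hκ : HasFDerivAt κ κ' z) (hη : HasFDerivAt η η' z)
    (hα : HasFDerivAt α α' z) (hβ : HasFDerivAt β β' z)
    (hu : ∀ z, J z (u, κ z) = (0, α z)) (hv : ∀ z, J z (v, η z) = (0, β z)) 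
    (hJJ : ∀ v, J z (J z v) = v)
    (hmix : η' (0, α z) - α' (v, η z) + (β' (u, κ z) - κ' (0, β z)) = 0) :
    flatNijenhuis J z (u, κ z) (v, η z) =
      (0, β' (0, α z) - α' (0, β z) + (η' (u, κ z) - κ' (v, η z))) := by
  have d1 : HasFDerivAt (fun z ↦ (u, κ z)) _ z := (hasFDerivAt_const u z).prodMk hκ
  have d2 : HasFDerivAt (fun z ↦ (v, η z)) _ z := (hasFDerivAt_const v z).prodMk hη
  have d3 : HasFDerivAt (fun z ↦ ((0 : E), α z)) _ z := (hasFDerivAt_const 0 z).prodMk hα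
  have d4 : HasFDerivAt (fun z ↦ ((0 : E), β z)) _ z := (hasFDerivAt_const 0 z).prodMk hβ
  have h1 := lieBracket_nijenhuis hJ d1.differentiableAt d2.differentiableAt
  simp only [hu, hv] at h1
  rw [← h1, hJJ]
  simp only [lieBracket, d1.fderiv, d2.fderiv, d3.fderiv, d4.fderiv]
  have h2 : ∀ a b : E × F, J z a + J z b = J z (a + b) := fun a b ↦ (map_add _ _ _).symm
  -- The two mixed brackets are gathered under a single `J`, where their sum vanishes by `hmix`.
  have h3 : ∀ a b c d : E × F, a - J z b - J z c + d = a + d - J z (b + c) := by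
    intro a b c d
    rw [map_add]
    abel
  rw [h3]
  simp only [ContinuousLinearMap.prod_apply, zero_apply, Prod.mk_sub_mk, Prod.mk_add_mk, sub_self,
    add_zero, hmix]
  rw [Prod.mk_zero_zero, map_zero, sub_zero]

end Generic

/-! ### The Nijenhuis tensor on horizontal lifts -/

section LocalNijenhuis

variable {E : Type*} [NormedAddCommGroup E] [NormedSpace ℝ E]

/-- The curvature `R(u, v)w` of a connection in coordinates. -/
def localCurvature (Γ : E → E →L[ℝ] E →L[ℝ] E) (y u v w : E) : E :=
  fderiv ℝ Γ y u v w - fderiv ℝ Γ y v u w + Γ y u (Γ y v w) - Γ y v (Γ y u w)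

variable [FiniteDimensional ℝ E] {h : E → E →L[ℝ] E →L[ℝ] ℝ} {Γ : E → E →L[ℝ] E →L[ℝ] E}
  {z : E × (E →L[ℝ] ℝ)} {a₁ b₁ a₂ b₂ : ℝ → ℝ}

namespace IsLocalMetric

variable (H : IsLocalMetric h Γ z.1)
include H

theorem differentiableAt_localTensor (ha₁ : SmoothCoeff a₁) (hb₁ : SmoothCoeff b₁)
    (ha₂ : SmoothCoeff a₂) (hb₂ : SmoothCoeff b₂) :
    DifferentiableAt ℝ (localTensor h Γ a₁ b₁ a₂ b₂) z := by
  have d1 : DifferentiableAt ℝ (fun z : E × (E →L[ℝ] ℝ) ↦ h z.1) z :=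
    (H.contDiffAt.differentiableAt two_ne_zero).comp z differentiableAt_fst
  have d2 : DifferentiableAt ℝ (fun z : E × (E →L[ℝ] ℝ) ↦ (h z.1).inverse) z :=
    ((contDiffAt_inverse H.inner.self_of_nhds H.contDiffAt).differentiableAt two_ne_zero).comp z
      differentiableAt_fst
  exact differentiableAt_liftTensor (differentiableAt_connForm H.differentiableAt)
    (differentiableAt_naturalFlat d1 differentiableAt_snd
      (H.hasFDerivAt_coeff ha₁).differentiableAt (H.hasFDerivAt_coeff hb₁).differentiableAt)
    (differentiableAt_naturalSharp d2 differentiableAt_snd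
      (H.hasFDerivAt_coeff ha₂).differentiableAt (H.hasFDerivAt_coeff hb₂).differentiableAt)

theorem hasFDerivAt_localFlat (ha₁ : SmoothCoeff a₁) (hb₁ : SmoothCoeff b₁) (u : E) :
    ∃ L : E × (E →L[ℝ] ℝ) →L[ℝ] E →L[ℝ] ℝ,
      HasFDerivAt (fun z : E × (E →L[ℝ] ℝ) ↦ naturalFlat (h z.1) z.2 (a₁ (localEnergy h z))
        (b₁ (localEnergy h z)) u) L z ∧ ∀ v w, L v w =
        coeffDeriv a₁ (localEnergy h z) * vertForm (h z.1) (Γ z.1) z.2 v * h z.1 u w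
          + a₁ (localEnergy h z) * (h z.1 (Γ z.1 v.1 u) w + h z.1 u (Γ z.1 v.1 w))
          + coeffDeriv b₁ (localEnergy h z) * vertForm (h z.1) (Γ z.1) z.2 v * (z.2 u * z.2 w)
          + b₁ (localEnergy h z) * (v.2 u * z.2 w + z.2 u * v.2 w) := by
  have d1 : HasFDerivAt (fun z : E × (E →L[ℝ] ℝ) ↦ h z.1) _ z :=
    HasFDerivAt.comp z (H.contDiffAt.differentiableAt two_ne_zero).hasFDerivAt hasFDerivAt_fst
  obtain ⟨L, hL, hLa⟩ := hasFDerivAt_naturalFlat d1 hasFDerivAt_snd (H.hasFDerivAt_coeff ha₁)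
    (H.hasFDerivAt_coeff hb₁) u
  refine ⟨L, hL, fun v w ↦ (hLa v w).trans ?_⟩
  simp only [smul_apply, smul_eq_mul, ContinuousLinearMap.comp_apply,
    ContinuousLinearMap.coe_fst', ContinuousLinearMap.coe_snd',
    H.leviCivita.self_of_nhds.metric]

/-- Take V, W to be the horizontal lifts of the constant fields u, v. Their bracket is vertical with
component ξ ∘ R(u, v). The bracket of the vertical fields JV, JW gives the coefficient term; the
derivative of b₁ drops out on antisymmetrizing. The mixed brackets have components -A₁Γ(v, u) and
A₁Γ(u, v), where A₁ is the horizontal-to-vertical part of J, and cancel because Γ is symmetric. -/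
theorem flatNijenhuis_horizontal (ha₁ : SmoothCoeff a₁) (hb₁ : SmoothCoeff b₁)
    (ha₂ : SmoothCoeff a₂) (hb₂ : SmoothCoeff b₂)
    (hJJ : ∀ v, localTensor h Γ a₁ b₁ a₂ b₂ z (localTensor h Γ a₁ b₁ a₂ b₂ z v) = v) (u v : E) :
    ∃ ρ : E →L[ℝ] ℝ, flatNijenhuis (localTensor h Γ a₁ b₁ a₂ b₂) z
        (u, connForm (Γ z.1) z.2 u) (v, connForm (Γ z.1) z.2 v) = (0, ρ) ∧
      ∀ w, ρ w = z.2 (localCurvature Γ z.1 u v w)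
        - (a₁ (localEnergy h z) * b₁ (localEnergy h z) - coeffDeriv a₁ (localEnergy h z) *
          (a₁ (localEnergy h z) + 2 * localEnergy h z * b₁ (localEnergy h z))) *
          (z.2 u * h z.1 v w - z.2 v * h z.1 u w) := by
  obtain ⟨K, hK, hKa⟩ := hasFDerivAt_connForm H.differentiableAt u
  obtain ⟨K', hK', hKa'⟩ := hasFDerivAt_connForm H.differentiableAt v
  obtain ⟨L, hL, hLa⟩ := H.hasFDerivAt_localFlat ha₁ hb₁ u
  obtain ⟨L', hL', hLa'⟩ := H.hasFDerivAt_localFlat ha₁ hb₁ v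
  have hlift : ∀ u (z : E × (E →L[ℝ] ℝ)),
      localTensor h Γ a₁ b₁ a₂ b₂ z (u, connForm (Γ z.1) z.2 u) =
      (0, naturalFlat (h z.1) z.2 (a₁ (localEnergy h z)) (b₁ (localEnergy h z)) u) := by
    intro u z
    rw [localTensor, liftTensor_apply, sub_self, map_zero, map_zero, add_zero]
  have hin := H.inner.self_of_nhds
  have hΓ := H.leviCivita.self_of_nhds.symm
  have hT : z.2 ((h z.1).inverse z.2) = 2 * localEnergy h z := by
    rw [localEnergy, halfSq]; ring
  have hs : ∀ u, h z.1 u ((h z.1).inverse z.2) = z.2 u := fun u ↦ by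
    rw [hin.symm, hin.apply_inverse]
  have hJ := H.differentiableAt_localTensor ha₁ hb₁ ha₂ hb₂
  have key := flatNijenhuis_of_hasFDerivAt (J := localTensor h Γ a₁ b₁ a₂ b₂)
    (κ := fun z ↦ connForm (Γ z.1) z.2 u) (η := fun z ↦ connForm (Γ z.1) z.2 v)
    (α := fun z ↦ naturalFlat (h z.1) z.2 (a₁ (localEnergy h z)) (b₁ (localEnergy h z)) u)
    (β := fun z ↦ naturalFlat (h z.1) z.2 (a₁ (localEnergy h z)) (b₁ (localEnergy h z)) v)
    hJ hK hK' hL hL' (hlift u) (hlift v) hJJ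
  beta_reduce at key
  refine ⟨_, key ?_, fun w ↦ ?_⟩
  · ext w
    simp only [add_apply, sub_apply, hKa, hKa', hLa, hLa', naturalFlat_apply, vertForm_apply,
      connForm_apply, map_zero, zero_apply, hΓ v u]
    ring
  · simp only [add_apply, sub_apply, hKa, hKa', hLa, hLa', naturalFlat_apply, vertForm_apply,
      connForm_apply, map_zero, zero_apply, hT, hs, localCurvature, map_add, map_sub,
      hin.symm v u]
    ring

theorem flatNijenhuis_localTensor_eq_zero_iff (ha₁ : SmoothCoeff a₁) (hb₁ : SmoothCoeff b₁)
    (ha₂ : SmoothCoeff a₂) (hb₂ : SmoothCoeff b₂)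
    (hJJ : ∀ᶠ z' in 𝓝 z, ∀ v,
      localTensor h Γ a₁ b₁ a₂ b₂ z' (localTensor h Γ a₁ b₁ a₂ b₂ z' v) = v) :
    (∀ v w, flatNijenhuis (localTensor h Γ a₁ b₁ a₂ b₂) z v w = 0) ↔
      ∀ u v w, z.2 (localCurvature Γ z.1 u v w) =
        (a₁ (localEnergy h z) * b₁ (localEnergy h z) - coeffDeriv a₁ (localEnergy h z) *
          (a₁ (localEnergy h z) + 2 * localEnergy h z * b₁ (localEnergy h z))) *
          (z.2 u * h z.1 v w - z.2 v * h z.1 u w) := by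
  have hz := hJJ.self_of_nhds
  rw [flatNijenhuis_eq_zero_iff (H.differentiableAt_localTensor ha₁ hb₁ ha₂ hb₂) hJJ
    (S := Set.range fun u : E ↦ (u, connForm (Γ z.1) z.2 u))]
  · simp only [Set.forall_mem_range]
    refine forall_congr' fun u ↦ forall_congr' fun v ↦ ?_
    obtain ⟨ρ, hρ, hρa⟩ := H.flatNijenhuis_horizontal ha₁ hb₁ ha₂ hb₂ hz u v
    rw [hρ]
    constructor
    · intro h0 w
      have : ρ = 0 := congrArg Prod.snd h0
      have h1 := hρa w
      rw [this, zero_apply] at h1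
      linarith
    · intro h0
      have : ρ = 0 := by
        ext w
        rw [hρa w, h0 w, sub_self, zero_apply]
      rw [this]
      rfl
  -- Subtracting the horizontal lift of `u` leaves a vertical vector. `J` sends it to the horizontal
  -- lift of `A`, so J² = 1 exhibits it as `J` of a horizontal vector.
  · rintro ⟨u, β⟩
    set A := naturalSharp (h z.1) z.2 (a₂ (localEnergy h z)) (b₂ (localEnergy h z))
      (β - connForm (Γ z.1) z.2 u) with hA
    have h1 : localTensor h Γ a₁ b₁ a₂ b₂ z (0, β - connForm (Γ z.1) z.2 u) =
        (A, connForm (Γ z.1) z.2 A) := by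
      rw [localTensor, liftTensor_apply, map_zero, map_zero, sub_zero, zero_add]
    refine ⟨_, ⟨u, rfl⟩, _, ⟨A, rfl⟩, ?_⟩
    beta_reduce
    rw [← h1, hz, Prod.mk_add_mk, add_zero, add_sub_cancel]

end IsLocalMetric

end LocalNijenhuis

/-! ### Curvature tensors are determined by their sectional values -/

section CurvatureAlgebra

/-- A quadrilinear form with the symmetries of a curvature tensor, and whose sectional values
vanish, is zero. -/
theorem eq_zero_of_curvature_symmetries {E : Type*} [AddCommGroup E] {B : E → E → E → E → ℝ}
    (add₁ : ∀ u u' v w x, B (u + u') v w x = B u v w x + B u' v w x)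
    (add₃ : ∀ u v w w' x, B u v (w + w') x = B u v w x + B u v w' x)
    (anti : ∀ u v w x, B u v w x = -B v u w x) (skew : ∀ u v w x, B u v w x = -B u v x w)
    (bianchi : ∀ u v w x, B u v w x + B v w u x + B w u v x = 0)
    (sect : ∀ u v, B u v v u = 0) (u v w x : E) : B u v w x = 0 := by
  have add₂ : ∀ u v v' w x, B u (v + v') w x = B u v w x + B u v' w x := fun u v v' w x ↦ by
    rw [anti, add₁, anti v, anti v']; ring
  have add₄ : ∀ u v w x x', B u v w (x + x') = B u v w x + B u v w x' := fun u v w x x' ↦ by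
    rw [skew, add₃, skew u v x, skew u v x']; ring
  have pair : ∀ u v w x, B u v w x = B w x u v := fun u v w x ↦ by
    linarith [bianchi u v w x, bianchi v w x u, bianchi w x u v, bianchi x u v w,
      skew u v w x, skew w x u v, skew v w u x, skew x u v w, skew w u v x, skew v x w u,
      anti w u x v, anti v x u w, skew u w x v, anti u w v x, skew x v u w, anti x v w u,
      skew w u x v, skew v x u w, skew x u w v, skew v w x u]
  -- Polarizing the sectional identity in the inner slots, then in the outer ones, makes `B` skew in
  -- its first and last arguments. With the other two skew symmetries it is alternating, and the
  -- Bianchi sum becomes 3B = 0.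
  have h1 : ∀ u v w, B u v w u = 0 := fun u v w ↦ by
    have e := sect u (v + w)
    rw [add₂, add₃, add₃, sect, sect] at e
    linarith [pair u v w u, anti w u u v, skew u w u v]
  have h2 : ∀ u v w x, B u v w x = -B x v w u := fun u v w x ↦ by
    have e := h1 (u + x) v w
    rw [add₁, add₄, add₄, h1, h1] at e
    linarith
  linarith [bianchi u v w x, anti u v w x, skew u v w x, h2 v w u x, anti x w u v, h2 w u v x,
    anti x u v w, skew v w u x, skew w u v x, anti v w u x, anti w u v x, h2 u v w x, 
    pair v w u x, pair w u v x, pair u v w x, h2 u w v x, anti u w v x, anti x w v u,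
    h2 v u w x, anti x u w v]

end CurvatureAlgebra

/-! ### Symmetries of the curvature and constant sectional curvature -/

section LocalCurvature

variable {E : Type*} [NormedAddCommGroup E] [NormedSpace ℝ E]
  {h : E → E →L[ℝ] E →L[ℝ] ℝ} {Γ : E → E →L[ℝ] E →L[ℝ] E} {y : E}

namespace IsLocalMetric

variable (H : IsLocalMetric h Γ y)
include H

/-- Γ and hence its derivatives are symmetric in the two lower arguments, so the cyclic sum cancels
in pairs. -/
theorem localCurvature_bianchi (u v w : E) :
    localCurvature Γ y u v w + localCurvature Γ y v w u + localCurvature Γ y w u v = 0 := by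
  have hΓ := H.leviCivita.self_of_nhds.symm
  have hd : ∀ u v w, fderiv ℝ Γ y u v w = fderiv ℝ Γ y u w v := by
    have e1 : ∀ v w, HasFDerivAt (fun x ↦ Γ x v w) _ y := fun v w ↦
      (H.differentiableAt.hasFDerivAt.clm_apply (hasFDerivAt_const v y)).clm_apply
        (hasFDerivAt_const w y)
    intro u v w
    have e2 : (fun x ↦ Γ x v w) =ᶠ[𝓝 y] fun x ↦ Γ x w v :=
      H.leviCivita.mono fun x hx ↦ hx.symm v w
    have e3 := (e1 v w).unique ((e1 w v).congr_of_eventuallyEq e2)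
    simpa using congrArg (fun L : E →L[ℝ] E ↦ L u) e3
  simp only [localCurvature]
  rw [hd u w v, hd w v u, hd v w u, hΓ w v, hΓ u w, hΓ v u]
  abel

/-- Differentiate the metric condition once more and use that the second derivatives of h commute;
what survives is the skew symmetry of R. -/
theorem localCurvature_skew (u v w x : E) :
    h y (localCurvature Γ y u v w) x = -h y (localCurvature Γ y u v x) w := by
  have hin := H.inner.self_of_nhds
  have hm := H.leviCivita.self_of_nhds.metric
  have hd := H.contDiffAt.differentiableAt two_ne_zero
  have hd2 : DifferentiableAt ℝ (fderiv ℝ h) y :=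
    (H.contDiffAt.fderiv_right (m := 1) (by norm_num)).differentiableAt one_ne_zero
  have key : ∀ u v, fderiv ℝ (fderiv ℝ h) y u v w x =
      (h y (Γ y u (Γ y v w)) x + h y (Γ y v w) (Γ y u x) + h y (fderiv ℝ Γ y u v w) x)
      + (h y (Γ y u w) (Γ y v x) + h y w (Γ y u (Γ y v x)) + h y w (fderiv ℝ Γ y u v x)) := by
    intro u v
    have e1 : HasFDerivAt (fun x' ↦ fderiv ℝ h x' v w x) _ y :=
      ((hd2.hasFDerivAt.clm_apply (hasFDerivAt_const v y)).clm_apply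
        (hasFDerivAt_const w y)).clm_apply (hasFDerivAt_const x y)
    have g1 : ∀ w, HasFDerivAt (fun x' ↦ Γ x' v w) _ y := fun w ↦
      (H.differentiableAt.hasFDerivAt.clm_apply (hasFDerivAt_const v y)).clm_apply
        (hasFDerivAt_const w y)
    have e2 : HasFDerivAt (fun x' ↦ h x' (Γ x' v w) x + h x' w (Γ x' v x)) _ y :=
      ((hd.hasFDerivAt.clm_apply (g1 w)).clm_apply (hasFDerivAt_const x y)).add
        ((hd.hasFDerivAt.clm_apply (hasFDerivAt_const w y)).clm_apply (g1 x))
    have e3 : (fun x' ↦ fderiv ℝ h x' v w x) =ᶠ[𝓝 y]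
        fun x' ↦ h x' (Γ x' v w) x + h x' w (Γ x' v x) :=
      H.leviCivita.mono fun x' hx' ↦ hx'.metric v w x
    have e4 := congrArg (fun L : E →L[ℝ] ℝ ↦ L u) (e1.unique (e2.congr_of_eventuallyEq e3))
    simp only [add_apply, ContinuousLinearMap.comp_apply, ContinuousLinearMap.flip_apply,
      zero_apply, map_zero, zero_add, hm] at e4
    linarith
  have hs : fderiv ℝ (fderiv ℝ h) y u v w x = fderiv ℝ (fderiv ℝ h) y v u w x := by
    rw [(H.contDiffAt.isSymmSndFDerivAt (by simp)).eq u v]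
  rw [key, key] at hs
  rw [hin.symm (localCurvature Γ y u v x)]
  simp only [localCurvature, map_add, map_sub, add_apply, sub_apply]
  linarith

/-- R minus the constant curvature model has all curvature symmetries and zero sectional values, so
it vanishes. -/
theorem sectional_eq_const_iff (c : ℝ) :
    (∀ u v, h y (localCurvature Γ y u v v) u = c * (h y u u * h y v v - h y u v ^ 2)) ↔
      ∀ u v w, localCurvature Γ y u v w = c • (h y v w • u - h y u w • v) := by
  have hin := H.inner.self_of_nhds
  constructor
  · intro hc u v w
    rw [← sub_eq_zero]
    refine hin.eq_zero_of_forall fun x ↦ ?_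
    have key := eq_zero_of_curvature_symmetries
      (B := fun u v w x ↦ h y (localCurvature Γ y u v w) x
        - c * (h y v w * h y u x - h y u w * h y v x)) ?_ ?_ ?_ ?_ ?_ ?_ u v w x
    · simp only [map_sub, map_smul, sub_apply, smul_apply, smul_eq_mul]
      linarith
    · intro u u' v w x
      simp only [localCurvature, map_add, map_sub, add_apply, sub_apply]
      ring
    · intro u v w w' x
      simp only [localCurvature, map_add, map_sub, add_apply, sub_apply]
      ring
    · intro u v w x
      simp only [localCurvature, map_add, map_sub, add_apply, sub_apply]
      ring
    · intro u v w x
      simp only [H.localCurvature_skew u v w x]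
      ring
    · intro u v w x
      have h1 := congrArg (fun a ↦ h y a x) (H.localCurvature_bianchi u v w)
      simp only [map_add, add_apply, map_zero, zero_apply] at h1
      simp only [hin.symm v u, hin.symm w u, hin.symm w v]
      linarith
    · intro u v
      simp only [hc, hin.symm v u]
      ring
  · intro hR u v
    rw [hR]
    simp only [map_sub, map_smul, sub_apply, smul_apply, smul_eq_mul, hin.symm v u]
    ring

end IsLocalMetric

end LocalCurvature

/-! ### Curvature of g in charts -/

section Chart

variable {E : Type*} [NormedAddCommGroup E] [NormedSpace ℝ E] [FiniteDimensional ℝ E]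
  {M : Type*} [TopologicalSpace M] [ChartedSpace E M] [IsManifold 𝓘(ℝ, E) ∞ M]

theorem differentiableAt_christoffel (g : Metric E M) {x : M} {y : E}
    (hy : y ∈ (extChartAt 𝓘(ℝ, E) x).target) : DifferentiableAt ℝ (christoffel g x) y := by
  have h0 := chartMetric_contDiffAt g hy
  have h1 : DifferentiableAt ℝ (fun y ↦ (chartMetric g x y).inverse) y :=
    (contDiffAt_inverse (chartMetric_isInner g hy) h0).differentiableAt (by simp)
  have h2 : DifferentiableAt ℝ (fderiv ℝ (chartMetric g x)) y :=
    (h0.fderiv_right (m := 1) (by norm_cast)).differentiableAt one_ne_zero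
  have h3 : DifferentiableAt ℝ (fun y ↦ (fderiv ℝ (chartMetric g x) y).flip) y :=
    (flipₗᵢ ℝ E E (E →L[ℝ] ℝ)).toContinuousLinearEquiv.differentiableAt.comp y h2
  have h4 : DifferentiableAt ℝ (christoffelFirst g x) y :=
    ((h2.add h3).sub ((differentiableAt_const (flipCLM E)).clm_comp h3)).const_smul (1 / 2 : ℝ)
  exact ((compL ℝ E (E →L[ℝ] ℝ) E).differentiableAt.comp y h1).clm_comp h4

theorem isLocalMetric_chart (g : Metric E M) {x : M} {y : E}
    (hy : y ∈ (extChartAt 𝓘(ℝ, E) x).target) :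
    IsLocalMetric (chartMetric g x) (christoffel g x) y := by
  have hnhds := (isOpen_extChartAt_target (I := 𝓘(ℝ, E)) x).mem_nhds hy
  exact ⟨Filter.mem_of_superset hnhds fun y hy ↦ chartMetric_isInner g hy,
    Filter.mem_of_superset hnhds fun y hy ↦ christoffel_isLeviCivitaAt g hy,
    (chartMetric_contDiffAt g hy).of_le (by norm_cast), differentiableAt_christoffel g hy⟩

theorem curvature_eq_localCurvature (g : Metric E M) (x : M) (u v w : E) :
    curvature g x u v w = localCurvature (christoffel g x) (extChartAt 𝓘(ℝ, E) x x) u v w := by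
  have hd := differentiableAt_christoffel g (mem_extChartAt_target (I := 𝓘(ℝ, E)) x)
  have h1 : ∀ v w, HasFDerivAt (fun y ↦ christoffel g x y v w) _ (extChartAt 𝓘(ℝ, E) x x) :=
    fun v w ↦ (hd.hasFDerivAt.clm_apply (hasFDerivAt_const v _)).clm_apply (hasFDerivAt_const w _)
  simp only [curvature, (h1 _ _).fderiv, localCurvature, christoffelAt]
  simp

theorem hasConstantSectionalCurvature_iff (g : Metric E M) (c : ℝ) :
    HasConstantSectionalCurvature g c ↔ ∀ (x : M) (u v w : E),
      curvature g x u v w = c • (flat g x v w • u - flat g x u w • v) := by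
  refine forall_congr' fun x ↦ ?_
  have := (isLocalMetric_chart g
    (mem_extChartAt_target (I := 𝓘(ℝ, E)) x)).sectional_eq_const_iff c
  simpa only [← curvature_eq_localCurvature, chartMetric_self] using this

end Chart

/-! ### From k = c to the formulas for b₁ and b₂ -/

section CoefficientRelations

theorem SmoothCoeff.continuousOn_coeffDeriv {f : ℝ → ℝ} (hf : SmoothCoeff f) :
    ContinuousOn (coeffDeriv f) (Set.Ici 0) :=
  ContDiffOn.continuousOn_derivWithin hf (uniqueDiffOn_Ici 0) (by norm_cast)

theorem SmoothCoeff.hasDerivWithinAt {f : ℝ → ℝ} (hf : SmoothCoeff f) {t : ℝ} (ht : 0 ≤ t) :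
    HasDerivWithinAt f (coeffDeriv f t) (Set.Ici 0) t :=
  ((hf.differentiableOn (by simp)) t ht).hasDerivWithinAt

/-- Identities obtained by dividing by t, or by testing on a nonzero covector, are extended to t = 0
with this. -/
theorem eq_of_continuousOn_Ici {f f' : ℝ → ℝ} (hf : ContinuousOn f (Set.Ici 0))
    (hf' : ContinuousOn f' (Set.Ici 0)) (heq : ∀ t, 0 < t → f t = f' t) {t : ℝ} (ht : 0 ≤ t) :
    f t = f' t := by
  rcases ht.eq_or_lt with rfl | ht
  · have h1 : Tendsto f (𝓝[>] 0) (𝓝 (f 0)) :=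
      (hf 0 Set.self_mem_Ici).mono_left (nhdsWithin_mono 0 Set.Ioi_subset_Ici_self)
    have h2 : Tendsto f' (𝓝[>] 0) (𝓝 (f' 0)) :=
      (hf' 0 Set.self_mem_Ici).mono_left (nhdsWithin_mono 0 Set.Ioi_subset_Ici_self)
    refine tendsto_nhds_unique (h1.congr' ?_) h2
    filter_upwards [self_mem_nhdsWithin] with t ht
    exact heq t ht
  · exact heq t ht

/-- A solution of a linear differential equation which does not vanish at `0` has no zeros. -/
theorem ne_zero_of_linear_ode {f f' q : ℝ → ℝ} (hq : ContinuousOn q (Set.Ici 0))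
    (hf : ∀ t, 0 ≤ t → HasDerivWithinAt f (f' t) (Set.Ici 0) t)
    (hode : ∀ t, 0 ≤ t → f' t = q t * f t) (h0 : f 0 ≠ 0) {T : ℝ} (hT : 0 ≤ T) : f T ≠ 0 := by
  intro hfT
  obtain ⟨K, hK⟩ := isCompact_Icc.exists_bound_of_continuousOn
    (hq.mono (Set.Icc_subset_Ici_self : Set.Icc 0 T ⊆ Set.Ici 0))
  have hK0 : 0 ≤ K := (norm_nonneg _).trans (hK 0 ⟨le_rfl, hT⟩)
  -- Backward uniqueness on [0, T]: vanishing at T forces `f` to be the zero solution down to 0. The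
  -- Lipschitz constant is a bound for q on the compact interval.
  have key := ODE_solution_unique_of_mem_Icc_left (v := fun t x ↦ q t * x)
    (s := fun _ ↦ Set.univ) (f := f) (g := fun _ ↦ 0) (a := 0) (b := T) (K := ⟨K, hK0⟩)
    (fun t ht ↦ ?_) (fun t ht ↦ ?_) (fun t ht ↦ ?_) (fun t ht ↦ Set.mem_univ _)
    continuousOn_const (fun t ht ↦ ?_) (fun t ht ↦ Set.mem_univ _) hfT
  · exact h0 (key ⟨le_rfl, hT⟩)
  · refine LipschitzOnWith.of_dist_le_mul fun x _ y _ ↦ ?_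
    rw [Real.dist_eq, Real.dist_eq, ← mul_sub, abs_mul]
    exact mul_le_mul_of_nonneg_right (hK t ⟨ht.1.le, ht.2⟩) (abs_nonneg _)
  · exact ((hf t ht.1).continuousWithinAt).mono Set.Icc_subset_Ici_self
  · rw [← hode t ht.1.le]
    exact ((hf t ht.1.le).hasDerivAt (Ici_mem_nhds ht.1)).hasDerivWithinAt
  · rw [mul_zero]
    exact hasDerivWithinAt_const _ _ _

variable {a₁ b₁ a₂ b₂ c₁ d₁ c₂ d₂ : ℝ → ℝ}

/-- The coefficient `a₁ b₁ - a₁' (a₁ + 2t b₁)` of the Nijenhuis tensor of the natural tensor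
field. -/
def nijenhuisCoeff (a₁ b₁ : ℝ → ℝ) (t : ℝ) : ℝ :=
  a₁ t * b₁ t - coeffDeriv a₁ t * (a₁ t + 2 * t * b₁ t)

theorem continuousOn_nijenhuisCoeff (ha₁ : SmoothCoeff a₁) (hb₁ : SmoothCoeff b₁) :
    ContinuousOn (nijenhuisCoeff a₁ b₁) (Set.Ici 0) := by
  have h1 := ContDiffOn.continuousOn ha₁
  have h2 := ContDiffOn.continuousOn hb₁
  have h3 := ha₁.continuousOn_coeffDeriv
  exact (h1.mul h2).sub (h3.mul (h1.add ((continuousOn_const.mul continuousOn_id).mul h2)))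

/-- The equation k = c is linear in b₁, with leading coefficient a₁ - 2ta₁'; the formula for b₂ then
follows from the relations between the two pairs of coefficients. The substance is that the
denominators cannot vanish: both divide, or are multiples of, a₁² + 2ct. -/
theorem nijenhuisCoeff_eq_const_iff (ha₁ : SmoothCoeff a₁) (hb₁ : SmoothCoeff b₁)
    (ha₂ : SmoothCoeff a₂) (hb₂ : SmoothCoeff b₂)
    (hrel : ∀ t, 0 ≤ t → ParaHermitianRelations a₁ b₁ a₂ b₂ c₁ d₁ c₂ d₂ t) (c : ℝ) :
    (∀ t, 0 ≤ t → nijenhuisCoeff a₁ b₁ t = c) ↔ IntegrabilityRelations a₁ b₁ a₂ b₂ c := by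
  constructor
  · intro hk
    have hne : ∀ t, 0 ≤ t → a₁ t + 2 * t * b₁ t ≠ 0 := fun t ht ↦
      left_ne_zero_of_mul_eq_one (hrel t ht).mul_radial
    have c₁' := ContDiffOn.continuousOn ha₁
    have c₂' := ContDiffOn.continuousOn hb₁
    have c₃' : ContinuousOn (fun t ↦ a₁ t + 2 * t * b₁ t) (Set.Ici 0) :=
      c₁'.add ((continuousOn_const.mul continuousOn_id).mul c₂')
    have hfac : ∀ t, 0 ≤ t → (a₁ t - 2 * t * coeffDeriv a₁ t) * (a₁ t + 2 * t * b₁ t) =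
        a₁ t ^ 2 + 2 * c * t := by
      intro t ht
      rw [← hk t ht, nijenhuisCoeff]
      ring
    -- Under k = c, f = a₁² + 2ct has f' = 2b₁(a₁ - 2ta₁'), which by `hfac` equals 2b₁f / (a₁ +
    -- 2tb₁).
    have hf0 : ∀ t, 0 ≤ t → a₁ t ^ 2 + 2 * c * t ≠ 0 := by
      intro T hT
      refine ne_zero_of_linear_ode (f := fun t ↦ a₁ t ^ 2 + 2 * c * t)
        (f' := fun t ↦ 2 * a₁ t * coeffDeriv a₁ t + 2 * c)
        (q := fun t ↦ 2 * b₁ t / (a₁ t + 2 * t * b₁ t))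
        ((continuousOn_const.mul c₂').div c₃' fun t ht ↦ hne t ht) ?_ ?_ ?_ hT
      · intro t ht
        have h1 := ((ha₁.hasDerivWithinAt ht).pow 2).add
          ((hasDerivWithinAt_id t (Set.Ici 0)).const_mul (2 * c))
        refine h1.congr_deriv ?_
        simp
      · intro t ht
        have h1 := hne t ht
        rw [← hfac t ht, div_mul_eq_mul_div, eq_div_iff h1, ← hk t ht, nijenhuisCoeff]
        ring
      · have := left_ne_zero_of_mul_eq_one (hrel 0 le_rfl).mul_orth
        simpa using this
    -- The difference of the two product relations is 2t times this identity; the case t = 0 is by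
    -- continuity.
    have hb : ∀ t, 0 ≤ t → b₂ t * (a₁ t + 2 * t * b₁ t) = -(b₁ t * a₂ t) := by
      intro t ht
      refine eq_of_continuousOn_Ici (f := fun t ↦ b₂ t * (a₁ t + 2 * t * b₁ t))
        (f' := fun t ↦ -(b₁ t * a₂ t)) ((ContDiffOn.continuousOn hb₂).mul c₃')
        (c₂'.mul (ContDiffOn.continuousOn ha₂)).neg (fun t ht ↦ ?_) ht
      have h1 := (hrel t ht.le).mul_radial
      have h2 := (hrel t ht.le).mul_orth
      refine mul_left_cancel₀ (mul_pos two_pos ht).ne' ?_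
      linear_combination h1 - h2
    have hda : ∀ t, 0 ≤ t → coeffDeriv a₁ t * a₂ t + a₁ t * coeffDeriv a₂ t = 0 := by
      intro t ht
      have h1 := (ha₁.hasDerivWithinAt ht).mul (ha₂.hasDerivWithinAt ht)
      have h2 : HasDerivWithinAt (a₁ * a₂) 0 (Set.Ici 0) t :=
        (hasDerivWithinAt_const t (Set.Ici 0) (1 : ℝ)).congr
          (fun s hs ↦ (hrel s hs).mul_orth) (hrel t ht).mul_orth
      exact (uniqueDiffOn_Ici (0 : ℝ) t ht).eq_deriv _ h1 h2
    intro t ht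
    have e1 := (hrel t ht).mul_orth
    have hd1 : a₁ t - 2 * t * coeffDeriv a₁ t ≠ 0 := by
      refine left_ne_zero_of_mul (b := a₁ t + 2 * t * b₁ t) ?_
      rw [hfac t ht]
      exact hf0 t ht
    have hs : a₁ t + 2 * c * t * a₂ t = a₂ t * (a₁ t ^ 2 + 2 * c * t) := by
      linear_combination (-a₁ t) * e1
    have hd2 : a₁ t + 2 * c * t * a₂ t ≠ 0 := by
      rw [hs]
      exact mul_ne_zero (right_ne_zero_of_mul_eq_one e1) (hf0 t ht)
    have hb1 : b₁ t * (a₁ t - 2 * t * coeffDeriv a₁ t) = a₁ t * coeffDeriv a₁ t + c := by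
      rw [← hk t ht, nijenhuisCoeff]
      ring
    refine ⟨hd1, hd2, ?_, ?_⟩
    · rw [eq_div_iff hd1, hb1]
    · rw [eq_div_iff hd2, hs, ← hfac t ht]
      have h1 := hb t ht
      have h2 := hda t ht
      linear_combination (a₂ t * (a₁ t - 2 * t * coeffDeriv a₁ t)) * h1 - a₂ t ^ 2 * hb1
        + (- a₁ t * a₂ t) * h2 + (a₁ t * coeffDeriv a₂ t) * e1
  · intro h t ht
    obtain ⟨h1, -, h2, -⟩ := h t ht
    rw [eq_div_iff h1] at h2
    rw [nijenhuisCoeff]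
    linear_combination h2

end CoefficientRelations

/-! ### The integrability and closedness criteria on T*M -/

section Global

variable {E : Type*} [NormedAddCommGroup E] [NormedSpace ℝ E] [FiniteDimensional ℝ E]
  {M : Type*} [TopologicalSpace M] [ChartedSpace E M] [IsManifold 𝓘(ℝ, E) ∞ M]
  {a₁ b₁ a₂ b₂ c₁ d₁ c₂ d₂ lam mu : ℝ → ℝ}

omit [FiniteDimensional ℝ E] in
theorem cotangent_extChartAt_self (p : CotangentBundle E M) :
    extChartAt (cotangentModel E) p p = (extChartAt 𝓘(ℝ, E) p.proj p.proj, covector p) := by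
  rw [cotangent_extChartAt_apply p p (mem_extChartAt_source _), frame_self]
  rfl

omit [FiniteDimensional ℝ E] in
theorem eventually_cotangent_base_mem (p : CotangentBundle E M) :
    ∀ᶠ z in 𝓝 (extChartAt (cotangentModel E) p p),
      z.1 ∈ (extChartAt 𝓘(ℝ, E) p.proj).target := by
  filter_upwards [extChartAt_target_mem_nhds (I := cotangentModel E) p] with z hz
  exact cotangent_mem_target_iff.1 hz

omit [FiniteDimensional ℝ E] in
theorem localEnergy_self (g : Metric E M) (p : CotangentBundle E M) :
    localEnergy (chartMetric g p.proj) (extChartAt 𝓘(ℝ, E) p.proj p.proj, covector p) =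
      halfSq (flat g p.proj) (covector p) := by
  rw [localEnergy, chartMetric_self]

theorem localTensor_localTensor {g : Metric E M}
    (hP : IsAlmostProduct (cotangentModel E) (naturalTensor g a₁ b₁ a₂ b₂))
    (p : CotangentBundle E M) {z : E × (E →L[ℝ] ℝ)}
    (hz : z.1 ∈ (extChartAt 𝓘(ℝ, E) p.proj).target) (v : E × (E →L[ℝ] ℝ)) :
    localTensor (chartMetric g p.proj) (christoffel g p.proj) a₁ b₁ a₂ b₂ z
      (localTensor (chartMetric g p.proj) (christoffel g p.proj) a₁ b₁ a₂ b₂ z v) = v := by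
  obtain ⟨e, he⟩ := coordFrame_isInvertible (cotangentModel E) (cotangent_mem_target_iff.2 hz)
  have h1 := coordFrame_naturalTensor g a₁ b₁ a₂ b₂ p hz
  have hinj : Function.Injective (coordFrame (cotangentModel E) p z) := by
    rw [← he]
    exact e.injective
  refine hinj ((h1 _).trans ?_)
  exact (congrArg (naturalTensor g a₁ b₁ a₂ b₂ _) (h1 v)).trans (hP _ _)

/-- Here the coordinate computation is read at the centre of each chart, where the frame is the
identity and the local data are those of g. -/
theorem isLocallyProduct_iff {g : Metric E M}
    (ha₁ : SmoothCoeff a₁) (hb₁ : SmoothCoeff b₁) (ha₂ : SmoothCoeff a₂) (hb₂ : SmoothCoeff b₂)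
    (hP : IsAlmostProduct (cotangentModel E) (naturalTensor g a₁ b₁ a₂ b₂)) :
    IsLocallyProduct (cotangentModel E) (naturalTensor g a₁ b₁ a₂ b₂) ↔
      ∀ (x : M) (ξ : E →L[ℝ] ℝ) (u v w : E), ξ (curvature g x u v w) =
        nijenhuisCoeff a₁ b₁ (halfSq (flat g x) ξ) *
          (ξ u * flat g x v w - ξ v * flat g x u w) := by
  have : CompleteSpace (E × (E →L[ℝ] ℝ)) := FiniteDimensional.complete ℝ _
  have key : ∀ p : CotangentBundle E M,
      (∀ V W : ∀ q : CotangentBundle E M, TangentSpace (cotangentModel E) q,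
        SmoothFieldAt (cotangentModel E) V p → SmoothFieldAt (cotangentModel E) W p →
          nijenhuis (cotangentModel E) (naturalTensor g a₁ b₁ a₂ b₂) V W p = 0) ↔
      ∀ u v w : E, covector p (curvature g p.proj u v w) =
        nijenhuisCoeff a₁ b₁ (halfSq (flat g p.proj) (covector p)) *
          (covector p u * flat g p.proj v w - covector p v * flat g p.proj u w) := by
    intro p
    have H := isLocalMetric_chart g (mem_extChartAt_target (I := 𝓘(ℝ, E)) p.proj)
    have hev := eventually_cotangent_base_mem p
    have hz := cotangent_extChartAt_self p
    have hd := IsLocalMetric.differentiableAt_localTensor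
      (z := (extChartAt 𝓘(ℝ, E) p.proj p.proj, covector p)) H ha₁ hb₁ ha₂ hb₂
    have hn := IsLocalMetric.flatNijenhuis_localTensor_eq_zero_iff
      (z := (extChartAt 𝓘(ℝ, E) p.proj p.proj, covector p)) H ha₁ hb₁ ha₂ hb₂
      (by rw [← hz]; exact hev.mono fun z hz ↦ localTensor_localTensor hP p hz)
    rw [← hz] at hd
    refine (nijenhuis_eq_zero_iff (I := cotangentModel E) hd
      (hev.mono fun z hz ↦ coordFrame_naturalTensor g a₁ b₁ a₂ b₂ p hz)).trans ?_
    rw [hz]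
    refine hn.trans ?_
    simp only [localEnergy_self, chartMetric_self, ← curvature_eq_localCurvature, nijenhuisCoeff]
  constructor
  · exact fun h x ξ ↦ (key (⟨x, ξ⟩ : CotangentBundle E M)).1 fun V W hV hW ↦
      h.2 (⟨x, ξ⟩ : CotangentBundle E M) V W hV hW
  · exact fun h ↦ ⟨hP, fun p V W hV hW ↦ (key p).2 (h p.proj (covector p)) V W hV hW⟩

/-- At a fixed x the left side is linear in ξ, while the right side is k(t) times a linear
expression. Comparing ξ with its multiples shows that k is constant, and taking ξ = y♭ for arbitrary
y recovers the full curvature tensor. -/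
theorem curvature_condition_iff (hn : 2 ≤ Module.finrank ℝ E) [Nonempty M] (g : Metric E M)
    {k : ℝ → ℝ} (hk : ContinuousOn k (Set.Ici 0)) :
    (∀ (x : M) (ξ : E →L[ℝ] ℝ) (u v w : E), ξ (curvature g x u v w) =
      k (halfSq (flat g x) ξ) * (ξ u * flat g x v w - ξ v * flat g x u w)) ↔
      ∃ c, HasConstantSectionalCurvature g c ∧ ∀ t, 0 ≤ t → k t = c := by
  constructor
  · intro h
    have : Nontrivial E := Module.nontrivial_of_finrank_pos (R := ℝ) (by omega)
    have hconst : ∀ t, 0 ≤ t → k t = k 1 := by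
      intro t ht
      refine eq_of_continuousOn_Ici hk continuousOn_const (fun t ht ↦ ?_) ht
      obtain ⟨x⟩ := ‹Nonempty M›
      have hh := flat_isInner g x
      -- The covector ξ has energy 1 and √t ξ has energy t. Both are tested with u = ξ♯ and v = w in
      -- the kernel of ξ, where the factor multiplying k is a nonzero multiple of g(v, v).
      obtain ⟨ξ, hξ⟩ := hh.exists_halfSq_eq zero_le_one
      obtain ⟨v, hv0, hv⟩ := exists_ne_zero_apply_eq_zero hn ξ
      have hs : 0 < √t := Real.sqrt_pos.2 ht
      have hst : halfSq (flat g x) (√t • ξ) = t := by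
        have h1 : halfSq (flat g x) (√t • ξ) = √t * √t * halfSq (flat g x) ξ := by
          simp only [halfSq, map_smul, smul_apply, smul_eq_mul]
          ring
        rw [h1, hξ, Real.mul_self_sqrt ht.le, mul_one]
      have hξs : ξ ((flat g x).inverse ξ) = 2 := by
        have : (1 / 2 : ℝ) * ξ ((flat g x).inverse ξ) = 1 := hξ
        linarith
      have e1 := h x ξ ((flat g x).inverse ξ) v v
      have e2 := h x (√t • ξ) ((flat g x).inverse ξ) v v
      rw [hst] at e2
      simp only [smul_apply, smul_eq_mul, e1, hv, hξs, hξ] at e2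
      have h3 : √t * (2 * flat g x v v) ≠ 0 := by
        have := hh.pos v hv0
        positivity
      refine mul_right_cancel₀ h3 ?_
      linarith
    refine ⟨k 1, (hasConstantSectionalCurvature_iff g _).2 fun x u v w ↦ ?_, hconst⟩
    have hh := flat_isInner g x
    rw [← sub_eq_zero]
    refine hh.eq_zero_of_forall fun y ↦ ?_
    have e1 := h x (flat g x y) u v w
    rw [hconst _ (hh.halfSq_nonneg _)] at e1
    rw [hh.symm]
    simp only [map_sub, map_smul, smul_eq_mul, e1]
    ring
  · rintro ⟨c, hc, hkc⟩ x ξ u v w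
    rw [(hasConstantSectionalCurvature_iff g c).1 hc, hkc _ ((flat_isInner g x).halfSq_nonneg ξ)]
    simp only [map_sub, map_smul, smul_eq_mul]
    ring

theorem isLocallyProduct_iff_constant_curvature (hn : 2 ≤ Module.finrank ℝ E) [Nonempty M]
    {g : Metric E M}
    (ha₁ : SmoothCoeff a₁) (hb₁ : SmoothCoeff b₁) (ha₂ : SmoothCoeff a₂) (hb₂ : SmoothCoeff b₂)
    (hP : IsAlmostProduct (cotangentModel E) (naturalTensor g a₁ b₁ a₂ b₂))
    (hrel : ∀ t, 0 ≤ t → ParaHermitianRelations a₁ b₁ a₂ b₂ c₁ d₁ c₂ d₂ t) :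
    IsLocallyProduct (cotangentModel E) (naturalTensor g a₁ b₁ a₂ b₂) ↔
      ∃ c : ℝ, HasConstantSectionalCurvature g c ∧ IntegrabilityRelations a₁ b₁ a₂ b₂ c := by
  rw [isLocallyProduct_iff ha₁ hb₁ ha₂ hb₂ hP,
    curvature_condition_iff hn g (continuousOn_nijenhuisCoeff ha₁ hb₁)]
  simp only [nijenhuisCoeff_eq_const_iff ha₁ hb₁ ha₂ hb₂ hrel]

theorem isClosedTwoForm_iff (hn : 2 ≤ Module.finrank ℝ E) [Nonempty M] (g : Metric E M)
    (hrel : ∀ t, 0 ≤ t → ParaHermitianRelations a₁ b₁ a₂ b₂ c₁ d₁ c₂ d₂ t)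
    (hf : AreProportionalityFactors a₁ b₁ a₂ b₂ c₁ d₁ c₂ d₂ lam mu) :
    IsClosedTwoForm (cotangentModel E) (associatedForm (cotangentModel E)
      (naturalMetric g c₁ d₁ c₂ d₂) (naturalTensor g a₁ b₁ a₂ b₂)) ↔
      ∀ t, 0 ≤ t → mu t = coeffDeriv lam t := by
  have : CompleteSpace (E × (E →L[ℝ] ℝ)) := FiniteDimensional.complete ℝ _
  have key : ∀ p : CotangentBundle E M,
      (∀ U V W : ∀ q : CotangentBundle E M, TangentSpace (cotangentModel E) q,
        SmoothFieldAt (cotangentModel E) U p → SmoothFieldAt (cotangentModel E) V p →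
        SmoothFieldAt (cotangentModel E) W p → extDerivTwoForm (cotangentModel E)
          (associatedForm (cotangentModel E) (naturalMetric g c₁ d₁ c₂ d₂)
            (naturalTensor g a₁ b₁ a₂ b₂)) U V W p = 0) ↔
      ∀ u v w : E × (E →L[ℝ] ℝ), (coeffDeriv lam (halfSq (flat g p.proj) (covector p))
          - mu (halfSq (flat g p.proj) (covector p))) *
        (vertForm (flat g p.proj) (christoffelAt g p.proj) (covector p) u * canonicalForm E v w
        - vertForm (flat g p.proj) (christoffelAt g p.proj) (covector p) v * canonicalForm E u w
        + vertForm (flat g p.proj) (christoffelAt g p.proj) (covector p) w *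
          canonicalForm E u v) = 0 := by
    intro p
    have H := isLocalMetric_chart g (mem_extChartAt_target (I := 𝓘(ℝ, E)) p.proj)
    have hev := eventually_cotangent_base_mem p
    have hz := cotangent_extChartAt_self p
    obtain ⟨hd, he⟩ := IsLocalMetric.flatExtDeriv_localForm
      (z := (extChartAt 𝓘(ℝ, E) p.proj p.proj, covector p)) H hf.smooth_lam hf.smooth_mu
    rw [← hz] at hd
    refine (extDerivTwoForm_eq_zero_iff (I := cotangentModel E) hd
      (localForm_antisymm lam mu)
      (hev.mono fun z hz ↦ associatedForm_coordFrame g hrel hf p hz)).trans ?_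
    rw [hz]
    simp only [he, localEnergy_self, chartMetric_self]
    rfl
  constructor
  · intro h t ht
    refine eq_of_continuousOn_Ici (ContDiffOn.continuousOn hf.smooth_mu)
      hf.smooth_lam.continuousOn_coeffDeriv (fun t ht ↦ ?_) ht
    have : Nontrivial E := Module.nontrivial_of_finrank_pos (R := ℝ) (by omega)
    obtain ⟨x⟩ := ‹Nonempty M›
    have hh := flat_isInner g x
    obtain ⟨ξ, hξ⟩ := hh.exists_halfSq_eq ht.le
    obtain ⟨v, hv0, hv⟩ := exists_ne_zero_apply_eq_zero hn ξ
    -- The test vectors are ξ^V, v^H, (v♭)^V with ξ(v) = 0. Then dt(ξ^V) = 2t and ω(v^H, (v♭)^V) =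
    -- g(v, v), while dt(v^H) = 0 and ω(ξ^V, v^H) = 0 remove the other two terms of dt ∧ ω.
    have e1 := (key (⟨x, ξ⟩ : CotangentBundle E M)).1
      (fun U V W hU hV hW ↦ h (⟨x, ξ⟩ : CotangentBundle E M) U V W hU hV hW)
      (0, ξ) (v, connForm (christoffelAt g x) ξ v) (0, flat g x v)
    have e2 : (coeffDeriv lam (halfSq (flat g x) ξ) - mu (halfSq (flat g x) ξ)) *
        (vertForm (flat g x) (christoffelAt g x) ξ (0, ξ) *
            canonicalForm E (v, connForm (christoffelAt g x) ξ v) (0, flat g x v)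
          - vertForm (flat g x) (christoffelAt g x) ξ (v, connForm (christoffelAt g x) ξ v) *
            canonicalForm E (0, ξ) (0, flat g x v)
          + vertForm (flat g x) (christoffelAt g x) ξ (0, flat g x v) *
            canonicalForm E (0, ξ) (v, connForm (christoffelAt g x) ξ v)) = 0 := e1
    have hξs : ξ ((flat g x).inverse ξ) = 2 * t := by rw [← hξ, halfSq]; ring
    simp only [vertForm_apply, canonicalForm_apply, hξ, map_zero, sub_zero, sub_self, zero_apply,
      hv, mul_zero, add_zero, hξs] at e2
    have h3 := (mul_eq_zero.1 e2).resolve_right (by have := hh.pos v hv0; positivity)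
    linarith
  · intro h p U V W hU hV hW
    refine (key p).2 (fun u v w ↦ ?_) U V W hU hV hW
    rw [h _ ((flat_isInner g p.proj).halfSq_nonneg (covector p)), sub_self, zero_mul]

end Global

end ParaKahlerCotangent

end

/-! ### The main theorem -/

theorem theorem5p2
    {E : Type*} [NormedAddCommGroup E] [NormedSpace ℝ E] [FiniteDimensional ℝ E]
    {M : Type*} [TopologicalSpace M] [ChartedSpace E M] [IsManifold 𝓘(ℝ, E) ∞ M] [Nonempty M]
    (hn : 2 ≤ Module.finrank ℝ E)
    (g : Metric E M)
    (a₁ b₁ a₂ b₂ c₁ d₁ c₂ d₂ : ℝ → ℝ)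
    (ha₁ : SmoothCoeff a₁) (hb₁ : SmoothCoeff b₁)
    (ha₂ : SmoothCoeff a₂) (hb₂ : SmoothCoeff b₂)
    (hc₁ : SmoothCoeff c₁) (hd₁ : SmoothCoeff d₁)
    (hc₂ : SmoothCoeff c₂) (hd₂ : SmoothCoeff d₂)
    (hGP : IsAlmostParaHermitian (cotangentModel E)
      (naturalMetric g c₁ d₁ c₂ d₂)
      (naturalTensor g a₁ b₁ a₂ b₂)) :
    (∃ lam mu : ℝ → ℝ,
      AreProportionalityFactors a₁ b₁ a₂ b₂ c₁ d₁ c₂ d₂ lam mu) ∧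
    ∀ lam mu : ℝ → ℝ,
      AreProportionalityFactors a₁ b₁ a₂ b₂ c₁ d₁ c₂ d₂ lam mu →
      (IsParaKahler (cotangentModel E)
          (naturalMetric g c₁ d₁ c₂ d₂)
          (naturalTensor g a₁ b₁ a₂ b₂) ↔
        IsLocallyProduct (cotangentModel E)
            (naturalTensor g a₁ b₁ a₂ b₂) ∧
          ∀ t, 0 ≤ t → mu t = coeffDeriv lam t) ∧
      (IsLocallyProduct (cotangentModel E)
          (naturalTensor g a₁ b₁ a₂ b₂) ↔
        ∃ c : ℝ, HasConstantSectionalCurvature g c ∧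
          IntegrabilityRelations a₁ b₁ a₂ b₂ c) := by
  have hrel := fun t (ht : 0 ≤ t) ↦ paraHermitianRelations hn g hGP ht
  refine ⟨exists_proportionalityFactors ha₁ hb₁ hc₁ hd₁ hrel, fun lam mu hf ↦ ⟨?_,
    isLocallyProduct_iff_constant_curvature hn ha₁ hb₁ ha₂ hb₂ hGP.almostProduct hrel⟩⟩
  have hclosed := isClosedTwoForm_iff hn g hrel hf
  exact ⟨fun h ↦ ⟨h.2, hclosed.1 h.1.2⟩, fun h ↦ ⟨⟨hGP, hclosed.2 h.2⟩, h.1⟩⟩
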